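/- Let $\mathbb{T}^\infty=\{(w_1,w_2,\dots):|w_j|=1\}$ with its product topology and normalised Haar measure $dm$, and let $\mathbb{Z}^\infty_0$ be the set of integer sequences $\nu=(\nu_1,\nu_2,\dots)$ with finitely many nonzero entries, $\mathbb{N}^\infty_0$ the subset of those with all $\nu_j\ge 0$. For $\nu\in\mathbb{Z}^\infty_0$ write $w^\nu=\prod_j w_j^{\nu_j}$. For a finite complex Borel measure $\mu$ on $\mathbb{T}^\infty$ (or $f\in L^1(\mathbb{T}^\infty)$) let $\widehat\mu(\nu)=\int \overline{w^\nu}\,d\mu(w)$ (or $\widehat f(\nu)=\int f\,\overline{w^\nu}\,dm$); the spectrum is the set of $\nu$ with nonzero coefficient. $H^1(\mathbb{T}^\infty)$ is the space of $f\in L^1(\mathbb{T}^\infty)$ with spectrum in $\mathbb{N}^\infty_0$, with the $L^1$ norm. Let $(m_j)_{j\ge1}$ be a sequence of positive integers with $\sum_{j} r^{m_j}<\infty$ for all $0\le r<1$. For $\xi=re^{it}$ in the open unit disc $\mathbb{D}$ put $$\mu_\xi(w)=\sum_{\nu\in\mathbb{Z}^\infty_0}\widehat\mu(\nu)\,r^{\sum_j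 m_j|\nu_j|}\,e^{it\sum_j m_j\nu_j}\,w^\nu ,$$ that is, the polyharmonic extension of $\mu$ evaluated at $(\xi^{m_1}w_1,\xi^{m_2}w_2,\dots)$; define $f_\xi$ in the same way from $\widehat f$, and let $M\mu(w)=\sup_{0<r<1}|\mu_r(w)|$ and $Mf(w)=\sup_{0<r<1}|f_r(w)|$. Then the series defining $\mu_\xi$ converges absolutely for all $\xi\in\mathbb{D}$, $w\in\mathbb{T}^\infty$, and $\mu_\xi$ is continuous on $\mathbb{T}^\infty$. Moreover, the following hold. (i) For every finite complex Borel measure $\mu$, $\int|\mu_\xi|\,dm\le\|\mu\|_{TV}$ for all $\xi\in\mathbb{D}$, and $\mu_r\,dm\to\mu$ weak-$*$ as $r\nearrow1$. (ii) There is $C<\infty$ such that for all finite complex Borel measures $\mu$ with spectrum in $\mathbb{N}^\infty_0\cup(-\mathbb{N}^\infty_0)$ and all $\lambda>0$, $m(\{M\mu>\lambda\})\le C\|\mu\|_{TV}/\lambda$. Moreover, for every such $\mu$ the finite limit $\lim_{r\to1^-}\mu_r(w)$ exists for a.e. $w$. (iii) If $f\in L^1(\mathbb{T}^\infty)$ has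 spectrum in $\mathbb{N}^\infty_0\cup(-\mathbb{N}^\infty_0)$, then $\lim_{r\to1^-}f_r(w)=f(w)$ for a.e. $w$, and $\|f_r-f\|_1\to0$ as $r\nearrow1$. (iv) There is $C<\infty$ such that $\|Mf\|_1\le C\|f\|_1$ for all $f\in H^1(\mathbb{T}^\infty)$; and there is $C<\infty$ such that $\|M\mu\|_1\le C\|\mu\|_{TV}$ for all finite complex Borel measures $\mu$ with spectrum in $\mathbb{N}^\infty_0$. (v) If $d\mu=f\,dm+d\mu_s$ with $f\in L^1(\mathbb{T}^\infty)$, $\mu_s$ a finite complex Borel measure singular with respect to $m$, and both $f$ and $\mu_s$ have spectrum in $\mathbb{N}^\infty_0\cup(-\mathbb{N}^\infty_0)$, then $\lim_{r\to1^-}\mu_r(w)=f(w)$ for a.e. $w$. -/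

import Mathlib

open MeasureTheory Filter Topology
open scoped ENNReal NNReal ComplexConjugate

noncomputable section

namespace InfPolydisc

/-- The circle carries its Borel `σ`-algebra; the product `σ`-algebra on `ℕ → Circle` is then the
Borel `σ`-algebra of the product topology. -/
instance circleMeasurableSpace : MeasurableSpace Circle := borel Circle

instance circleBorelSpace : BorelSpace Circle := ⟨rfl⟩

/-- The infinite torus `𝕋^∞`, a compact abelian group with the product topology. -/
abbrev Torus : Type := ℕ → Circle

/-- The normalised Haar measure on `𝕋^∞`: the unique translation invariant Borel probability
measure, that is, the product of the normalised Haar measures on the factors. -/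
def haar : Measure Torus :=
  Measure.haarMeasure (⊤ : TopologicalSpace.PositiveCompacts Torus)

/-- The polyharmonic monomial attached to a finitely supported multi-index `ν ∈ ℤ^∞_0`.
For `z_j = ρ_j e^{iθ_j}` its value is `∏_j ρ_j^{|ν_j|} e^{i ν_j θ_j}`. -/
def monomial (ν : ℕ →₀ ℤ) (z : ℕ → ℂ) : ℂ :=
  ν.prod fun j n => if 0 ≤ n then z j ^ n.natAbs else conj (z j) ^ n.natAbs

/-- The character `e^{iθ} ↦ e^{iν·θ}` of the infinite torus. -/
def character (ν : ℕ →₀ ℤ) (w : Torus) : ℂ :=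
  monomial ν fun j => (w j : ℂ)

/-- The integral `∫ g dμ` of a complex function against a complex measure. -/
def cintegral (μ : ComplexMeasure Torus) (g : Torus → ℂ) : ℂ :=
  μ.integral g (ContinuousLinearMap.mul ℝ ℂ)

/-- The total variation norm of a complex measure. -/
def tvNorm (μ : ComplexMeasure Torus) : ℝ≥0∞ :=
  μ.variation Set.univ

/-- The Fourier coefficients of a complex Borel measure. -/
def measureFourier (μ : ComplexMeasure Torus) (ν : ℕ →₀ ℤ) : ℂ :=
  cintegral μ fun w => conj (character ν w)

/-- The Fourier coefficients of a function in `L¹(𝕋^∞)`. -/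
def functionFourier (f : Torus → ℂ) (ν : ℕ →₀ ℤ) : ℂ :=
  ∫ w, f w * conj (character ν w) ∂haar

/-- The Fourier spectrum is contained in `ℕ^∞_0 ∪ (-ℕ^∞_0)`. -/
def HasOneSignedSpectrum (a : (ℕ →₀ ℤ) → ℂ) : Prop :=
  ∀ ν, a ν ≠ 0 → 0 ≤ ν ∨ ν ≤ 0

/-- The Fourier spectrum is contained in `ℕ^∞_0`. -/
def HasAnalyticSpectrum (a : (ℕ →₀ ℤ) → ℂ) : Prop :=
  ∀ ν, a ν ≠ 0 → 0 ≤ ν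

/-- The Hardy space `H¹(𝕋^∞)`; its norm is the norm of `L¹(𝕋^∞)`. -/
def MemHardyOne (f : Torus → ℂ) : Prop :=
  Integrable f haar ∧ HasAnalyticSpectrum (functionFourier f)

/-- The point `(ξ^{m_0} w_0, ξ^{m_1} w_1, …)`. -/
def approach (m : ℕ → ℕ) (ξ : ℂ) (w : Torus) : ℕ → ℂ :=
  fun j => ξ ^ m j * (w j : ℂ)

/-- The polyharmonic extension `∑_ν a_ν ρ^{|ν|} e^{iν·θ}` of the Fourier series with coefficients
`a`, at the point `z = (ρ_j e^{iθ_j})_j`. -/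
def polyExtension (a : (ℕ →₀ ℤ) → ℂ) (z : ℕ → ℂ) : ℂ :=
  ∑' ν : ℕ →₀ ℤ, a ν * monomial ν z

/-- The function `w ↦ μ_ξ(w)` (or `f_ξ(w)`), where `a` are the Fourier coefficients of
`μ` (or of `f`). -/
def dilate (m : ℕ → ℕ) (a : (ℕ →₀ ℤ) → ℂ) (ξ : ℂ) (w : Torus) : ℂ :=
  polyExtension a (approach m ξ w)

/-- The radial maximal function `sup_{0 < r < 1} |μ_r(w)|`. -/
def maximal (m : ℕ → ℕ) (a : (ℕ →₀ ℤ) → ℂ) (w : Torus) : ℝ≥0∞ :=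
  ⨆ r ∈ Set.Ioo (0 : ℝ) 1, ‖dilate m a (r : ℂ) w‖ₑ

end InfPolydisc

end

open InfPolydisc

noncomputable section

namespace InfPolydisc

section

/-! ### The Poisson kernel of the circle as a Fourier series -/

theorem hasSum_poisson {x : ℝ} (hx0 : 0 ≤ x) (hx1 : x < 1) (w : Circle) :
    HasSum (fun n : ℤ => (x : ℂ) ^ n.natAbs * (w : ℂ) ^ n)
      (((1 - x ^ 2) / ‖1 - (x : ℂ) * w‖ ^ 2 : ℝ) : ℂ) := by
  have hw : ‖(w : ℂ)‖ = 1 := Circle.norm_coe w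
  have hz : ‖(x : ℂ) * w‖ < 1 := by
    rw [norm_mul, hw, mul_one, Complex.norm_real, Real.norm_of_nonneg hx0]; exact hx1
  have hz' : ‖(x : ℂ) * conj (w : ℂ)‖ < 1 := by
    rw [norm_mul, Complex.norm_conj, hw, mul_one, Complex.norm_real, Real.norm_of_nonneg hx0]
    exact hx1
  have h1 := hasSum_geometric_of_norm_lt_one hz
  have h2 := hasSum_geometric_of_norm_lt_one hz'
  have hne : (1 : ℂ) - x * w ≠ 0 := by
    intro h
    rw [sub_eq_zero] at h
    rw [← h] at hz; simp at hz
  have hne' : (1 : ℂ) - x * conj (w : ℂ) ≠ 0 := by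
    intro h
    rw [sub_eq_zero] at h
    rw [← h] at hz'; simp at hz'
  have hww : (w : ℂ) * conj (w : ℂ) = 1 := by
    rw [Complex.mul_conj, Complex.normSq_eq_norm_sq, hw]; simp
  have h := HasSum.of_nat_of_neg (f := fun n : ℤ => (x : ℂ) ^ n.natAbs * (w : ℂ) ^ n)
    (g := (1 - (x : ℂ) * w)⁻¹) (g' := (1 - (x : ℂ) * conj (w : ℂ))⁻¹)
    (by simpa [mul_pow] using h1)
    (by
      refine h2.congr_fun fun n => ?_
      rw [mul_pow, ← Circle.coe_inv_eq_conj, Circle.coe_inv]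
      simp)
  have hn : ((‖1 - (x : ℂ) * w‖ ^ 2 : ℝ) : ℂ) = (1 - x * w) * (1 - x * conj (w : ℂ)) := by
    rw [← Complex.normSq_eq_norm_sq, ← Complex.mul_conj]; simp
  have e : (((1 - x ^ 2) / ‖1 - (x : ℂ) * w‖ ^ 2 : ℝ) : ℂ) = (1 - (x : ℂ) * w)⁻¹ +
      (1 - (x : ℂ) * conj (w : ℂ))⁻¹ - (x : ℂ) ^ (0 : ℤ).natAbs * (w : ℂ) ^ (0 : ℤ) := by
    rw [Complex.ofReal_div, hn]
    simp only [Int.natAbs_zero, pow_zero, zpow_zero, mul_one]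
    field_simp
    push_cast
    linear_combination ((x : ℂ) ^ 2) * hww
  rw [e]
  exact h

theorem tsum_pow_natAbs_le {x : ℝ} (hx0 : 0 ≤ x) (hx1 : x < 1) (s : Finset ℤ) :
    ∑ n ∈ s, x ^ n.natAbs ≤ Real.exp (2 * x / (1 - x)) := by
  have h := hasSum_poisson hx0 hx1 1
  have h' : HasSum (fun n : ℤ => x ^ n.natAbs) ((1 - x ^ 2) / ‖1 - (x : ℂ) * (1 : Circle)‖ ^ 2) := by
    rw [← Complex.hasSum_ofReal]
    simpa using h
  refine (sum_le_hasSum s (fun i _ => by positivity) h').trans ?_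
  have hpos : 0 < 1 - x := by linarith
  have : ‖1 - (x : ℂ) * (1 : Circle)‖ = 1 - x := by
    rw [Circle.coe_one, mul_one, ← Complex.ofReal_one, ← Complex.ofReal_sub, Complex.norm_real,
      Real.norm_of_nonneg hpos.le]
  rw [this]
  refine le_trans (le_of_eq ?_) (Real.add_one_le_exp _)
  field_simp
  ring

/-! ### Sums of products over finitely supported sequences -/

theorem sum_finsupp_prod {R : Type*} [CommSemiring R] (s : Finset ℕ) (t : ℕ → Finset ℤ)
    (f : ℕ → ℤ → R) (hf : ∀ j, f j 0 = 1) :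
    ∑ ν ∈ s.finsupp t, ν.prod f = ∏ j ∈ s, ∑ n ∈ t j, f j n := by
  classical
  rw [Finset.prod_sum, Finset.finsupp, Finset.sum_map]
  refine Finset.sum_congr (by congr!) fun p _ => ?_
  have h : (Finsupp.indicator s p).support ⊆ s := Finsupp.support_indicator_subset _ _
  rw [Function.Embedding.coeFn_mk, Finsupp.prod_of_support_subset _ h _ fun i _ => hf i,
    ← Finset.prod_attach]
  refine Finset.prod_congr rfl fun x _ => ?_
  rw [Finsupp.indicator_of_mem x.2]

/-- The finite set of multi-indices with support in `{0, …, n - 1}` and entries bounded by `n`. -/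
def box (n : ℕ) : Finset (ℕ →₀ ℤ) :=
  (Finset.range n).finsupp fun _ => Finset.Icc (-(n : ℤ)) n

theorem mem_box {n : ℕ} {ν : ℕ →₀ ℤ} :
    ν ∈ box n ↔ ν.support ⊆ Finset.range n ∧ ∀ j, ν j ∈ Finset.Icc (-(n : ℤ)) n := by
  rw [box, Finset.mem_finsupp_iff]
  refine and_congr_right fun h => ⟨fun h' j => ?_, fun h' j _ => h' j⟩
  by_cases hj : j ∈ Finset.range n
  · exact h' j hj
  · have : ν j = 0 := by
      by_contra h0
      exact hj (h (Finsupp.mem_support_iff.2 h0))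
    simp [this]

theorem box_mono : Monotone box := by
  intro a b hab ν hν
  rw [mem_box] at hν ⊢
  refine ⟨hν.1.trans (Finset.range_mono hab), fun j => ?_⟩
  have := hν.2 j
  rw [Finset.mem_Icc] at this ⊢
  have : (a : ℤ) ≤ b := by exact_mod_cast hab
  constructor <;> omega

theorem tendsto_box : Tendsto box atTop atTop := by
  refine tendsto_atTop_finset_of_monotone box_mono fun ν => ?_
  refine ⟨ν.support.sup id + 1 + ∑ j ∈ ν.support, (ν j).natAbs, mem_box.2 ⟨fun j hj => ?_, ?_⟩⟩
  · have : j ≤ ν.support.sup id := Finset.le_sup (f := id) hj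
    rw [Finset.mem_range]; omega
  · intro j
    rw [Finset.mem_Icc]
    have : (ν j).natAbs ≤ ∑ j ∈ ν.support, (ν j).natAbs := by
      by_cases hj : j ∈ ν.support
      · exact Finset.single_le_sum (f := fun j => (ν j).natAbs) (fun _ _ => Nat.zero_le _) hj
      · rw [Finsupp.notMem_support_iff.1 hj]; simp
    constructor <;> omega

/-! ### Characters -/

theorem character_apply (ν : ℕ →₀ ℤ) (w : Torus) :
    character ν w = ν.prod fun j n => (w j : ℂ) ^ n := by
  unfold character monomial
  refine Finsupp.prod_congr fun j _ => ?_
  split_ifs with h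
  · rw [← zpow_natCast, Int.natAbs_of_nonneg h]
  · rw [← Circle.coe_inv_eq_conj, Circle.coe_inv, inv_pow, ← zpow_natCast, ← zpow_neg]
    congr 1; omega

theorem character_eq_coe (ν : ℕ →₀ ℤ) (w : Torus) :
    character ν w = ((ν.prod fun j n => (w j) ^ n : Circle) : ℂ) := by
  rw [character_apply, Finsupp.prod, Finsupp.prod]
  refine Eq.trans ?_ (map_prod Circle.coeHom _ _).symm
  exact Finset.prod_congr rfl fun j _ => (Circle.coe_zpow _ _).symm

@[simp] theorem norm_character (ν : ℕ →₀ ℤ) (w : Torus) : ‖character ν w‖ = 1 := by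
  rw [character_eq_coe, Circle.norm_coe]

theorem character_mul (ν : ℕ →₀ ℤ) (w v : Torus) :
    character ν (w * v) = character ν w * character ν v := by
  simp only [character_apply, Pi.mul_apply, Circle.coe_mul, mul_zpow, Finsupp.prod_mul]

theorem character_inv (ν : ℕ →₀ ℤ) (w : Torus) : character ν w⁻¹ = conj (character ν w) := by
  rw [character_eq_coe, character_eq_coe, ← Circle.coe_inv_eq_conj]
  simp [Finsupp.prod]

theorem character_div (ν : ℕ →₀ ℤ) (w v : Torus) :
    character ν (w / v) = character ν w * conj (character ν v) := by
  rw [div_eq_mul_inv, character_mul, character_inv]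

theorem character_neg (ν : ℕ →₀ ℤ) (w : Torus) : character (-ν) w = conj (character ν w) := by
  rw [character_eq_coe, character_eq_coe, ← Circle.coe_inv_eq_conj]
  simp [Finsupp.prod]

theorem character_add (ν κ : ℕ →₀ ℤ) (w : Torus) :
    character (ν + κ) w = character ν w * character κ w := by
  rw [character_apply, character_apply, character_apply]
  exact Finsupp.prod_add_index' (fun _ => zpow_zero _)
    fun j a b => zpow_add₀ (Circle.coe_ne_zero _) a b

@[simp] theorem character_zero (w : Torus) : character 0 w = 1 := by simp [character_apply]

@[simp] theorem character_one (ν : ℕ →₀ ℤ) : character ν 1 = 1 := by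
  simp [character_apply, Finsupp.prod]

@[fun_prop] theorem continuous_character (ν : ℕ →₀ ℤ) : Continuous (character ν) := by
  have : character ν = fun w => ((ν.prod fun j n => (w j) ^ n : Circle) : ℂ) :=
    funext fun w => character_eq_coe ν w
  rw [this]
  unfold Finsupp.prod
  fun_prop

theorem character_single (j : ℕ) (w : Torus) :
    character (Finsupp.single j 1) w = w j := by
  rw [character_apply, Finsupp.prod_single_index] <;> simp

instance : haar.IsMulLeftInvariant := by unfold haar; infer_instance

instance : IsProbabilityMeasure haar :=
  ⟨by
    have := Measure.haarMeasure_self (K₀ := (⊤ : TopologicalSpace.PositiveCompacts Torus))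
    simpa [haar] using this⟩

theorem integrable_of_continuous {f : Torus → ℂ} (hf : Continuous f) (ρ : Measure Torus)
    [IsFiniteMeasure ρ] : Integrable f ρ :=
  hf.integrable_of_hasCompactSupport (HasCompactSupport.of_compactSpace f)

theorem integral_character {ν : ℕ →₀ ℤ} (hν : ν ≠ 0) : ∫ w, character ν w ∂haar = 0 := by
  obtain ⟨w₀, h₀⟩ : ∃ w₀ : Torus, character ν w₀ ≠ 1 := by
    obtain ⟨j, hj⟩ : ∃ j, ν j ≠ 0 := by
      by_contra! h
      exact hν (Finsupp.ext h)
    refine ⟨Pi.mulSingle j (Circle.exp (1 / ν j)), ?_⟩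
    have hval : character ν (Pi.mulSingle j (Circle.exp (1 / ν j))) = Circle.exp 1 := by
      rw [character_eq_coe, Finsupp.prod,
        Finset.prod_eq_single_of_mem j (Finsupp.mem_support_iff.2 hj)]
      · rw [Pi.mulSingle_eq_same, ← Circle.exp_zsmul]
        congr 2
        rw [zsmul_eq_mul]
        field_simp
      · intro i _ hi
        rw [Pi.mulSingle_eq_of_ne hi, one_zpow]
    rw [hval]
    intro h
    have h' : Circle.exp 1 = 1 := Circle.coe_inj.1 (by simpa using h)
    rw [Circle.exp_eq_one] at h'
    obtain ⟨n, hn⟩ := h'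
    have h3 := Real.pi_gt_three
    rcases lt_trichotomy n 0 with h | h | h
    · have : (n : ℝ) ≤ 0 := by exact_mod_cast h.le
      nlinarith
    · simp [h] at hn
    · have : (1 : ℝ) ≤ n := by exact_mod_cast h
      nlinarith
  have h := integral_mul_left_eq_self (μ := haar) (fun w => character ν w) w₀
  simp only [character_mul] at h
  rw [integral_const_mul] at h
  have : (character ν w₀ - 1) * ∫ w, character ν w ∂haar = 0 := by rw [sub_mul, h]; ring
  exact (mul_eq_zero.1 this).resolve_left (sub_ne_zero.2 h₀)

/-! ### Weights, degrees and the flow -/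

/-- The weighted length `∑ m_j |ν_j|`. -/
def wt (m : ℕ → ℕ) (ν : ℕ →₀ ℤ) : ℕ := ν.sum fun j n => m j * n.natAbs

/-- The weighted degree `∑ m_j ν_j`. -/
def deg (m : ℕ → ℕ) (ν : ℕ →₀ ℤ) : ℤ := ν.sum fun j n => m j * n

/-- The flow `t ↦ (e^{2πi m_j t} w_j)_j` on the infinite torus. -/
def flow (m : ℕ → ℕ) (t : UnitAddCircle) (w : Torus) : Torus :=
  fun j => AddCircle.toCircle t ^ m j * w j

theorem character_flow (m : ℕ → ℕ) (ν : ℕ →₀ ℤ) (t : UnitAddCircle) (w : Torus) :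
    character ν (flow m t w) = fourier (deg m ν) t * character ν w := by
  have : flow m t w = (fun j => AddCircle.toCircle t ^ m j) * w := rfl
  rw [this, character_mul]
  congr 1
  rw [character_eq_coe, fourier_apply, AddCircle.toCircle_zsmul, Finsupp.prod, deg, Finsupp.sum]
  congr 1
  have h (s : Finset ℕ) : AddCircle.toCircle t ^ ∑ j ∈ s, (m j : ℤ) * ν j =
      ∏ j ∈ s, (AddCircle.toCircle t ^ m j) ^ ν j := by
    induction s using Finset.induction_on with
    | empty => simp
    | insert a s ha ih =>
      rw [Finset.sum_insert ha, Finset.prod_insert ha, zpow_add, ih, zpow_mul, zpow_natCast]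
  exact (h _).symm

theorem monomial_approach (m : ℕ → ℕ) (ν : ℕ →₀ ℤ) (ξ : ℂ) (w : Torus) :
    monomial ν (approach m ξ w) = monomial ν (approach m ξ 1) * character ν w := by
  unfold character monomial approach
  rw [← Finsupp.prod_mul]
  refine Finsupp.prod_congr fun j _ => ?_
  split_ifs <;> simp [mul_pow]

theorem norm_monomial_approach (m : ℕ → ℕ) (ν : ℕ →₀ ℤ) (ξ : ℂ) (w : Torus) :
    ‖monomial ν (approach m ξ w)‖ = ‖ξ‖ ^ wt m ν := by
  unfold monomial approach wt
  rw [Finsupp.prod, Finsupp.sum, norm_prod, ← Finset.prod_pow_eq_pow_sum]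
  refine Finset.prod_congr rfl fun j _ => ?_
  split_ifs <;> rw [norm_pow, pow_mul] <;> simp [Circle.norm_coe]

theorem monomial_approach_real (m : ℕ → ℕ) (ν : ℕ →₀ ℤ) (r : ℝ) (w : Torus) :
    monomial ν (approach m r w) = (r : ℂ) ^ wt m ν * character ν w := by
  rw [monomial_approach]
  congr 1
  unfold monomial approach wt
  rw [Finsupp.prod, Finsupp.sum, ← Finset.prod_pow_eq_pow_sum]
  refine Finset.prod_congr rfl fun j _ => ?_
  split_ifs <;> simp [pow_mul]

end

section

/-! ### Absolute convergence -/

theorem summable_pow_wt {m : ℕ → ℕ} (hm : ∀ j, 0 < m j)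
    (hsum : ∀ r : ℝ, 0 ≤ r → r < 1 → Summable fun j => r ^ m j) {r : ℝ} (hr0 : 0 ≤ r)
    (hr1 : r < 1) : Summable fun ν : ℕ →₀ ℤ => r ^ wt m ν := by
  have hle (j : ℕ) : r ^ m j ≤ r := pow_le_of_le_one hr0 hr1.le (hm j).ne'
  have hs : Summable fun j => 2 * r ^ m j / (1 - r ^ m j) := by
    refine Summable.of_nonneg_of_le (fun j => ?_) (fun j => ?_)
      ((hsum r hr0 hr1).mul_left (2 / (1 - r)))
    · have : r ^ m j < 1 := (hle j).trans_lt hr1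
      exact div_nonneg (by positivity) (by linarith)
    · have h1 : 0 < 1 - r := by linarith
      rw [div_mul_eq_mul_div]
      have := hle j
      gcongr
  have hprod (ν : ℕ →₀ ℤ) : r ^ wt m ν = ν.prod fun j n => (r ^ m j) ^ n.natAbs := by
    rw [wt, Finsupp.prod, Finsupp.sum, ← Finset.prod_pow_eq_pow_sum]
    exact Finset.prod_congr rfl fun j _ => pow_mul _ _ _
  refine summable_of_sum_le (c := Real.exp (∑' j, 2 * r ^ m j / (1 - r ^ m j)))
    (fun ν => by positivity) fun F => ?_
  obtain ⟨B, hB⟩ := (tendsto_box.eventually_ge_atTop F).exists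
  refine (Finset.sum_le_sum_of_subset_of_nonneg hB fun ν _ _ => by positivity).trans ?_
  simp only [hprod]
  rw [box, sum_finsupp_prod _ _ _ (by simp)]
  calc ∏ j ∈ Finset.range B, ∑ n ∈ Finset.Icc (-(B : ℤ)) B, (r ^ m j) ^ n.natAbs
      ≤ ∏ j ∈ Finset.range B, Real.exp (2 * r ^ m j / (1 - r ^ m j)) :=
        Finset.prod_le_prod (fun j _ => Finset.sum_nonneg fun n _ => by positivity)
          fun j _ => tsum_pow_natAbs_le (by positivity) ((hle j).trans_lt hr1) _
    _ = Real.exp (∑ j ∈ Finset.range B, 2 * r ^ m j / (1 - r ^ m j)) := (Real.exp_sum _ _).symm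
    _ ≤ _ := Real.exp_le_exp.2 (hs.sum_le_tsum _ fun j _ => by
        have : r ^ m j < 1 := (hle j).trans_lt hr1
        exact div_nonneg (by positivity) (by linarith))

/-- The standing assumptions on the weights. -/
structure Weights (m : ℕ → ℕ) : Prop where
  pos : ∀ j, 0 < m j
  summable : ∀ r : ℝ, 0 ≤ r → r < 1 → Summable fun j => r ^ m j

variable {m : ℕ → ℕ} {a : (ℕ →₀ ℤ) → ℂ} {A : ℝ}

theorem Weights.summable_wt (H : Weights m) {r : ℝ} (hr0 : 0 ≤ r) (hr1 : r < 1) :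
    Summable fun ν : ℕ →₀ ℤ => r ^ wt m ν :=
  summable_pow_wt H.pos H.summable hr0 hr1

theorem summable_norm_dilate (H : Weights m) (ha : ∀ ν, ‖a ν‖ ≤ A) {ξ : ℂ} (hξ : ‖ξ‖ < 1)
    (w : Torus) : Summable fun ν => ‖a ν * monomial ν (approach m ξ w)‖ := by
  refine Summable.of_nonneg_of_le (fun ν => norm_nonneg _) (fun ν => ?_)
    ((H.summable_wt (norm_nonneg ξ) hξ).mul_left A)
  rw [norm_mul, norm_monomial_approach]
  gcongr
  exact ha ν

theorem dilate_eq (ξ : ℂ) (w : Torus) :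
    dilate m a ξ w = ∑' ν, a ν * monomial ν (approach m ξ 1) * character ν w := by
  unfold dilate polyExtension
  refine tsum_congr fun ν => ?_
  rw [monomial_approach, mul_assoc]

theorem continuous_dilate (H : Weights m) (ha : ∀ ν, ‖a ν‖ ≤ A) {ξ : ℂ} (hξ : ‖ξ‖ < 1) :
    Continuous (dilate m a ξ) := by
  have : dilate m a ξ = fun w => ∑' ν, a ν * monomial ν (approach m ξ 1) * character ν w :=
    funext fun w => dilate_eq ξ w
  rw [this]
  refine continuous_tsum (fun ν => by fun_prop) (summable_norm_dilate H ha hξ 1) fun ν w => ?_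
  rw [norm_mul _ (character ν w), norm_character, mul_one]

theorem dilate_real (r : ℝ) (w : Torus) :
    dilate m a r w = ∑' ν, (r : ℂ) ^ wt m ν * (a ν * character ν w) := by
  unfold dilate polyExtension
  refine tsum_congr fun ν => ?_
  rw [monomial_approach_real]; ring

theorem summable_dilate_real (H : Weights m) (ha : ∀ ν, ‖a ν‖ ≤ A) {r : ℝ} (hr0 : 0 ≤ r)
    (hr1 : r < 1) (w : Torus) :
    Summable fun ν => ‖(r : ℂ) ^ wt m ν * (a ν * character ν w)‖ := by
  have := summable_norm_dilate H ha (ξ := r) (by simpa [abs_of_nonneg hr0] using hr1) w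
  refine this.congr fun ν => ?_
  rw [monomial_approach_real]
  congr 1; ring

theorem integral_character_mul_dilate (H : Weights m) (ha : ∀ ν, ‖a ν‖ ≤ A) {r : ℝ}
    (hr0 : 0 ≤ r) (hr1 : r < 1) (κ : ℕ →₀ ℤ) :
    ∫ w, character κ w * dilate m a r w ∂haar = (r : ℂ) ^ wt m κ * a (-κ) := by
  have hwt : wt m (-κ) = wt m κ := by
    simp [wt, Finsupp.sum]
  have h1 (ν : ℕ →₀ ℤ) : ∫ w, character κ w * ((r : ℂ) ^ wt m ν * (a ν * character ν w)) ∂haar =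
      if ν = -κ then (r : ℂ) ^ wt m κ * a (-κ) else 0 := by
    have : (fun w => character κ w * ((r : ℂ) ^ wt m ν * (a ν * character ν w))) =
        fun w => ((r : ℂ) ^ wt m ν * a ν) * character (κ + ν) w := by
      funext w; rw [character_add]; ring
    rw [this, integral_const_mul]
    split_ifs with h
    · subst h; simp [hwt]
    · rw [integral_character (fun h' => h (eq_neg_of_add_eq_zero_right h')), mul_zero]
  have h2 := hasSum_integral_of_summable_integral_norm (μ := haar)
    (F := fun (ν : ℕ →₀ ℤ) w => character κ w * ((r : ℂ) ^ wt m ν * (a ν * character ν w)))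
    (fun ν => integrable_of_continuous (by fun_prop) _) (by
      have := summable_dilate_real H ha hr0 hr1 1
      refine this.congr fun ν => ?_
      simp)
  simp only [h1] at h2
  have h3 := h2.unique (hasSum_ite_eq (-κ) _)
  rw [← h3]
  refine integral_congr_ae (Eventually.of_forall fun w => ?_)
  simp only
  rw [dilate_real, tsum_mul_left]

theorem dilate_flow (ξ : ℂ) (t : UnitAddCircle) (w : Torus) :
    dilate m a ξ (flow m t w) = dilate m a (ξ * AddCircle.toCircle t) w := by
  unfold dilate
  congr 1
  funext j
  simp only [approach, flow, Circle.coe_mul, Circle.coe_pow]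
  ring

/-! ### The Poisson kernel of the infinite torus -/

/-- The product Poisson kernel. -/
def kernel (m : ℕ → ℕ) (r : ℝ) (w : Torus) : ℝ := (dilate m (fun _ => 1) r w).re

theorem continuous_kernel (H : Weights m) {r : ℝ} (hr0 : 0 ≤ r) (hr1 : r < 1) :
    Continuous (kernel m r) :=
  Complex.continuous_re.comp (continuous_dilate (A := 1) H (by simp)
    (by simpa [abs_of_nonneg hr0] using hr1))

theorem kernel_aux (H : Weights m) {r : ℝ} (hr0 : 0 ≤ r) (hr1 : r < 1) (w : Torus) :
    0 ≤ (dilate m (fun _ => 1) r w).re ∧ (dilate m (fun _ => 1) r w).im = 0 := by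
  classical
  set g : (ℕ →₀ ℤ) → ℂ := fun ν => (r : ℂ) ^ wt m ν * ((1 : ℂ) * character ν w) with hg
  have hgs : Summable fun ν => ‖g ν‖ :=
    summable_dilate_real (a := fun _ => 1) (A := 1) H (by simp) hr0 hr1 w
  have hgp (ν : ℕ →₀ ℤ) :
      g ν = ν.prod fun j n => ((r ^ m j : ℝ) : ℂ) ^ n.natAbs * (w j : ℂ) ^ n := by
    rw [Finsupp.prod_mul]
    change (r : ℂ) ^ wt m ν * (1 * character ν w) = _
    rw [one_mul, character_apply]
    congr 1
    rw [wt, Finsupp.prod, Finsupp.sum, ← Finset.prod_pow_eq_pow_sum]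
    refine Finset.prod_congr rfl fun j _ => ?_
    push_cast
    exact pow_mul _ _ _
  have hclosed : IsClosed {z : ℂ | 0 ≤ z.re ∧ z.im = 0} :=
    (isClosed_le continuous_const Complex.continuous_re).inter
      (isClosed_eq Complex.continuous_im continuous_const)
  have hle (j : ℕ) : r ^ m j < 1 := (pow_le_of_le_one hr0 hr1.le (H.pos j).ne').trans_lt hr1
  have key (N : ℕ) : (∑' ν, if ν.support ⊆ Finset.range N then g ν else 0) ∈
      {z : ℂ | 0 ≤ z.re ∧ z.im = 0} := by
    have hprod : (∑' ν, if ν.support ⊆ Finset.range N then g ν else 0) =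
        ∏ j ∈ Finset.range N,
          (((1 - (r ^ m j) ^ 2) / ‖1 - ((r ^ m j : ℝ) : ℂ) * w j‖ ^ 2 : ℝ) : ℂ) := by
      have t1 : Tendsto (fun B : ℕ => ∑' ν, if ν ∈ (Finset.range N).finsupp
          (fun _ => Finset.Icc (-(B : ℤ)) B) then g ν else 0) atTop
          (𝓝 (∑' ν, if ν.support ⊆ Finset.range N then g ν else 0)) := by
        refine tendsto_tsum_of_dominated_convergence hgs (fun ν => ?_)
          (Eventually.of_forall fun B ν => by split_ifs <;> simp)
        refine tendsto_const_nhds.congr' ?_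
        filter_upwards [tendsto_box.eventually_ge_atTop {ν}] with B hB
        have hB' := (mem_box.1 (hB (Finset.mem_singleton_self ν))).2
        refine if_congr ?_ rfl rfl
        rw [Finset.mem_finsupp_iff]
        exact ⟨fun h => ⟨h, fun j _ => hB' j⟩, fun h => h.1⟩
      have t2 : Tendsto (fun B : ℕ => ∑' ν, if ν ∈ (Finset.range N).finsupp
          (fun _ => Finset.Icc (-(B : ℤ)) B) then g ν else 0) atTop
          (𝓝 (∏ j ∈ Finset.range N,
            (((1 - (r ^ m j) ^ 2) / ‖1 - ((r ^ m j : ℝ) : ℂ) * w j‖ ^ 2 : ℝ) : ℂ))) := by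
        have (B : ℕ) : (∑' ν, if ν ∈ (Finset.range N).finsupp
            (fun _ => Finset.Icc (-(B : ℤ)) B) then g ν else 0) =
            ∏ j ∈ Finset.range N, ∑ n ∈ Finset.Icc (-(B : ℤ)) B,
              ((r ^ m j : ℝ) : ℂ) ^ n.natAbs * (w j : ℂ) ^ n := by
          rw [tsum_eq_sum (s := (Finset.range N).finsupp (fun _ => Finset.Icc (-(B : ℤ)) B))
            (fun ν hν => if_neg hν), Finset.sum_congr rfl (fun ν hν => if_pos hν)]
          simp only [hgp]
          exact sum_finsupp_prod _ _ _ (by simp)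
        simp only [this]
        refine tendsto_finsetProd _ fun j _ => ?_
        have hP := hasSum_poisson (by positivity) (hle j) (w j)
        rw [HasSum, SummationFilter.unconditional_filter] at hP
        exact hP.comp Finset.tendsto_Icc_neg
      exact tendsto_nhds_unique t1 t2
    rw [hprod, ← Complex.ofReal_prod]
    refine ⟨?_, Complex.ofReal_im _⟩
    rw [Complex.ofReal_re]
    refine Finset.prod_nonneg fun j _ => div_nonneg ?_ (by positivity)
    have := hle j
    have h0 : 0 ≤ r ^ m j := by positivity
    nlinarith
  have t : Tendsto (fun N : ℕ => ∑' ν, if ν.support ⊆ Finset.range N then g ν else 0) atTop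
      (𝓝 (dilate m (fun _ => 1) r w)) := by
    rw [dilate_real]
    refine tendsto_tsum_of_dominated_convergence hgs (fun ν => ?_)
      (Eventually.of_forall fun B ν => by split_ifs <;> simp)
    refine tendsto_const_nhds.congr' ?_
    filter_upwards [tendsto_box.eventually_ge_atTop {ν}] with B hB
    rw [if_pos (mem_box.1 (hB (Finset.mem_singleton_self ν))).1]
  exact hclosed.mem_of_tendsto t (Eventually.of_forall key)

theorem kernel_nonneg (H : Weights m) {r : ℝ} (hr0 : 0 ≤ r) (hr1 : r < 1) (w : Torus) :
    0 ≤ kernel m r w := (kernel_aux H hr0 hr1 w).1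

theorem ofReal_kernel (H : Weights m) {r : ℝ} (hr0 : 0 ≤ r) (hr1 : r < 1) (w : Torus) :
    (kernel m r w : ℂ) = dilate m (fun _ => 1) r w :=
  Complex.ext rfl (by simp [(kernel_aux H hr0 hr1 w).2])

theorem ofReal_kernel_div (H : Weights m) {r : ℝ} (hr0 : 0 ≤ r) (hr1 : r < 1) (w v : Torus) :
    (kernel m r (w / v) : ℂ) = dilate m (fun ν => conj (character ν v)) r w := by
  rw [ofReal_kernel H hr0 hr1, dilate_real, dilate_real]
  refine tsum_congr fun ν => ?_
  rw [character_div]; ring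

theorem integral_character_mul_kernel (H : Weights m) {r : ℝ} (hr0 : 0 ≤ r) (hr1 : r < 1)
    (κ : ℕ →₀ ℤ) (v : Torus) :
    ∫ w, character κ w * kernel m r (w / v) ∂haar = (r : ℂ) ^ wt m κ * character κ v := by
  simp only [ofReal_kernel_div H hr0 hr1]
  rw [integral_character_mul_dilate (A := 1) H (by simp) hr0 hr1, character_neg]
  simp

theorem lintegral_kernel (H : Weights m) {r : ℝ} (hr0 : 0 ≤ r) (hr1 : r < 1) (v : Torus) :
    ∫⁻ w, ENNReal.ofReal (kernel m r (w / v)) ∂haar = 1 := by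
  have hc := continuous_kernel H hr0 hr1
  have h := integral_character_mul_kernel H hr0 hr1 0 v
  simp only [character_zero, one_mul] at h
  rw [integral_complex_ofReal] at h
  have h' : ∫ w, kernel m r (w / v) ∂haar = 1 := by
    have : wt m 0 = 0 := by simp [wt]
    rw [this, pow_zero, one_mul] at h
    exact_mod_cast h
  rw [← ofReal_integral_eq_lintegral_ofReal, h', ENNReal.ofReal_one]
  · exact (hc.comp (continuous_id.div_const v)).integrable_of_hasCompactSupport
      (HasCompactSupport.of_compactSpace _)
  · exact Eventually.of_forall fun w => kernel_nonneg H hr0 hr1 _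

theorem kernel_inv (H : Weights m) {r : ℝ} (hr0 : 0 ≤ r) (hr1 : r < 1) (w : Torus) :
    kernel m r w⁻¹ = kernel m r w := by
  have h : (kernel m r w⁻¹ : ℂ) = conj (kernel m r w : ℂ) := by
    rw [ofReal_kernel H hr0 hr1, ofReal_kernel H hr0 hr1, dilate_real, dilate_real,
      Complex.conj_tsum]
    refine tsum_congr fun ν => ?_
    simp [character_inv]
  rw [Complex.conj_ofReal] at h
  exact_mod_cast h

end

section

variable {m : ℕ → ℕ} {a : (ℕ →₀ ℤ) → ℂ} {A : ℝ}

/-! ### Integration against complex measures -/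

instance isFiniteMeasure_variation (μ : ComplexMeasure Torus) : IsFiniteMeasure μ.variation := by
  have h : μ.variation ≤ (ComplexMeasure.re μ).totalVariation +
      (ComplexMeasure.im μ).totalVariation := by
    refine VectorMeasure.variation_le_of_forall_enorm_le fun E _ => ?_
    have h1 := SignedMeasure.enorm_le_totalVariation (ComplexMeasure.re μ) E
    have h2 := SignedMeasure.enorm_le_totalVariation (ComplexMeasure.im μ) E
    have h3 : μ E = ((ComplexMeasure.re μ E : ℝ) : ℂ) + (ComplexMeasure.im μ E : ℝ) * Complex.I :=
      (Complex.re_add_im (μ E)).symm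
    rw [h3]
    refine (enorm_add_le _ _).trans (add_le_add ?_ ?_)
    · refine le_trans (le_of_eq ?_) h1
      simp [← ofReal_norm]
    · refine le_trans (le_of_eq ?_) h2
      simp [← ofReal_norm]
  exact isFiniteMeasure_of_le _ h

theorem tvNorm_ne_top (μ : ComplexMeasure Torus) : tvNorm μ ≠ ∞ := measure_ne_top _ _

theorem enorm_cintegral_le (μ : ComplexMeasure Torus) (g : Torus → ℂ) :
    ‖cintegral μ g‖ₑ ≤ ∫⁻ w, ‖g w‖ₑ ∂μ.variation := by
  have h := VectorMeasure.enorm_integral_le_lintegral_enorm (μ := μ) (f := g)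
    (B := ContinuousLinearMap.mul ℝ ℂ)
  have h1 : ‖ContinuousLinearMap.mul ℝ ℂ‖ₑ = 1 := by
    rw [← ofReal_norm, ContinuousLinearMap.opNorm_mul, ENNReal.ofReal_one]
  rwa [h1, one_mul] at h

theorem cintegral_const_mul (μ : ComplexMeasure Torus) (c : ℂ) (g : Torus → ℂ) :
    cintegral μ (fun w => c * g w) = c * cintegral μ g := by
  unfold cintegral
  rw [VectorMeasure.integral_eq_setToFun, VectorMeasure.integral_eq_setToFun]
  exact setToFun_smul (μ := μ.variation) _ (fun c s x => by
    rw [transpose_eq_cbmApplyMeasure]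
    simp only [cbmApplyMeasure_apply, ContinuousLinearMap.mul_apply', smul_eq_mul, mul_assoc]) c g

theorem norm_cintegral_le (μ : ComplexMeasure Torus) {g : Torus → ℂ} {c : ℝ}
    (hg : ∀ w, ‖g w‖ ≤ c) : ‖cintegral μ g‖ ≤ c * (tvNorm μ).toReal := by
  have hc : 0 ≤ c := (norm_nonneg _).trans (hg 1)
  have h : ‖cintegral μ g‖ₑ ≤ ENNReal.ofReal c * tvNorm μ := by
    refine (enorm_cintegral_le μ g).trans ?_
    rw [tvNorm, ← lintegral_const]
    refine lintegral_mono fun w => ?_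
    rw [← ofReal_norm]
    exact ENNReal.ofReal_le_ofReal (hg w)
  rw [← toReal_enorm]
  refine (ENNReal.toReal_mono (ENNReal.mul_ne_top ENNReal.ofReal_ne_top (tvNorm_ne_top μ)) h).trans ?_
  rw [ENNReal.toReal_mul, ENNReal.toReal_ofReal hc]

theorem norm_measureFourier_le (μ : ComplexMeasure Torus) (ν : ℕ →₀ ℤ) :
    ‖measureFourier μ ν‖ ≤ (tvNorm μ).toReal := by
  have := norm_cintegral_le μ (g := fun w => conj (character ν w)) (c := 1) (by simp)
  simpa [measureFourier] using this

theorem measureFourier_add (μ κ : ComplexMeasure Torus) (ν : ℕ →₀ ℤ) :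
    measureFourier (μ + κ) ν = measureFourier μ ν + measureFourier κ ν := by
  have hc : Continuous fun w => conj (character ν w) := by fun_prop
  exact VectorMeasure.integral_add_vectorMeasure (integrable_of_continuous hc _)
    (integrable_of_continuous hc _)

theorem dilate_measureFourier (H : Weights m) (μ : ComplexMeasure Torus) {r : ℝ} (hr0 : 0 ≤ r)
    (hr1 : r < 1) (w : Torus) :
    dilate m (measureFourier μ) r w = cintegral μ fun v => (kernel m r (w / v) : ℂ) := by
  have h2 : ∑' ν : ℕ →₀ ℤ, ∫⁻ v, ‖(r : ℂ) ^ wt m ν * (conj (character ν v) * character ν w)‖ₑ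
      ∂μ.variation ≠ ∞ := by
    have hs := H.summable_wt hr0 hr1
    have : ∀ ν : ℕ →₀ ℤ, ∫⁻ v, ‖(r : ℂ) ^ wt m ν * (conj (character ν v) * character ν w)‖ₑ
      ∂μ.variation = ENNReal.ofReal (r ^ wt m ν) * tvNorm μ := by
      intro ν
      rw [tvNorm, ← lintegral_const]
      refine lintegral_congr fun v => ?_
      rw [← ofReal_norm]
      simp [abs_of_nonneg hr0]
    simp only [this]
    rw [ENNReal.tsum_mul_right, ← ENNReal.ofReal_tsum_of_nonneg (fun ν => by positivity) hs]
    exact ENNReal.mul_ne_top ENNReal.ofReal_ne_top (tvNorm_ne_top μ)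
  have h := VectorMeasure.integral_tsum (μ := μ) (B := ContinuousLinearMap.mul ℝ ℂ)
    (f := fun (ν : ℕ →₀ ℤ) v => (r : ℂ) ^ wt m ν * (conj (character ν v) * character ν w))
    (fun ν => (by fun_prop : Continuous _).aestronglyMeasurable) h2
  rw [dilate_real]
  have e : (fun v => (kernel m r (w / v) : ℂ)) = fun v =>
      ∑' ν : ℕ →₀ ℤ, (r : ℂ) ^ wt m ν * (conj (character ν v) * character ν w) := by
    funext v
    rw [ofReal_kernel_div H hr0 hr1, dilate_real]
  rw [e]
  refine Eq.trans (tsum_congr fun ν => ?_) h.symm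
  change _ = cintegral μ fun v => (r : ℂ) ^ wt m ν * (conj (character ν v) * character ν w)
  rw [cintegral_const_mul]
  congr 1
  rw [mul_comm, measureFourier, ← cintegral_const_mul]
  congr 1
  funext v
  ring

theorem enorm_dilate_measureFourier_le (H : Weights m) (μ : ComplexMeasure Torus) {r : ℝ}
    (hr0 : 0 ≤ r) (hr1 : r < 1) (w : Torus) :
    ‖dilate m (measureFourier μ) r w‖ₑ ≤ ∫⁻ v, ENNReal.ofReal (kernel m r (w / v)) ∂μ.variation := by
  rw [dilate_measureFourier H μ hr0 hr1]
  refine (enorm_cintegral_le _ _).trans (le_of_eq (lintegral_congr fun v => ?_))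
  rw [← ofReal_norm, Complex.norm_real, Real.norm_of_nonneg (kernel_nonneg H hr0 hr1 _)]

theorem lintegral_mul_enorm_dilate_le (H : Weights m) (μ : ComplexMeasure Torus) {r : ℝ}
    (hr0 : 0 ≤ r) (hr1 : r < 1) {φ : Torus → ℝ≥0∞} (hφ : Measurable φ) :
    ∫⁻ w, φ w * ‖dilate m (measureFourier μ) r w‖ₑ ∂haar ≤
      ∫⁻ v, ∫⁻ w, φ w * ENNReal.ofReal (kernel m r (w / v)) ∂haar ∂μ.variation := by
  have hk : Measurable fun p : Torus × Torus => ENNReal.ofReal (kernel m r (p.1 / p.2)) :=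
    ENNReal.measurable_ofReal.comp
      ((continuous_kernel H hr0 hr1).comp (continuous_fst.div' continuous_snd)).measurable
  calc ∫⁻ w, φ w * ‖dilate m (measureFourier μ) r w‖ₑ ∂haar
      ≤ ∫⁻ w, ∫⁻ v, φ w * ENNReal.ofReal (kernel m r (w / v)) ∂μ.variation ∂haar := by
        refine lintegral_mono fun w => ?_
        have hc : Continuous fun v => kernel m r (w / v) :=
          (continuous_kernel H hr0 hr1).comp (continuous_const.div' continuous_id)
        have hk' : Measurable fun v => ENNReal.ofReal (kernel m r (w / v)) :=
          hc.measurable.ennreal_ofReal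
        have h1 := enorm_dilate_measureFourier_le H μ hr0 hr1 w
        have h2 := lintegral_const_mul (μ := μ.variation) (φ w) hk'
        exact (mul_le_mul' le_rfl h1).trans_eq h2.symm
    _ = _ := lintegral_lintegral_swap ((hφ.comp measurable_fst).mul hk).aemeasurable

theorem lintegral_enorm_dilate_le (H : Weights m) (μ : ComplexMeasure Torus) {r : ℝ}
    (hr0 : 0 ≤ r) (hr1 : r < 1) :
    ∫⁻ w, ‖dilate m (measureFourier μ) r w‖ₑ ∂haar ≤ tvNorm μ := by
  have h := lintegral_mul_enorm_dilate_le H μ hr0 hr1 (φ := fun _ => 1) measurable_const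
  simp only [one_mul, lintegral_kernel H hr0 hr1, lintegral_one] at h
  exact h

theorem continuous_flow (m : ℕ → ℕ) :
    Continuous fun p : UnitAddCircle × Torus => flow m p.1 p.2 := by
  refine continuous_pi fun j => ?_
  have : Continuous fun p : UnitAddCircle × Torus => AddCircle.toCircle p.1 :=
    AddCircle.continuous_toCircle.comp continuous_fst
  unfold flow
  fun_prop

theorem measurePreserving_flow (m : ℕ → ℕ) (t : UnitAddCircle) :
    MeasurePreserving (flow m t) haar haar :=
  measurePreserving_mul_left haar (fun j => AddCircle.toCircle t ^ m j)

theorem exists_polar (ξ : ℂ) : ∃ t : UnitAddCircle, ξ = ((‖ξ‖ : ℝ) : ℂ) * AddCircle.toCircle t := by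
  refine ⟨((Complex.arg ξ / (2 * Real.pi) : ℝ) : UnitAddCircle), ?_⟩
  have : AddCircle.toCircle ((Complex.arg ξ / (2 * Real.pi) : ℝ) : UnitAddCircle) =
      Circle.exp (Complex.arg ξ) := by
    rw [AddCircle.toCircle_apply_mk]
    congr 1
    field_simp
  rw [this, Circle.coe_exp, Complex.norm_mul_exp_arg_mul_I]

theorem lintegral_enorm_dilate_complex_le (H : Weights m) (μ : ComplexMeasure Torus) {ξ : ℂ}
    (hξ : ‖ξ‖ < 1) : ∫⁻ w, ‖dilate m (measureFourier μ) ξ w‖ₑ ∂haar ≤ tvNorm μ := by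
  obtain ⟨t, ht⟩ := exists_polar ξ
  have hc := continuous_dilate H (norm_measureFourier_le μ) (ξ := (‖ξ‖ : ℝ)) (by simpa using hξ)
  have h1 := (measurePreserving_flow m t).lintegral_comp
    (f := fun w => ‖dilate m (measureFourier μ) ((‖ξ‖ : ℝ) : ℂ) w‖ₑ) hc.measurable.enorm
  have h2 : ∀ w, dilate m (measureFourier μ) ξ w =
      dilate m (measureFourier μ) ((‖ξ‖ : ℝ) : ℂ) (flow m t w) := by
    intro w
    rw [dilate_flow, ← ht]
  simp only [h2]
  rw [h1]
  exact lintegral_enorm_dilate_le H μ (norm_nonneg ξ) hξ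

/-! ### Density of trigonometric polynomials -/

/-- The characters as bundled continuous functions. -/
def characterC (ν : ℕ →₀ ℤ) : C(Torus, ℂ) := ⟨character ν, continuous_character ν⟩

/-- The star subalgebra of trigonometric polynomials. -/
def trigPoly : StarSubalgebra ℂ C(Torus, ℂ) where
  toSubalgebra := Algebra.adjoin ℂ (Set.range characterC)
  star_mem' := by
    change Algebra.adjoin ℂ (Set.range characterC) ≤ star (Algebra.adjoin ℂ (Set.range characterC))
    refine Algebra.adjoin_le ?_
    rintro - ⟨ν, rfl⟩
    refine Algebra.subset_adjoin ⟨-ν, ?_⟩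
    ext w
    exact character_neg ν w

theorem trigPoly_coe :
    Subalgebra.toSubmodule trigPoly.toSubalgebra = Submodule.span ℂ (Set.range characterC) := by
  apply Algebra.adjoin_eq_span_of_subset
  refine Set.Subset.trans ?_ Submodule.subset_span
  intro x hx
  refine Submonoid.closure_induction (fun _ => id) ⟨0, ?_⟩ ?_ hx
  · ext w; exact character_zero w
  · rintro - - - - ⟨ν, rfl⟩ ⟨κ, rfl⟩
    exact ⟨ν + κ, by ext w; exact character_add ν κ w⟩

theorem span_characterC_dense (g : C(Torus, ℂ)) {ε : ℝ} (hε : 0 < ε) :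
    ∃ p ∈ Submodule.span ℂ (Set.range characterC), ‖g - p‖ < ε := by
  have h : trigPoly.topologicalClosure = ⊤ := by
    refine ContinuousMap.starSubalgebra_topologicalClosure_eq_top_of_separatesPoints trigPoly ?_
    intro x y hxy
    obtain ⟨j, hj⟩ : ∃ j, x j ≠ y j := by
      by_contra! h
      exact hxy (funext h)
    refine ⟨_, ⟨characterC (Finsupp.single j 1), Algebra.subset_adjoin ⟨_, rfl⟩, rfl⟩, ?_⟩
    change character (Finsupp.single j 1) x ≠ character (Finsupp.single j 1) y
    rw [character_single, character_single]
    exact fun h => hj (Circle.coe_injective h)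
  have hg : g ∈ closure (trigPoly : Set C(Torus, ℂ)) := by
    have : g ∈ trigPoly.topologicalClosure := h ▸ trivial
    exact this
  obtain ⟨p, hp, hd⟩ := Metric.mem_closure_iff.1 hg ε hε
  refine ⟨p, ?_, by rwa [dist_eq_norm] at hd⟩
  rw [← trigPoly_coe]
  exact hp

/-- Uniformly bounded families of linear functionals converge as soon as they do on characters. -/
theorem tendsto_of_characterC {ι : Type*} {l : Filter ι} (L : ι → C(Torus, ℂ) →ₗ[ℂ] ℂ)
    (L₀ : C(Torus, ℂ) →ₗ[ℂ] ℂ) {C : ℝ} (hC : 0 ≤ C) (hL : ∀ᶠ i in l, ∀ g, ‖L i g‖ ≤ ‖g‖ * C)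
    (hL₀ : ∀ g, ‖L₀ g‖ ≤ ‖g‖ * C)
    (h : ∀ κ, Tendsto (fun i => L i (characterC κ)) l (𝓝 (L₀ (characterC κ)))) (g : C(Torus, ℂ)) :
    Tendsto (fun i => L i g) l (𝓝 (L₀ g)) := by
  have hspan : ∀ p ∈ Submodule.span ℂ (Set.range characterC),
      Tendsto (fun i => L i p) l (𝓝 (L₀ p)) := by
    intro p hp
    induction hp using Submodule.span_induction with
    | mem x hx => obtain ⟨κ, rfl⟩ := hx; exact h κ
    | zero => simp only [map_zero]; exact tendsto_const_nhds
    | add x y _ _ hx hy => simpa using hx.add hy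
    | smul c x _ hx => simpa using hx.const_mul c
  rw [Metric.tendsto_nhds]
  intro ε hε
  obtain ⟨p, hp, hgp⟩ := span_characterC_dense g (ε := ε / (3 * (C + 1))) (by positivity)
  have hb : ‖g - p‖ * C ≤ ε / 3 := by
    calc ‖g - p‖ * C ≤ ε / (3 * (C + 1)) * (C + 1) := by gcongr; linarith
      _ = ε / 3 := by field_simp
  filter_upwards [hL, Metric.tendsto_nhds.1 (hspan p hp) (ε / 3) (by positivity)] with i hi hi'
  have h1 := hi (g - p)
  have h2 := hL₀ (g - p)
  rw [map_sub] at h1 h2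
  rw [dist_eq_norm] at hi' ⊢
  have : L i g - L₀ g = (L i g - L i p) - (L₀ g - L₀ p) + (L i p - L₀ p) := by ring
  rw [this]
  calc _ ≤ ‖L i g - L i p‖ + ‖L₀ g - L₀ p‖ + ‖L i p - L₀ p‖ :=
        (norm_add_le _ _).trans (add_le_add_left (norm_sub_le _ _) _)
    _ < ε := by linarith

theorem tendsto_pow_nhdsLT_one (n : ℕ) :
    Tendsto (fun r : ℝ => (r : ℂ) ^ n) (𝓝[<] 1) (𝓝 1) := by
  have : Continuous fun r : ℝ => (r : ℂ) ^ n := by fun_prop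
  simpa using (this.tendsto 1).mono_left nhdsWithin_le_nhds

theorem eventually_nhdsLT_one : ∀ᶠ r : ℝ in 𝓝[<] 1, 0 < r ∧ r < 1 :=
  Ioo_mem_nhdsLT one_pos

theorem tendsto_integral_mul_dilate (H : Weights m) (μ : ComplexMeasure Torus) (g : C(Torus, ℂ)) :
    Tendsto (fun r : ℝ => ∫ w, g w * dilate m (measureFourier μ) (r : ℂ) w ∂haar)
      (𝓝[<] 1) (𝓝 (cintegral μ g)) := by
  have hcont {r : ℝ} (hr0 : 0 ≤ r) (hr1 : r < 1) :
      Continuous (dilate m (measureFourier μ) (r : ℂ)) :=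
    continuous_dilate H (norm_measureFourier_le μ) (by simpa [abs_of_nonneg hr0] using hr1)
  let L₀ : C(Torus, ℂ) →ₗ[ℂ] ℂ :=
    { toFun g := cintegral μ g
      map_add' f g := VectorMeasure.integral_add (integrable_of_continuous f.continuous _)
        (integrable_of_continuous g.continuous _)
      map_smul' c g := cintegral_const_mul μ c g }
  let L (r : ℝ) : C(Torus, ℂ) →ₗ[ℂ] ℂ := if hr : 0 < r ∧ r < 1 then
    { toFun g := ∫ w, g w * dilate m (measureFourier μ) (r : ℂ) w ∂haar
      map_add' f g := by
        rw [← integral_add]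
        · simp [add_mul]
        · exact integrable_of_continuous (f.continuous.mul (hcont hr.1.le hr.2)) _
        · exact integrable_of_continuous (g.continuous.mul (hcont hr.1.le hr.2)) _
      map_smul' c g := by
        simp [mul_assoc, integral_const_mul] } else 0
  have hL {r : ℝ} (hr : 0 < r ∧ r < 1) (g : C(Torus, ℂ)) :
      L r g = ∫ w, g w * dilate m (measureFourier μ) (r : ℂ) w ∂haar := by
    simp only [L, dif_pos hr]; rfl
  have key := tendsto_of_characterC (l := 𝓝[<] (1 : ℝ)) L L₀ (C := (tvNorm μ).toReal)
    ENNReal.toReal_nonneg ?_ (fun g => norm_cintegral_le μ fun w => g.norm_coe_le_norm w) ?_ g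
  · refine key.congr' ?_
    filter_upwards [eventually_nhdsLT_one] with r hr using hL hr g
  · filter_upwards [eventually_nhdsLT_one] with r hr g
    rw [hL hr]
    have h1 : ‖∫ w, g w * dilate m (measureFourier μ) (r : ℂ) w ∂haar‖ₑ ≤
        ENNReal.ofReal ‖g‖ * tvNorm μ := by
      refine (enorm_integral_le_lintegral_enorm _).trans ?_
      refine le_trans ?_ (mul_le_mul_right (lintegral_enorm_dilate_le H μ hr.1.le hr.2) _)
      rw [← lintegral_const_mul _ (hcont hr.1.le hr.2).measurable.enorm]
      refine lintegral_mono fun w => ?_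
      rw [enorm_mul]
      gcongr
      rw [← ofReal_norm]
      exact ENNReal.ofReal_le_ofReal (g.norm_coe_le_norm w)
    rw [← toReal_enorm]
    refine (ENNReal.toReal_mono
      (ENNReal.mul_ne_top ENNReal.ofReal_ne_top (tvNorm_ne_top μ)) h1).trans ?_
    rw [ENNReal.toReal_mul, ENNReal.toReal_ofReal (norm_nonneg g)]
  · intro κ
    have h1 : L₀ (characterC κ) = 1 * measureFourier μ (-κ) := by
      rw [one_mul, measureFourier]
      change cintegral μ (character κ) = _
      congr 1
      funext w
      rw [character_neg, Complex.conj_conj]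
    rw [h1]
    refine ((tendsto_pow_nhdsLT_one (wt m κ)).mul_const _).congr' ?_
    filter_upwards [eventually_nhdsLT_one] with r hr
    rw [hL hr]
    exact (integral_character_mul_dilate H (norm_measureFourier_le μ) hr.1.le hr.2 κ).symm

theorem tendsto_smooth (H : Weights m) (g : C(Torus, ℂ)) (v : Torus) :
    Tendsto (fun r : ℝ => ∫ w, g w * kernel m r (w / v) ∂haar) (𝓝[<] 1) (𝓝 (g v)) := by
  have hF (ν : ℕ →₀ ℤ) : measureFourier (VectorMeasure.dirac v 1) ν = conj (character ν v) := by
    unfold measureFourier cintegral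
    rw [VectorMeasure.integral_dirac' (by fun_prop : Continuous _).stronglyMeasurable]
    simp
  have hg : cintegral (VectorMeasure.dirac v 1) g = g v := by
    unfold cintegral
    rw [VectorMeasure.integral_dirac' g.continuous.stronglyMeasurable]
    simp
  have h := tendsto_integral_mul_dilate H (VectorMeasure.dirac v 1) g
  rw [hg] at h
  refine h.congr' ?_
  filter_upwards [eventually_nhdsLT_one] with r hr
  simp only [ofReal_kernel_div H hr.1.le hr.2, funext hF]

theorem integral_kernel (H : Weights m) {r : ℝ} (hr0 : 0 ≤ r) (hr1 : r < 1) (v : Torus) :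
    ∫ w, kernel m r (w / v) ∂haar = 1 := by
  have hk : Continuous fun w => kernel m r (w / v) :=
    (continuous_kernel H hr0 hr1).comp (continuous_id.div_const v)
  rw [integral_eq_lintegral_of_nonneg_ae (Eventually.of_forall fun w => kernel_nonneg H hr0 hr1 _)
    hk.aestronglyMeasurable,
    lintegral_kernel H hr0 hr1, ENNReal.toReal_one]

theorem norm_smooth_le (H : Weights m) {r : ℝ} (hr0 : 0 ≤ r) (hr1 : r < 1) {g : Torus → ℂ} {c : ℝ}
    (hg : ∀ w, ‖g w‖ ≤ c) (v : Torus) : ‖∫ w, g w * kernel m r (w / v) ∂haar‖ ≤ c := by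
  have hk : Continuous fun w => kernel m r (w / v) :=
    (continuous_kernel H hr0 hr1).comp (continuous_id.div_const v)
  have hi : Integrable (fun w => c * kernel m r (w / v)) haar :=
    (continuous_const.mul hk).integrable_of_hasCompactSupport (HasCompactSupport.of_compactSpace _)
  refine (norm_integral_le_of_norm_le hi (Eventually.of_forall fun w => ?_)).trans ?_
  · rw [norm_mul, Complex.norm_real, Real.norm_of_nonneg (kernel_nonneg H hr0 hr1 _)]
    exact mul_le_mul_of_nonneg_right (hg w) (kernel_nonneg H hr0 hr1 _)
  · rw [integral_const_mul, integral_kernel H hr0 hr1, mul_one]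

/-- Weighted `L¹` bounds for the extension of a measure are asymptotically those of the measure. -/
theorem exists_tendsto_lintegral_mul_enorm_dilate_le (H : Weights m) (μ : ComplexMeasure Torus)
    {φ : Torus → ℝ} (hφ : Continuous φ) (hφ0 : ∀ w, 0 ≤ φ w) :
    ∃ B : ℝ → ℝ≥0∞, (∀ᶠ r : ℝ in 𝓝[<] 1,
        ∫⁻ w, ENNReal.ofReal (φ w) * ‖dilate m (measureFourier μ) r w‖ₑ ∂haar ≤ B r) ∧
      Tendsto B (𝓝[<] 1) (𝓝 (∫⁻ w, ENNReal.ofReal (φ w) ∂μ.variation)) := by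
  set g : C(Torus, ℂ) := ⟨fun w => φ w, by fun_prop⟩ with hg
  have e {r : ℝ} (hr : 0 < r ∧ r < 1) (v : Torus) :
      ∫⁻ w, ENNReal.ofReal (φ w) * ENNReal.ofReal (kernel m r (w / v)) ∂haar =
        ‖∫ w, g w * kernel m r (w / v) ∂haar‖ₑ := by
    have hk : Continuous fun w => kernel m r (w / v) :=
      (continuous_kernel H hr.1.le hr.2).comp (continuous_id.div_const v)
    have h0 (w : Torus) : 0 ≤ φ w * kernel m r (w / v) :=
      mul_nonneg (hφ0 w) (kernel_nonneg H hr.1.le hr.2 _)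
    have : ∫ w, g w * kernel m r (w / v) ∂haar = ((∫ w, φ w * kernel m r (w / v) ∂haar : ℝ) : ℂ) := by
      rw [← integral_complex_ofReal]
      exact integral_congr_ae (Eventually.of_forall fun w => by simp [hg])
    rw [this, ← ofReal_norm, Complex.norm_real, Real.norm_of_nonneg (integral_nonneg h0),
      ofReal_integral_eq_lintegral_ofReal (f := fun w => φ w * kernel m r (w / v))
        ((hφ.mul hk).integrable_of_hasCompactSupport (HasCompactSupport.of_compactSpace _))
        (Eventually.of_forall h0)]
    exact lintegral_congr fun w => (ENNReal.ofReal_mul (hφ0 w)).symm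
  refine ⟨fun r => ∫⁻ v, ∫⁻ w, ENNReal.ofReal (φ w) * ENNReal.ofReal (kernel m r (w / v)) ∂haar
    ∂μ.variation, ?_, ?_⟩
  · filter_upwards [eventually_nhdsLT_one] with r hr
    exact lintegral_mul_enorm_dilate_le H μ hr.1.le hr.2 (by fun_prop)
  · refine tendsto_lintegral_filter_of_dominated_convergence (fun _ => ENNReal.ofReal ‖g‖) ?_ ?_ ?_ ?_
    · filter_upwards [eventually_nhdsLT_one] with r hr
      have : Measurable fun p : Torus × Torus =>
          ENNReal.ofReal (φ p.2) * ENNReal.ofReal (kernel m r (p.2 / p.1)) :=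
        (ENNReal.measurable_ofReal.comp (hφ.comp continuous_snd).measurable).mul
          (ENNReal.measurable_ofReal.comp ((continuous_kernel H hr.1.le hr.2).comp
            (continuous_snd.div' continuous_fst)).measurable)
      exact this.lintegral_prod_right'
    · filter_upwards [eventually_nhdsLT_one] with r hr
      refine Eventually.of_forall fun v => ?_
      rw [e hr, ← ofReal_norm]
      exact ENNReal.ofReal_le_ofReal (norm_smooth_le H hr.1.le hr.2 g.norm_coe_le_norm v)
    · rw [lintegral_const]
      exact ENNReal.mul_ne_top ENNReal.ofReal_ne_top (measure_ne_top _ _)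
    · refine Eventually.of_forall fun v => ?_
      have h := (tendsto_smooth H g v).enorm
      have : ‖g v‖ₑ = ENNReal.ofReal (φ v) := by
        rw [← ofReal_norm]
        simp [hg, abs_of_nonneg (hφ0 v)]
      rw [this] at h
      refine h.congr' ?_
      filter_upwards [eventually_nhdsLT_one] with r hr using (e hr v).symm

/-! ### Absolutely continuous measures -/

theorem cintegral_withDensityᵥ {f : Torus → ℂ} (hf : Integrable f haar) {g : Torus → ℂ}
    (hg : Continuous g) : cintegral (haar.withDensityᵥ f) g = ∫ w, f w * g w ∂haar := by
  set μ : ComplexMeasure Torus := haar.withDensityᵥ f with hμ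
  obtain ⟨c, hc⟩ : ∃ c, ∀ w, ‖g w‖ ≤ c :=
    ⟨‖(⟨g, hg⟩ : C(Torus, ℂ))‖, fun w => (⟨g, hg⟩ : C(Torus, ℂ)).norm_coe_le_norm w⟩
  have hc0 : 0 ≤ c := (norm_nonneg _).trans (hc 1)
  have hsimple (s : SimpleFunc Torus ℂ) : cintegral μ s = ∫ w, f w * s w ∂haar := by
    have hint (s : SimpleFunc Torus ℂ) : Integrable (fun w => f w * s w) haar := by
      obtain ⟨C, hC⟩ := s.exists_forall_norm_le
      exact hf.mul_bdd (c := C) s.aestronglyMeasurable (Eventually.of_forall hC)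
    have hint' (s : SimpleFunc Torus ℂ) : Integrable s μ.variation :=
      SimpleFunc.integrable_of_isFiniteMeasure s
    induction s using SimpleFunc.induction with
    | const x hs =>
      rename_i s
      have h1 : cintegral μ (s.indicator fun _ => x) = x * μ s := by
        unfold cintegral
        rw [VectorMeasure.integral_eq_setToFun, setToFun_indicator_const _ hs (measure_ne_top _ _),
          transpose_eq_cbmApplyMeasure, cbmApplyMeasure_apply]
        rfl
      have h2 : (SimpleFunc.piecewise s hs (SimpleFunc.const Torus x) (SimpleFunc.const Torus 0) :
          Torus → ℂ) = s.indicator fun _ => x := by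
        simp only [SimpleFunc.coe_piecewise, SimpleFunc.coe_const]
        classical exact Set.piecewise_eq_indicator
      rw [h2, h1, hμ, withDensityᵥ_apply hf hs, ← integral_const_mul, ← integral_indicator hs]
      refine integral_congr_ae (Eventually.of_forall fun w => ?_)
      by_cases hw : w ∈ s <;> simp [hw, mul_comm]
    | add _ hs ht =>
      rename_i s t _
      rw [SimpleFunc.coe_add]
      refine (VectorMeasure.integral_add (hint' s) (hint' t)).trans ?_
      change cintegral μ s + cintegral μ t = _
      rw [hs, ht, ← integral_add (hint s) (hint t)]
      simp [mul_add]
  set G := hg.stronglyMeasurable.approxBounded c with hG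
  have t1 : Tendsto (fun n => cintegral μ (G n)) atTop (𝓝 (cintegral μ g)) := by
    refine VectorMeasure.tendsto_integral_of_dominated_convergence (fun _ => c)
      (fun n => (G n).aestronglyMeasurable) (integrable_const c)
      (fun n => Eventually.of_forall fun w =>
        hg.stronglyMeasurable.norm_approxBounded_le hc0 n w)
      (Eventually.of_forall fun w =>
        hg.stronglyMeasurable.tendsto_approxBounded_of_norm_le (hc w))
  have t2 : Tendsto (fun n => ∫ w, f w * G n w ∂haar) atTop (𝓝 (∫ w, f w * g w ∂haar)) := by
    refine tendsto_integral_of_dominated_convergence (fun w => ‖f w‖ * c)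
      (fun n => hf.1.mul (G n).aestronglyMeasurable) (hf.norm.mul_const c)
      (fun n => Eventually.of_forall fun w => ?_)
      (Eventually.of_forall fun w => tendsto_const_nhds.mul
        (hg.stronglyMeasurable.tendsto_approxBounded_of_norm_le (hc w)))
    rw [norm_mul]
    exact mul_le_mul_of_nonneg_left (hg.stronglyMeasurable.norm_approxBounded_le hc0 n w)
      (norm_nonneg _)
  simp only [hsimple] at t1
  exact tendsto_nhds_unique t1 t2

theorem measureFourier_withDensityᵥ {f : Torus → ℂ} (hf : Integrable f haar) :
    measureFourier (haar.withDensityᵥ f) = functionFourier f := by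
  funext ν
  exact cintegral_withDensityᵥ hf (by fun_prop)

theorem tvNorm_withDensityᵥ {f : Torus → ℂ} (hf : Integrable f haar) :
    tvNorm (haar.withDensityᵥ f) = ∫⁻ w, ‖f w‖ₑ ∂haar := by
  rw [tvNorm, Measure.variation_withDensityᵥ hf, withDensity_apply _ MeasurableSet.univ,
    Measure.restrict_univ]

theorem dilate_functionFourier (H : Weights m) {f : Torus → ℂ} (hf : Integrable f haar) {r : ℝ}
    (hr0 : 0 ≤ r) (hr1 : r < 1) (w : Torus) :
    dilate m (functionFourier f) r w = ∫ v, f v * kernel m r (v / w) ∂haar := by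
  have hk : Continuous fun v => (kernel m r (w / v) : ℂ) := by
    have := (continuous_kernel H hr0 hr1).comp (continuous_const.div' continuous_id : Continuous (w / ·))
    fun_prop
  rw [← measureFourier_withDensityᵥ hf, dilate_measureFourier H _ hr0 hr1,
    cintegral_withDensityᵥ hf hk]
  refine integral_congr_ae (Eventually.of_forall fun v => ?_)
  simp only
  rw [← kernel_inv H hr0 hr1, inv_div]

theorem continuous_dilate_functionFourier (H : Weights m) {f : Torus → ℂ} (hf : Integrable f haar)
    {r : ℝ} (hr0 : 0 ≤ r) (hr1 : r < 1) : Continuous (dilate m (functionFourier f) (r : ℂ)) := by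
  rw [← measureFourier_withDensityᵥ hf]
  exact continuous_dilate H (norm_measureFourier_le _) (by simpa [abs_of_nonneg hr0] using hr1)

theorem lintegral_enorm_dilate_functionFourier_le (H : Weights m) {f : Torus → ℂ}
    (hf : Integrable f haar) {r : ℝ} (hr0 : 0 ≤ r) (hr1 : r < 1) :
    ∫⁻ w, ‖dilate m (functionFourier f) r w‖ₑ ∂haar ≤ ∫⁻ w, ‖f w‖ₑ ∂haar := by
  rw [← measureFourier_withDensityᵥ hf, ← tvNorm_withDensityᵥ hf]
  exact lintegral_enorm_dilate_le H _ hr0 hr1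

/-- Convergence in `L¹` of the extension of an integrable function. -/
theorem tendsto_lintegral_enorm_dilate_sub (H : Weights m) {f : Torus → ℂ}
    (hf : Integrable f haar) :
    Tendsto (fun r : ℝ => ∫⁻ w, ‖dilate m (functionFourier f) (r : ℂ) w - f w‖ₑ ∂haar)
      (𝓝[<] 1) (𝓝 0) := by
  have hcont (g : C(Torus, ℂ)) :
      Tendsto (fun r : ℝ => ∫⁻ w, ‖dilate m (functionFourier g) (r : ℂ) w - g w‖ₑ ∂haar)
        (𝓝[<] 1) (𝓝 0) := by
    have hg := integrable_of_continuous g.continuous haar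
    rw [← lintegral_zero (μ := haar) (α := Torus)]
    refine tendsto_lintegral_filter_of_dominated_convergence (fun _ => ENNReal.ofReal (‖g‖ + ‖g‖))
      ?_ ?_ ?_ ?_
    · filter_upwards [eventually_nhdsLT_one] with r hr
      exact ((continuous_dilate_functionFourier H hg hr.1.le hr.2).sub g.continuous).measurable.enorm
    · filter_upwards [eventually_nhdsLT_one] with r hr
      refine Eventually.of_forall fun w => ?_
      rw [← ofReal_norm, dilate_functionFourier H hg hr.1.le hr.2]
      refine ENNReal.ofReal_le_ofReal ((norm_sub_le _ _).trans (add_le_add ?_ ?_))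
      · exact norm_smooth_le H hr.1.le hr.2 g.norm_coe_le_norm w
      · exact g.norm_coe_le_norm w
    · simp
    · refine Eventually.of_forall fun w => ?_
      have h := ((tendsto_smooth H g w).sub_const (g w)).enorm
      rw [sub_self, enorm_zero] at h
      refine h.congr' ?_
      filter_upwards [eventually_nhdsLT_one] with r hr
      rw [dilate_functionFourier H hg hr.1.le hr.2]
  rw [ENNReal.tendsto_nhds_zero]
  intro ε hε
  obtain ⟨δ, hδ0, hδ⟩ : ∃ δ : ℝ≥0∞, 0 < δ ∧ δ + δ + δ ≤ ε := by
    refine ⟨ε / 3, ENNReal.div_pos hε.ne' (by simp), le_of_eq (ENNReal.add_thirds ε)⟩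
  obtain ⟨g, hg1, hg2⟩ := (memLp_one_iff_integrable.2 hf).exists_boundedContinuous_eLpNorm_sub_le
    ENNReal.one_ne_top hδ0.ne'
  have hgi : Integrable g haar := memLp_one_iff_integrable.1 hg2
  rw [eLpNorm_one_eq_lintegral_enorm] at hg1
  filter_upwards [eventually_nhdsLT_one,
    (ENNReal.tendsto_nhds_zero.1 (hcont (g : C(Torus, ℂ))) δ hδ0)] with r hr hrg
  have hd (w : Torus) : dilate m (functionFourier f) r w - dilate m (functionFourier g) r w =
      dilate m (functionFourier (f - g)) r w := by
    rw [dilate_functionFourier H hf hr.1.le hr.2, dilate_functionFourier H hgi hr.1.le hr.2,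
      dilate_functionFourier H (hf.sub hgi) hr.1.le hr.2]
    have hk : Continuous fun v => (kernel m r (v / w) : ℂ) := by
      have := (continuous_kernel H hr.1.le hr.2).comp (continuous_id.div_const w)
      fun_prop
    have hb {f : Torus → ℂ} (hf : Integrable f haar) :
        Integrable (fun v => f v * (kernel m r (v / w) : ℂ)) haar :=
      hf.mul_bdd (c := ‖(⟨_, hk⟩ : C(Torus, ℂ))‖) hk.aestronglyMeasurable
        (Eventually.of_forall fun v => (⟨_, hk⟩ : C(Torus, ℂ)).norm_coe_le_norm v)
    rw [← integral_sub (hb hf) (hb hgi)]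
    simp [sub_mul]
  have hfc := continuous_dilate_functionFourier H hf hr.1.le hr.2
  have hgc := continuous_dilate_functionFourier H hgi hr.1.le hr.2
  calc ∫⁻ w, ‖dilate m (functionFourier f) r w - f w‖ₑ ∂haar
      ≤ ∫⁻ w, (‖dilate m (functionFourier (f - g)) r w‖ₑ +
          ‖dilate m (functionFourier g) r w - g w‖ₑ) + ‖(f - g) w‖ₑ ∂haar := by
        refine lintegral_mono fun w => ?_
        rw [← hd w]
        have : dilate m (functionFourier f) r w - f w = (dilate m (functionFourier f) r w -
          dilate m (functionFourier g) r w) + (dilate m (functionFourier g) r w - g w) -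
          (f - g) w := by simp only [Pi.sub_apply]; ring
        rw [this]
        exact enorm_sub_le.trans (add_le_add_left (enorm_add_le _ _) _)
    _ = ∫⁻ w, ‖dilate m (functionFourier (f - g)) r w‖ₑ ∂haar +
          ∫⁻ w, ‖dilate m (functionFourier g) r w - g w‖ₑ ∂haar + ∫⁻ w, ‖(f - g) w‖ₑ ∂haar := by
        rw [lintegral_add_left, lintegral_add_left]
        · exact (continuous_dilate_functionFourier H (hf.sub hgi) hr.1.le hr.2).measurable.enorm
        · exact (continuous_dilate_functionFourier H (hf.sub hgi) hr.1.le hr.2).measurable.enorm.add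
            (hgc.sub g.continuous).measurable.enorm
    _ ≤ δ + δ + δ := by
        refine add_le_add (add_le_add ?_ hrg) hg1
        exact (lintegral_enorm_dilate_functionFourier_le H (hf.sub hgi) hr.1.le hr.2).trans hg1
    _ ≤ ε := hδ

end

section

/-! ### The Poisson kernel on `UnitAddCircle` -/

instance : IsProbabilityMeasure (volume : Measure UnitAddCircle) :=
  ⟨UnitAddCircle.measure_univ⟩

/-- The Poisson kernel at distance `u` from the origin of `UnitAddCircle`. -/
def poissonProfile (r u : ℝ) : ℝ := (1 - r ^ 2) / (1 - 2 * r * Real.cos (2 * Real.pi * u) + r ^ 2)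

theorem poissonProfile_denom_pos {r : ℝ} (hr0 : 0 ≤ r) (hr1 : r < 1) (u : ℝ) :
    0 < 1 - 2 * r * Real.cos (2 * Real.pi * u) + r ^ 2 := by
  have h := Real.cos_le_one (2 * Real.pi * u)
  have : 0 < (1 - r) ^ 2 := by
    have : 0 < 1 - r := by linarith
    positivity
  nlinarith

theorem poissonProfile_nonneg {r : ℝ} (hr0 : 0 ≤ r) (hr1 : r < 1) (u : ℝ) :
    0 ≤ poissonProfile r u :=
  div_nonneg (by nlinarith) (poissonProfile_denom_pos hr0 hr1 u).le

theorem poissonProfile_anti {r : ℝ} (hr0 : 0 ≤ r) (hr1 : r < 1) {u v : ℝ} (hu : 0 ≤ u)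
    (huv : u ≤ v) (hv : v ≤ 1 / 2) : poissonProfile r v ≤ poissonProfile r u := by
  have hpi := Real.pi_pos
  have h : Real.cos (2 * Real.pi * v) ≤ Real.cos (2 * Real.pi * u) :=
    Real.cos_le_cos_of_nonneg_of_le_pi (by positivity) (by nlinarith)
      (by nlinarith)
  unfold poissonProfile
  have h1 := poissonProfile_denom_pos hr0 hr1 u
  have h2 : 0 ≤ 1 - r ^ 2 := by nlinarith
  gcongr

theorem continuous_poissonProfile {r : ℝ} (hr0 : 0 ≤ r) (hr1 : r < 1) :
    Continuous (poissonProfile r) := by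
  unfold poissonProfile
  exact continuous_const.div (by fun_prop) fun u => (poissonProfile_denom_pos hr0 hr1 u).ne'

theorem tendsto_poissonProfile {u : ℝ} (hu : 0 < u) (hu' : u ≤ 1 / 2) :
    Tendsto (fun r => poissonProfile r u) (𝓝[<] 1) (𝓝 0) := by
  have hpi := Real.pi_pos
  have hcos : Real.cos (2 * Real.pi * u) < 1 := by
    rw [← Real.cos_zero]
    exact Real.cos_lt_cos_of_nonneg_of_le_pi le_rfl (by nlinarith) (by positivity)
  have h : ContinuousAt (fun r => poissonProfile r u) 1 := by
    unfold poissonProfile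
    refine ContinuousAt.div (by fun_prop) (by fun_prop) ?_
    intro h; nlinarith
  have := h.tendsto.mono_left (nhdsWithin_le_nhds (s := Set.Iio (1 : ℝ)))
  simpa [poissonProfile] using this

theorem norm_le_half_unitAddCircle (x : UnitAddCircle) : ‖x‖ ≤ 1 / 2 := by
  have := AddCircle.norm_le_half_period (1 : ℝ) (x := x) one_ne_zero
  simpa using this

theorem norm_sq_one_sub_mul_toCircle (r : ℝ) (x : UnitAddCircle) :
    ‖1 - (r : ℂ) * AddCircle.toCircle x‖ ^ 2 =
      1 - 2 * r * Real.cos (2 * Real.pi * ‖x‖) + r ^ 2 := by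
  induction x using QuotientAddGroup.induction_on with
  | H x =>
  have h1 : ‖(x : UnitAddCircle)‖ = |x - round x| := UnitAddCircle.norm_eq
  change ‖1 - (r : ℂ) * AddCircle.toCircle (x : UnitAddCircle)‖ ^ 2 =
    1 - 2 * r * Real.cos (2 * Real.pi * ‖(x : UnitAddCircle)‖) + r ^ 2
  have h2 : Real.cos (2 * Real.pi * ‖(x : UnitAddCircle)‖) = Real.cos (2 * Real.pi * x) := by
    rw [h1]
    have : 2 * Real.pi * |x - round x| = |2 * Real.pi * x - round x * (2 * Real.pi)| := by
      rw [← abs_of_pos Real.two_pi_pos, ← abs_mul, abs_of_pos Real.two_pi_pos]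
      congr 1; ring
    rw [this, Real.cos_abs, Real.cos_sub_int_mul_two_pi]
  rw [h2, AddCircle.toCircle_apply_mk, ← Complex.normSq_eq_norm_sq, Circle.coe_exp,
    div_one, Complex.exp_mul_I, Complex.normSq_apply]
  simp only [← Complex.ofReal_cos, ← Complex.ofReal_sin, Complex.sub_re, Complex.sub_im,
    Complex.mul_re, Complex.mul_im, Complex.add_re, Complex.add_im, Complex.ofReal_re,
    Complex.ofReal_im, Complex.I_re, Complex.I_im, Complex.one_re, Complex.one_im]
  have := Real.sin_sq_add_cos_sq (2 * Real.pi * x)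
  linear_combination r ^ 2 * this

theorem hasSum_poissonProfile {r : ℝ} (hr0 : 0 ≤ r) (hr1 : r < 1) (x : UnitAddCircle) :
    HasSum (fun n : ℤ => (r : ℂ) ^ n.natAbs * fourier n x) (poissonProfile r ‖x‖ : ℂ) := by
  have h := hasSum_poisson hr0 hr1 (AddCircle.toCircle x)
  rw [norm_sq_one_sub_mul_toCircle] at h
  refine h.congr_fun fun n => ?_
  rw [fourier_apply, AddCircle.toCircle_zsmul, Circle.coe_zpow]

theorem norm_fourier_apply (n : ℤ) (x : UnitAddCircle) : ‖fourier n x‖ = 1 := by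
  rw [fourier_apply]; exact Circle.norm_coe _

theorem integral_fourier (n : ℤ) : ∫ x : UnitAddCircle, fourier n x = if n = 0 then 1 else 0 := by
  split_ifs with hn
  · subst hn
    simp
  · exact integral_eq_zero_of_add_right_eq_neg (μ := volume)
      (fourier_add_half_inv_index hn one_pos)

theorem fourier_sub (n : ℤ) (s t : UnitAddCircle) :
    fourier n (s - t) = fourier n s * conj (fourier n t) := by
  rw [fourier_apply, fourier_apply, fourier_apply, smul_sub, sub_eq_add_neg,
    AddCircle.toCircle_add, AddCircle.toCircle_neg, Circle.coe_mul, Circle.coe_inv_eq_conj]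

theorem integral_poissonProfile_mul_fourier {r : ℝ} (hr0 : 0 ≤ r) (hr1 : r < 1) (k : ℤ)
    (t : UnitAddCircle) :
    ∫ s, (poissonProfile r ‖s - t‖ : ℂ) * fourier k s = (r : ℂ) ^ k.natAbs * fourier k t := by
  have hs : Summable fun n : ℤ => r ^ n.natAbs := by
    have := (hasSum_poissonProfile hr0 hr1 0).summable.norm
    simpa [abs_of_nonneg hr0] using this
  have h1 (n : ℤ) : ∫ s, ((r : ℂ) ^ n.natAbs * fourier n (s - t)) * fourier k s =
      if n = -k then (r : ℂ) ^ k.natAbs * fourier k t else 0 := by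
    have : (fun s : UnitAddCircle => ((r : ℂ) ^ n.natAbs * fourier n (s - t)) * fourier k s) =
        fun s => ((r : ℂ) ^ n.natAbs * conj (fourier n t)) * fourier (n + k) s := by
      funext s
      rw [fourier_sub, fourier_add]
      ring
    rw [this, integral_const_mul, integral_fourier]
    by_cases h : n = -k
    · subst h
      simp only [neg_add_cancel, if_true, Int.natAbs_neg, mul_one, fourier_neg, Complex.conj_conj]
    · rw [if_neg h, if_neg (fun h' => h (eq_neg_of_add_eq_zero_left h')), mul_zero]
  have h2 := hasSum_integral_of_summable_integral_norm (μ := (volume : Measure UnitAddCircle))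
    (F := fun (n : ℤ) s => ((r : ℂ) ^ n.natAbs * fourier n (s - t)) * fourier k s)
    (fun n => (by fun_prop : Continuous _).integrable_of_hasCompactSupport
      (HasCompactSupport.of_compactSpace _)) (by
      refine hs.congr fun n => ?_
      simp only [norm_mul, norm_fourier_apply, norm_pow, Complex.norm_real,
        Real.norm_of_nonneg hr0, mul_one, integral_const, probReal_univ, one_smul])
  simp only [h1] at h2
  rw [← h2.unique (hasSum_ite_eq (-k) _)]
  refine integral_congr_ae (Eventually.of_forall fun s => ?_)
  simp only
  rw [tsum_mul_right, (hasSum_poissonProfile hr0 hr1 (s - t)).tsum_eq]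

/-! ### Comparison of radially decreasing averages -/

theorem lintegral_radial_mono {α β : Measure UnitAddCircle} [IsFiniteMeasure α] [IsFiniteMeasure β]
    {t : UnitAddCircle}
    (h : ∀ u > 0, α (Metric.closedBall t u) ≤ β (Metric.closedBall t u)) {p : ℝ → ℝ}
    (hp : Continuous p) (hp0 : ∀ u, 0 ≤ p u)
    (hanti : ∀ u v, 0 ≤ u → u ≤ v → v ≤ 1 / 2 → p v ≤ p u) :
    ∫⁻ s, ENNReal.ofReal (p ‖s - t‖) ∂α ≤ ∫⁻ s, ENNReal.ofReal (p ‖s - t‖) ∂β := by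
  have hc : Continuous fun s : UnitAddCircle => p ‖s - t‖ := by fun_prop
  rw [lintegral_eq_lintegral_meas_lt _ (Eventually.of_forall fun s => hp0 _) hc.aemeasurable,
    lintegral_eq_lintegral_meas_lt _ (Eventually.of_forall fun s => hp0 _) hc.aemeasurable]
  refine lintegral_mono fun l => ?_
  have hU : IsOpen {s : UnitAddCircle | l < p ‖s - t‖} := isOpen_lt continuous_const hc
  rw [hU.measure_eq_iSup_isCompact]
  refine iSup₂_le fun K hK => iSup_le fun hKc => ?_
  rcases K.eq_empty_or_nonempty with rfl | hne
  · simp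
  obtain ⟨s₀, hs₀, hmax⟩ := hKc.exists_isMaxOn hne
    (f := fun s => ‖s - t‖) (by fun_prop : Continuous _).continuousOn
  have hball : Metric.closedBall t ‖s₀ - t‖ ⊆ {s : UnitAddCircle | l < p ‖s - t‖} := by
    intro s hs
    rw [Metric.mem_closedBall, dist_eq_norm] at hs
    exact (hK hs₀).trans_le (hanti _ _ (norm_nonneg _) hs (norm_le_half_unitAddCircle _))
  obtain ⟨u₁, hu₁, hu₁'⟩ := Metric.nhds_basis_closedBall.mem_iff.1
    (hU.mem_nhds (hball (Metric.mem_closedBall_self (norm_nonneg _))))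
  have hsub : Metric.closedBall t (max u₁ ‖s₀ - t‖) ⊆ {s : UnitAddCircle | l < p ‖s - t‖} := by
    rcases max_choice u₁ ‖s₀ - t‖ with h | h <;> rw [h] <;> assumption
  calc α K ≤ α (Metric.closedBall t (max u₁ ‖s₀ - t‖)) := by
        refine measure_mono fun s hs => ?_
        rw [Metric.mem_closedBall, dist_eq_norm]
        exact (hmax hs).trans (le_max_right _ _)
    _ ≤ β (Metric.closedBall t (max u₁ ‖s₀ - t‖)) := h _ (lt_max_of_lt_left hu₁)
    _ ≤ _ := measure_mono hsub

/-- The Poisson integral of a measure. -/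
def poissonLIntegral (σ : Measure UnitAddCircle) (r : ℝ) (t : UnitAddCircle) : ℝ≥0∞ :=
  ∫⁻ s, ENNReal.ofReal (poissonProfile r ‖s - t‖) ∂σ

theorem poissonLIntegral_mono {α β : Measure UnitAddCircle} [IsFiniteMeasure α] [IsFiniteMeasure β]
    {t : UnitAddCircle}
    (h : ∀ u > 0, α (Metric.closedBall t u) ≤ β (Metric.closedBall t u)) {r : ℝ} (hr0 : 0 ≤ r)
    (hr1 : r < 1) : poissonLIntegral α r t ≤ poissonLIntegral β r t :=
  lintegral_radial_mono h (continuous_poissonProfile hr0 hr1) (poissonProfile_nonneg hr0 hr1)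
    fun _ _ hu huv hv' => poissonProfile_anti hr0 hr1 hu huv hv'

theorem integral_poissonProfile {r : ℝ} (hr0 : 0 ≤ r) (hr1 : r < 1) (t : UnitAddCircle) :
    ∫ s : UnitAddCircle, poissonProfile r ‖s - t‖ = 1 := by
  have h := integral_poissonProfile_mul_fourier hr0 hr1 0 t
  simp only [fourier_zero, mul_one, Int.natAbs_zero, pow_zero] at h
  rw [integral_complex_ofReal] at h
  exact_mod_cast h

theorem poissonLIntegral_volume {r : ℝ} (hr0 : 0 ≤ r) (hr1 : r < 1) (t : UnitAddCircle) :
    poissonLIntegral volume r t = 1 := by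
  have hc : Continuous fun s : UnitAddCircle => poissonProfile r ‖s - t‖ :=
    (continuous_poissonProfile hr0 hr1).comp (by fun_prop)
  rw [poissonLIntegral, ← ofReal_integral_eq_lintegral_ofReal
    (hc.integrable_of_hasCompactSupport (HasCompactSupport.of_compactSpace _))
    (Eventually.of_forall fun s => poissonProfile_nonneg hr0 hr1 _),
    integral_poissonProfile hr0 hr1, ENNReal.ofReal_one]

/-! ### The weak type maximal inequality -/

theorem volume_closedBall_five_mul_le (t : UnitAddCircle) (u : ℝ) :
    volume (Metric.closedBall t (5 * u)) ≤ 5 * volume (Metric.closedBall t u) := by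
  rw [AddCircle.volume_closedBall, AddCircle.volume_closedBall]
  have : (5 : ℝ≥0∞) = ENNReal.ofReal 5 := by simp
  rw [this, ← ENNReal.ofReal_mul (by norm_num)]
  refine ENNReal.ofReal_le_ofReal ?_
  rcases le_total 1 (2 * u) with h | h
  · rw [min_eq_left h]
    exact (min_le_left _ _).trans (by norm_num)
  · rw [min_eq_right h]
    exact (min_le_right _ _).trans (by linarith)

theorem volume_maximal_le (σ : Measure UnitAddCircle) [IsFiniteMeasure σ] {c : ℝ≥0∞} (hc0 : c ≠ 0)
    (hc : c ≠ ∞) :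
    volume {t | ∃ r : ℝ, 0 ≤ r ∧ r < 1 ∧ c < poissonLIntegral σ r t} ≤ 5 * σ Set.univ / c := by
  set E := {t | ∃ r : ℝ, 0 ≤ r ∧ r < 1 ∧ c < poissonLIntegral σ r t} with hE
  have h1 : ∀ t ∈ E, ∃ u : ℝ, 0 < u ∧ u ≤ 1 ∧
      c * volume (Metric.closedBall t u) ≤ σ (Metric.closedBall t u) := by
    rintro t ⟨r, hr0, hr1, hr⟩
    by_contra! hcon
    have hfin : IsFiniteMeasure (c • (volume : Measure UnitAddCircle)) :=
      Measure.smul_finite _ hc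
    refine hr.not_ge ((poissonLIntegral_mono (β := c • volume) (fun u hu => ?_) hr0 hr1).trans ?_)
    · rw [Measure.smul_apply, smul_eq_mul]
      rcases le_total u 1 with h | h
      · exact (hcon u hu h).le
      · have hb (v : ℝ) (hv : 1 ≤ v) : Metric.closedBall t v = Set.univ := by
          refine Set.eq_univ_of_forall fun s => ?_
          rw [Metric.mem_closedBall, dist_eq_norm]
          exact (norm_le_half_unitAddCircle _).trans (by linarith)
        have := (hcon 1 one_pos le_rfl).le
        rwa [hb 1 le_rfl, ← hb u h] at this
    · rw [poissonLIntegral, lintegral_smul_measure]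
      change c • poissonLIntegral volume r t ≤ c
      rw [poissonLIntegral_volume hr0 hr1, smul_eq_mul, mul_one]
  choose! u hu0 hu1 hu using h1
  obtain ⟨F, hFE, hdisj, hcov⟩ := Vitali.exists_disjoint_subfamily_covering_enlargement_closedBall
    E (fun t => t) u 1 hu1 5 (by norm_num)
  have hFc : F.Countable := by
    refine hdisj.countable_of_nonempty_interior fun t ht => ?_
    exact ⟨t, mem_interior_iff_mem_nhds.2 (Metric.closedBall_mem_nhds t (hu0 t (hFE ht)))⟩
  have hsub : E ⊆ ⋃ t ∈ F, Metric.closedBall t (5 * u t) := by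
    intro t ht
    obtain ⟨b, hb, hb'⟩ := hcov t ht
    exact Set.mem_biUnion hb (hb' (Metric.mem_closedBall_self (hu0 t ht).le))
  rw [ENNReal.le_div_iff_mul_le (Or.inl hc0) (Or.inl hc)]
  have := hFc.to_subtype
  calc volume E * c ≤ (∑' t : F, volume (Metric.closedBall (t : UnitAddCircle) (5 * u t))) * c := by
        gcongr
        exact (measure_mono hsub).trans (measure_biUnion_le _ hFc _)
    _ ≤ (∑' t : F, 5 * volume (Metric.closedBall (t : UnitAddCircle) (u t))) * c := by
        gcongr with t
        exact volume_closedBall_five_mul_le _ _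
    _ = 5 * ∑' t : F, c * volume (Metric.closedBall (t : UnitAddCircle) (u t)) := by
        rw [ENNReal.tsum_mul_left, ENNReal.tsum_mul_left]; ring
    _ ≤ 5 * ∑' t : F, σ (Metric.closedBall (t : UnitAddCircle) (u t)) := by
        gcongr with t
        exact hu t (hFE t.2)
    _ = 5 * σ (⋃ t ∈ F, Metric.closedBall (t : UnitAddCircle) (u t)) := by
        rw [measure_biUnion hFc hdisj fun t _ => Metric.isClosed_closedBall.measurableSet]
    _ ≤ 5 * σ Set.univ := by gcongr; exact Set.subset_univ _

/-! ### Boundary limits of Poisson integrals of measures -/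

theorem poissonLIntegral_restrict_compl_le (σ : Measure UnitAddCircle) {t : UnitAddCircle} {r δ : ℝ}
    (hr0 : 0 ≤ r) (hr1 : r < 1) (hδ : 0 < δ) :
    ∫⁻ s in (Metric.closedBall t δ)ᶜ, ENNReal.ofReal (poissonProfile r ‖s - t‖) ∂σ ≤
      ENNReal.ofReal (poissonProfile r δ) * σ Set.univ := by
  calc _ ≤ ∫⁻ _ in (Metric.closedBall t δ)ᶜ, ENNReal.ofReal (poissonProfile r δ) ∂σ := by
        refine setLIntegral_mono measurable_const fun s hs => ?_
        rw [Set.mem_compl_iff, Metric.mem_closedBall, dist_eq_norm, not_le] at hs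
        exact ENNReal.ofReal_le_ofReal (poissonProfile_anti hr0 hr1 hδ.le hs.le
          (norm_le_half_unitAddCircle _))
    _ ≤ _ := by
        rw [setLIntegral_const]
        gcongr
        exact Set.subset_univ _

theorem closedBall_inter_closedBall_self (t : UnitAddCircle) (u δ : ℝ) :
    Metric.closedBall t u ∩ Metric.closedBall t δ = Metric.closedBall t (min u δ) := by
  ext s; simp

theorem tendsto_poissonLIntegral {σ : Measure UnitAddCircle} [IsFiniteMeasure σ]
    {t : UnitAddCircle} {D : ℝ≥0∞}
    (hD : Tendsto (fun u : ℝ => σ (Metric.closedBall t u) / volume (Metric.closedBall t u))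
      (𝓝[>] 0) (𝓝 D)) :
    Tendsto (fun r => poissonLIntegral σ r t) (𝓝[<] 1) (𝓝 D) := by
  have hvol (u : ℝ) (hu : 0 < u) : volume (Metric.closedBall t u) ≠ 0 :=
    (Metric.measure_closedBall_pos _ t hu).ne'
  have hprof {δ : ℝ} (hδ : 0 < δ) (hδ' : δ ≤ 1 / 2) :
      Tendsto (fun r => ENNReal.ofReal (poissonProfile r δ)) (𝓝[<] 1) (𝓝 0) := by
    simpa using ENNReal.tendsto_ofReal (tendsto_poissonProfile hδ hδ')
  have hscale {P : ℝ → Prop} (h : ∀ᶠ u in 𝓝[>] (0 : ℝ), P u) :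
      ∃ δ, 0 < δ ∧ δ ≤ 1 / 2 ∧ ∀ u, 0 < u → u ≤ δ → P u := by
    obtain ⟨δ, hδ, hP⟩ := mem_nhdsGT_iff_exists_Ioc_subset.1 h
    exact ⟨min δ (1 / 2), lt_min hδ (by norm_num), min_le_right _ _,
      fun u hu hu' => hP ⟨hu, hu'.trans (min_le_left _ _)⟩⟩
  have hev : ∀ᶠ r : ℝ in 𝓝[<] 1, 0 < r ∧ r < 1 := eventually_nhdsLT_one
  refine tendsto_order.2 ⟨fun a ha => ?_, fun a ha => ?_⟩
  · obtain ⟨b, hab, hbD⟩ := exists_between ha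
    have hb : b ≠ ∞ := (hbD.trans_le le_top).ne
    obtain ⟨δ, hδ, hδ', hP⟩ := hscale (hD.eventually (lt_mem_nhds hbD))
    have hfin : IsFiniteMeasure (b • (volume.restrict (Metric.closedBall t δ))) :=
      Measure.smul_finite _ hb
    have h1 : ∀ r : ℝ, 0 < r ∧ r < 1 →
        b * (1 - ENNReal.ofReal (poissonProfile r δ)) ≤ poissonLIntegral σ r t := by
      rintro r ⟨hr0, hr1⟩
      have h2 : 1 ≤ poissonLIntegral (volume.restrict (Metric.closedBall t δ)) r t +
          ENNReal.ofReal (poissonProfile r δ) := by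
        have h3 := poissonLIntegral_restrict_compl_le volume (t := t) hr0.le hr1 hδ
        rw [measure_univ, mul_one] at h3
        rw [← poissonLIntegral_volume hr0.le hr1 t]
        refine le_trans (le_of_eq ?_) (add_le_add_right h3 _)
        exact (lintegral_add_compl _ Metric.isClosed_closedBall.measurableSet).symm
      have h4 : b * poissonLIntegral (volume.restrict (Metric.closedBall t δ)) r t ≤
          poissonLIntegral σ r t := by
        refine le_trans (le_of_eq ?_) (poissonLIntegral_mono
          (α := b • (volume.restrict (Metric.closedBall t δ))) (fun u hu => ?_) hr0.le hr1)
        · rw [poissonLIntegral, poissonLIntegral, lintegral_smul_measure, smul_eq_mul]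
        · rw [Measure.smul_apply, smul_eq_mul,
            Measure.restrict_apply Metric.isClosed_closedBall.measurableSet,
            closedBall_inter_closedBall_self]
          have := (hP (min u δ) (lt_min hu hδ) (min_le_right _ _)).le
          rw [ENNReal.le_div_iff_mul_le (Or.inl (hvol _ (lt_min hu hδ)))
            (Or.inl (measure_ne_top _ _))] at this
          exact this.trans (measure_mono (Metric.closedBall_subset_closedBall (min_le_left _ _)))
      refine le_trans ?_ h4
      gcongr
      exact tsub_le_iff_right.2 h2
    have h5 : Tendsto (fun r => b * (1 - ENNReal.ofReal (poissonProfile r δ))) (𝓝[<] 1) (𝓝 b) := by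
      have := ENNReal.Tendsto.const_mul (a := b)
        (ENNReal.Tendsto.sub (tendsto_const_nhds (x := (1 : ℝ≥0∞))) (hprof hδ hδ')
          (Or.inl ENNReal.one_ne_top)) (Or.inr hb)
      simpa using this
    filter_upwards [h5.eventually (lt_mem_nhds hab), hev] with r hr hr'
    exact hr.trans_le (h1 r hr')
  · obtain ⟨b, hDb, hba⟩ := exists_between ha
    have hb : b ≠ ∞ := (hba.trans_le le_top).ne
    obtain ⟨δ, hδ, hδ', hP⟩ := hscale (hD.eventually (gt_mem_nhds hDb))
    have hfin : IsFiniteMeasure (b • (volume : Measure UnitAddCircle)) :=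
      Measure.smul_finite _ hb
    have h1 : ∀ r : ℝ, 0 < r ∧ r < 1 →
        poissonLIntegral σ r t ≤ b + ENNReal.ofReal (poissonProfile r δ) * σ Set.univ := by
      rintro r ⟨hr0, hr1⟩
      have h2 : poissonLIntegral (σ.restrict (Metric.closedBall t δ)) r t ≤ b := by
        refine (poissonLIntegral_mono (β := b • volume) (fun u hu => ?_) hr0.le hr1).trans ?_
        · rw [Measure.restrict_apply Metric.isClosed_closedBall.measurableSet,
            closedBall_inter_closedBall_self, Measure.smul_apply, smul_eq_mul]
          have := (hP (min u δ) (lt_min hu hδ) (min_le_right _ _)).le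
          rw [ENNReal.div_le_iff_le_mul (Or.inl (hvol _ (lt_min hu hδ)))
            (Or.inl (measure_ne_top _ _))] at this
          refine this.trans ?_
          gcongr
          exact min_le_left _ _
        · rw [poissonLIntegral, lintegral_smul_measure]
          change b • poissonLIntegral volume r t ≤ b
          rw [poissonLIntegral_volume hr0.le hr1, smul_eq_mul, mul_one]
      refine le_trans (le_of_eq ?_) (add_le_add h2
        (poissonLIntegral_restrict_compl_le σ (t := t) hr0.le hr1 hδ))
      exact (lintegral_add_compl _ Metric.isClosed_closedBall.measurableSet).symm
    have h5 : Tendsto (fun r => b + ENNReal.ofReal (poissonProfile r δ) * σ Set.univ) (𝓝[<] 1)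
        (𝓝 b) := by
      have := (tendsto_const_nhds (x := b)).add (ENNReal.Tendsto.mul_const (b := σ Set.univ)
        (hprof hδ hδ') (Or.inr (measure_ne_top _ _)))
      simpa using this
    filter_upwards [h5.eventually (gt_mem_nhds hba), hev] with r hr hr'
    exact (h1 r hr').trans_lt hr

theorem ae_tendsto_poissonLIntegral (σ : Measure UnitAddCircle) [IsFiniteMeasure σ] :
    ∀ᵐ t, ∃ D : ℝ≥0∞, D ≠ ∞ ∧ Tendsto (fun r => poissonLIntegral σ r t) (𝓝[<] 1) (𝓝 D) := by
  filter_upwards [VitaliFamily.ae_tendsto_rnDeriv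
    (IsUnifLocDoublingMeasure.vitaliFamily (volume : Measure UnitAddCircle) 1) σ,
    σ.rnDeriv_lt_top volume] with t ht htop
  refine ⟨σ.rnDeriv volume t, htop.ne, tendsto_poissonLIntegral ?_⟩
  refine ht.comp (IsUnifLocDoublingMeasure.tendsto_closedBall_filterAt volume (fun _ => t)
    (fun u => u) tendsto_id ?_)
  filter_upwards [self_mem_nhdsWithin] with u hu
  exact Metric.mem_closedBall_self (by simpa using (Set.mem_Ioi.1 hu).le)

end

section

/-! ### Weak limits of densities -/

theorem exists_tendsto_ultrafilter {ι : Type*} (l : Ultrafilter ι) {f : ι → ℝ} {C : ℝ}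
    (hf : ∀ᶠ i in (l : Filter ι), |f i| ≤ C) : ∃ x, Tendsto f l (𝓝 x) := by
  have h : ∀ᶠ i in (l : Filter ι), f i ∈ Set.Icc (-C) C := hf.mono fun i hi => abs_le.1 hi
  obtain ⟨x, -, hx⟩ := isCompact_Icc.ultrafilter_le_nhds' (l.map f) h
  exact ⟨x, hx⟩

/-- Along an ultrafilter, nonnegative densities with bounded mass converge weakly to a measure. -/
theorem exists_weak_limit {ι : Type*} (l : Ultrafilter ι) {h : ι → UnitAddCircle → ℝ} {C : ℝ}
    (hc : ∀ᶠ i in (l : Filter ι), Continuous (h i)) (h0 : ∀ i t, 0 ≤ h i t)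
    (hC : ∀ᶠ i in (l : Filter ι), ∫ t, h i t ≤ C) :
    ∃ σ : Measure UnitAddCircle, IsFiniteMeasure σ ∧ ∀ g : UnitAddCircle → ℝ, Continuous g →
      Tendsto (fun i => ∫ t, g t * h i t) l (𝓝 (∫ t, g t ∂σ)) := by
  have hint {g : UnitAddCircle → ℝ} (hg : Continuous g) : Integrable g :=
    hg.integrable_of_hasCompactSupport (HasCompactSupport.of_compactSpace _)
  have hex (g : UnitAddCircle → ℝ) (hg : Continuous g) :
      ∃ x, Tendsto (fun i => ∫ t, g t * h i t) l (𝓝 x) := by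
    obtain ⟨c, hc'⟩ : ∃ c, ∀ t, |g t| ≤ c := by
      obtain ⟨c, hc'⟩ := isCompact_univ.exists_bound_of_continuousOn hg.continuousOn
      exact ⟨c, fun t => hc' t trivial⟩
    refine exists_tendsto_ultrafilter l (C := c * C) ?_
    filter_upwards [hc, hC] with i hi hi'
    have hc0 : 0 ≤ c := (abs_nonneg _).trans (hc' 0)
    calc |∫ t, g t * h i t| ≤ ∫ t, c * h i t := by
          rw [← Real.norm_eq_abs]
          refine norm_integral_le_of_norm_le ((hint hi).const_mul c)
            (Eventually.of_forall fun t => ?_)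
          rw [Real.norm_eq_abs, abs_mul, abs_of_nonneg (h0 i t)]
          exact mul_le_mul_of_nonneg_right (hc' t) (h0 i t)
      _ ≤ c * C := by
          rw [integral_const_mul]
          exact mul_le_mul_of_nonneg_left hi' hc0
  let Λ₀ : CompactlySupportedContinuousMap UnitAddCircle ℝ →ₗ[ℝ] ℝ :=
    { toFun g := (hex g g.continuous).choose
      map_add' f g := by
        refine tendsto_nhds_unique (hex _ (f + g).continuous).choose_spec ?_
        refine ((hex f f.continuous).choose_spec.add (hex g g.continuous).choose_spec).congr' ?_
        filter_upwards [hc] with i hi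
        refine (integral_add (hint (f.continuous.mul hi)) (hint (g.continuous.mul hi))).symm.trans ?_
        refine integral_congr_ae (Eventually.of_forall fun t => ?_)
        exact (add_mul _ _ _).symm
      map_smul' c g := by
        refine tendsto_nhds_unique (hex _ (c • g).continuous).choose_spec ?_
        refine ((hex g g.continuous).choose_spec.const_mul c).congr fun i => ?_
        rw [← integral_const_mul]
        simp [mul_assoc] }
  have hΛ₀ (g) (hg : 0 ≤ g) : 0 ≤ Λ₀ g := by
    refine ge_of_tendsto' (hex g g.continuous).choose_spec fun i => ?_
    exact integral_nonneg fun t => mul_nonneg (hg t) (h0 i t)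
  let Λ := PositiveLinearMap.mk₀ Λ₀ hΛ₀
  refine ⟨RealRMK.rieszMeasure Λ, inferInstance, fun g hg => ?_⟩
  let G : CompactlySupportedContinuousMap UnitAddCircle ℝ :=
    ⟨⟨g, hg⟩, HasCompactSupport.of_compactSpace _⟩
  have h1 := RealRMK.integral_rieszMeasure Λ G
  have h2 : ∫ t, g t ∂(RealRMK.rieszMeasure Λ) = Λ G := h1
  rw [h2]
  exact (hex g hg).choose_spec

/-! ### Boundary limits of harmonic functions -/

/-- A family of continuous functions on the circle that is reproduced by Poisson kernels: the
traces on the circles `|z| = ρ` of a harmonic function in the disc. -/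
structure PoissonFamily {E : Type*} [NormedAddCommGroup E] [NormedSpace ℝ E]
    (U : ℝ → UnitAddCircle → E) : Prop where
  continuous : ∀ ρ, 0 ≤ ρ → ρ < 1 → Continuous (U ρ)
  continuousAt : ∀ t ρ, 0 ≤ ρ → ρ < 1 → ContinuousAt (fun r => U r t) ρ
  reproduce : ∀ r ρ t, 0 ≤ r → r < 1 → 0 ≤ ρ → ρ < 1 →
    U (r * ρ) t = ∫ s, poissonProfile r ‖s - t‖ • U ρ s

theorem continuous_poissonProfile_norm_sub {r : ℝ} (hr0 : 0 ≤ r) (hr1 : r < 1)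
    (t : UnitAddCircle) : Continuous fun s : UnitAddCircle => poissonProfile r ‖s - t‖ :=
  (continuous_poissonProfile hr0 hr1).comp (by fun_prop)

theorem toReal_poissonLIntegral {σ : Measure UnitAddCircle} {r : ℝ} (hr0 : 0 ≤ r)
    (hr1 : r < 1) (t : UnitAddCircle) :
    (poissonLIntegral σ r t).toReal = ∫ s, poissonProfile r ‖s - t‖ ∂σ :=
  (integral_eq_lintegral_of_nonneg_ae
    (Eventually.of_forall fun _ => poissonProfile_nonneg hr0 hr1 _)
    (continuous_poissonProfile_norm_sub hr0 hr1 t).aestronglyMeasurable).symm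

theorem PoissonFamily.clm_comp {E F : Type*} [NormedAddCommGroup E] [NormedSpace ℝ E]
    [NormedAddCommGroup F] [NormedSpace ℝ F] [CompleteSpace E] [CompleteSpace F]
    {U : ℝ → UnitAddCircle → E}
    (hU : PoissonFamily U) (L : E →L[ℝ] F) : PoissonFamily fun r t => L (U r t) where
  continuous ρ h0 h1 := L.continuous.comp (hU.continuous ρ h0 h1)
  continuousAt t ρ h0 h1 := L.continuous.continuousAt.comp (hU.continuousAt t ρ h0 h1)
  reproduce r ρ t hr0 hr1 hρ0 hρ1 := by
    rw [hU.reproduce r ρ t hr0 hr1 hρ0 hρ1, ← L.integral_comp_comm]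
    · simp
    · exact ((continuous_poissonProfile_norm_sub hr0 hr1 t).smul
        (hU.continuous ρ hρ0 hρ1)).integrable_of_hasCompactSupport
        (HasCompactSupport.of_compactSpace _)

theorem PoissonFamily.ae_exists_tendsto_real {U : ℝ → UnitAddCircle → ℝ} (hU : PoissonFamily U)
    {C : ℝ} (hC : ∀ ρ, 0 ≤ ρ → ρ < 1 → ∫ t, |U ρ t| ≤ C) :
    ∀ᵐ t, ∃ x : ℝ, Tendsto (fun r => U r t) (𝓝[<] 1) (𝓝 x) := by
  set l : Ultrafilter ℝ := Ultrafilter.of (𝓝[<] (1 : ℝ)) with hl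
  have hl1 : (l : Filter ℝ) ≤ 𝓝[<] 1 := Ultrafilter.of_le _
  have hev : ∀ᶠ r : ℝ in (l : Filter ℝ), 0 < r ∧ r < 1 := hl1 eventually_nhdsLT_one
  have hint {g : UnitAddCircle → ℝ} (hg : Continuous g) : Integrable g :=
    hg.integrable_of_hasCompactSupport (HasCompactSupport.of_compactSpace _)
  have hpm (V : ℝ → ℝ) (hV : Continuous V) (hV0 : ∀ x, 0 ≤ V x) (hVa : ∀ x, V x ≤ |x|) :=
    exists_weak_limit l (h := fun ρ t => V (U ρ t)) (C := C)
      (hev.mono fun ρ hρ => hV.comp (hU.continuous ρ hρ.1.le hρ.2)) (fun _ _ => hV0 _)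
      (hev.mono fun ρ hρ => (integral_mono
        (hint (hV.comp (hU.continuous ρ hρ.1.le hρ.2)))
        (hint (hU.continuous ρ hρ.1.le hρ.2).abs) fun t => hVa _).trans (hC ρ hρ.1.le hρ.2))
  obtain ⟨σ₁, hσ₁, h₁⟩ := hpm (fun x => max x 0) (by fun_prop) (fun x => le_max_right _ _)
    (fun x => max_le (le_abs_self x) (abs_nonneg x))
  obtain ⟨σ₂, hσ₂, h₂⟩ := hpm (fun x => max (-x) 0) (by fun_prop) (fun x => le_max_right _ _)
    (fun x => max_le (neg_le_abs x) (abs_nonneg x))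
  have hrep {r : ℝ} (hr0 : 0 ≤ r) (hr1 : r < 1) (t : UnitAddCircle) :
      U r t = (poissonLIntegral σ₁ r t).toReal - (poissonLIntegral σ₂ r t).toReal := by
    rw [toReal_poissonLIntegral hr0 hr1, toReal_poissonLIntegral hr0 hr1]
    have hp := continuous_poissonProfile_norm_sub hr0 hr1 t
    refine tendsto_nhds_unique (f := fun ρ => U (r * ρ) t) (l := l) ?_
      (((h₁ _ hp).sub (h₂ _ hp)).congr' ?_)
    · have h1 : Tendsto (fun ρ : ℝ => r * ρ) l (𝓝 r) := by
        have : Tendsto (fun ρ : ℝ => r * ρ) (𝓝 1) (𝓝 (r * 1)) := tendsto_id.const_mul r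
        rw [mul_one] at this
        exact this.mono_left (hl1.trans nhdsWithin_le_nhds)
      exact (hU.continuousAt t r hr0 hr1).tendsto.comp h1
    · filter_upwards [hev] with ρ hρ
      have hUc := hU.continuous ρ hρ.1.le hρ.2
      rw [hU.reproduce r ρ t hr0 hr1 hρ.1.le hρ.2,
        ← integral_sub (hint (by fun_prop)) (hint (by fun_prop))]
      refine integral_congr_ae (Eventually.of_forall fun s => ?_)
      simp only [smul_eq_mul]
      rw [← mul_sub]
      congr 1
      rcases le_total 0 (U ρ s) with h | h
      · rw [max_eq_left h, max_eq_right (by linarith), sub_zero]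
      · rw [max_eq_right h, max_eq_left (by linarith)]; ring
  filter_upwards [ae_tendsto_poissonLIntegral σ₁, ae_tendsto_poissonLIntegral σ₂] with t h₁ h₂
  obtain ⟨D₁, hD₁, h₁⟩ := h₁
  obtain ⟨D₂, hD₂, h₂⟩ := h₂
  refine ⟨D₁.toReal - D₂.toReal, (((ENNReal.tendsto_toReal hD₁).comp h₁).sub
    ((ENNReal.tendsto_toReal hD₂).comp h₂)).congr' ?_⟩
  filter_upwards [eventually_nhdsLT_one] with r hr using (hrep hr.1.le hr.2 t).symm

theorem PoissonFamily.ae_exists_tendsto {U : ℝ → UnitAddCircle → ℂ} (hU : PoissonFamily U)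
    {C : ℝ} (hC : ∀ ρ, 0 ≤ ρ → ρ < 1 → ∫ t, ‖U ρ t‖ ≤ C) :
    ∀ᵐ t, ∃ x : ℂ, Tendsto (fun r => U r t) (𝓝[<] 1) (𝓝 x) := by
  have hint {g : UnitAddCircle → ℝ} (hg : Continuous g) : Integrable g :=
    hg.integrable_of_hasCompactSupport (HasCompactSupport.of_compactSpace _)
  have h1 := (hU.clm_comp Complex.reCLM).ae_exists_tendsto_real (C := C) fun ρ h0 h1 =>
    (integral_mono (hint ((hU.clm_comp Complex.reCLM).continuous ρ h0 h1).abs)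
      (hint (hU.continuous ρ h0 h1).norm) fun t => Complex.abs_re_le_norm _).trans (hC ρ h0 h1)
  have h2 := (hU.clm_comp Complex.imCLM).ae_exists_tendsto_real (C := C) fun ρ h0 h1 =>
    (integral_mono (hint ((hU.clm_comp Complex.imCLM).continuous ρ h0 h1).abs)
      (hint (hU.continuous ρ h0 h1).norm) fun t => Complex.abs_im_le_norm _).trans (hC ρ h0 h1)
  filter_upwards [h1, h2] with t ⟨x, hx⟩ ⟨y, hy⟩
  refine ⟨x + y * Complex.I, ?_⟩
  have hx' := (Complex.continuous_ofReal.tendsto x).comp hx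
  have hy' := (Complex.continuous_ofReal.tendsto y).comp hy
  refine (hx'.add (hy'.mul_const Complex.I)).congr fun r => ?_
  exact Complex.re_add_im _

/-! ### The weak type inequality for harmonic functions -/

theorem PoissonFamily.enorm_le_poissonLIntegral {E : Type*} [NormedAddCommGroup E]
    [NormedSpace ℝ E] {U : ℝ → UnitAddCircle → E} (hU : PoissonFamily U)
    {r ρ : ℝ} (hr0 : 0 ≤ r) (hr1 : r < 1) (hρ0 : 0 ≤ ρ) (hρ1 : ρ < 1) (t : UnitAddCircle) :
    ‖U (r * ρ) t‖ₑ ≤ poissonLIntegral (volume.withDensity fun s => ‖U ρ s‖ₑ) r t := by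
  have hUc := (hU.continuous ρ hρ0 hρ1).enorm
  rw [hU.reproduce r ρ t hr0 hr1 hρ0 hρ1, poissonLIntegral,
    lintegral_withDensity_eq_lintegral_mul _ hUc.measurable
      (continuous_poissonProfile_norm_sub hr0 hr1 t).measurable.ennreal_ofReal]
  refine (enorm_integral_le_lintegral_enorm _).trans (lintegral_mono fun s => le_of_eq ?_)
  rw [enorm_smul, Pi.mul_apply, mul_comm, Real.enorm_eq_ofReal (poissonProfile_nonneg hr0 hr1 _)]

theorem PoissonFamily.volume_lt_le {E : Type*} [NormedAddCommGroup E]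
    [NormedSpace ℝ E] {U : ℝ → UnitAddCircle → E} (hU : PoissonFamily U) {ρ : ℝ} (hρ0 : 0 < ρ)
    (hρ1 : ρ < 1) {c : ℝ≥0∞} (hc0 : c ≠ 0) (hc : c ≠ ∞) :
    volume {t | ∃ r, 0 ≤ r ∧ r < ρ ∧ c < ‖U r t‖ₑ} ≤ 5 * (∫⁻ t, ‖U ρ t‖ₑ) / c := by
  have hUc := (hU.continuous ρ hρ0.le hρ1)
  have hfin : IsFiniteMeasure (volume.withDensity fun s => ‖U ρ s‖ₑ) := by
    refine isFiniteMeasure_withDensity ?_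
    exact (hUc.integrable_of_hasCompactSupport
      (HasCompactSupport.of_compactSpace _)).hasFiniteIntegral.ne
  have h := volume_maximal_le (volume.withDensity fun s => ‖U ρ s‖ₑ) hc0 hc
  rw [withDensity_apply _ MeasurableSet.univ, Measure.restrict_univ] at h
  refine (measure_mono ?_).trans h
  rintro t ⟨r, hr0, hrρ, hr⟩
  have e : r / ρ * ρ = r := by field_simp
  refine ⟨r / ρ, by positivity, (div_lt_one hρ0).2 hrρ, ?_⟩
  have := hU.enorm_le_poissonLIntegral (r := r / ρ) (by positivity) ((div_lt_one hρ0).2 hrρ)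
    hρ0.le hρ1 t
  rw [e] at this
  exact hr.trans_le this

theorem PoissonFamily.lintegral_enorm_mono {E : Type*} [NormedAddCommGroup E]
    [NormedSpace ℝ E] {U : ℝ → UnitAddCircle → E} (hU : PoissonFamily U) {r ρ : ℝ} (hr0 : 0 ≤ r)
    (hrρ : r ≤ ρ) (hρ1 : ρ < 1) : ∫⁻ t, ‖U r t‖ₑ ≤ ∫⁻ t, ‖U ρ t‖ₑ := by
  rcases hrρ.eq_or_lt with rfl | hlt
  · exact le_rfl
  have hρ0 : 0 < ρ := hr0.trans_lt hlt
  have e : r / ρ * ρ = r := by field_simp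
  have hq0 : 0 ≤ r / ρ := by positivity
  have hq1 : r / ρ < 1 := (div_lt_one hρ0).2 hlt
  have hUm := (hU.continuous ρ hρ0.le hρ1).enorm.measurable
  have hk : Measurable fun p : UnitAddCircle × UnitAddCircle =>
      ENNReal.ofReal (poissonProfile (r / ρ) ‖p.2 - p.1‖) :=
    ((continuous_poissonProfile hq0 hq1).comp (by fun_prop)).measurable.ennreal_ofReal
  calc ∫⁻ t, ‖U r t‖ₑ
      ≤ ∫⁻ t, ∫⁻ s, ‖U ρ s‖ₑ * ENNReal.ofReal (poissonProfile (r / ρ) ‖s - t‖) := by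
        refine lintegral_mono fun t => ?_
        have := hU.enorm_le_poissonLIntegral hq0 hq1 hρ0.le hρ1 t
        rw [e, poissonLIntegral, lintegral_withDensity_eq_lintegral_mul _ hUm
          (continuous_poissonProfile_norm_sub hq0 hq1 t).measurable.ennreal_ofReal] at this
        exact this
    _ = ∫⁻ s, ∫⁻ t, ‖U ρ s‖ₑ * ENNReal.ofReal (poissonProfile (r / ρ) ‖s - t‖) :=
        lintegral_lintegral_swap ((hUm.comp measurable_snd).mul hk).aemeasurable
    _ = ∫⁻ s, ‖U ρ s‖ₑ := by
        refine lintegral_congr fun s => ?_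
        have h1 : ∫⁻ t : UnitAddCircle, ENNReal.ofReal (poissonProfile (r / ρ) ‖s - t‖) = 1 := by
          rw [← poissonLIntegral_volume hq0 hq1 s, poissonLIntegral]
          simp only [norm_sub_rev s]
        have hm : Measurable fun t : UnitAddCircle =>
            ENNReal.ofReal (poissonProfile (r / ρ) ‖s - t‖) :=
          ((continuous_poissonProfile hq0 hq1).comp (by fun_prop)).measurable.ennreal_ofReal
        rw [lintegral_const_mul _ hm, h1, mul_one]

end

section

variable {m : ℕ → ℕ} {a : (ℕ →₀ ℤ) → ℂ} {A : ℝ}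

/-! ### Restriction of the extension to the orbits of the flow -/

theorem natAbs_deg {ν : ℕ →₀ ℤ} (h : 0 ≤ ν ∨ ν ≤ 0) : (deg m ν).natAbs = wt m ν := by
  have hpos {ν : ℕ →₀ ℤ} (h : 0 ≤ ν) : deg m ν = wt m ν := by
    simp only [deg, wt, Finsupp.sum]
    push_cast
    exact Finset.sum_congr rfl fun j _ => by rw [abs_of_nonneg (h j)]
  rcases h with h | h
  · rw [hpos h, Int.natAbs_natCast]
  · have h1 := hpos (ν := -ν) (neg_nonneg.2 h)
    have h2 : deg m (-ν) = -deg m ν := by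
      simp [deg, Finsupp.sum]
    have h3 : wt m (-ν) = wt m ν := by
      simp [wt, Finsupp.sum]
    rw [h2, h3] at h1
    omega

theorem dilate_real_flow (r : ℝ) (t : UnitAddCircle) (w : Torus) :
    dilate m a r (flow m t w) =
      ∑' ν, ((r : ℂ) ^ wt m ν * (a ν * character ν w)) * fourier (deg m ν) t := by
  rw [dilate_real]
  refine tsum_congr fun ν => ?_
  rw [character_flow]; ring

theorem continuousAt_dilate_real (H : Weights m) (ha : ∀ ν, ‖a ν‖ ≤ A) {ρ : ℝ} (hρ0 : 0 ≤ ρ)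
    (hρ1 : ρ < 1) (w : Torus) : ContinuousAt (fun r : ℝ => dilate m a r w) ρ := by
  obtain ⟨R, hρR, hR1⟩ := exists_between hρ1
  have hR0 : 0 ≤ R := hρ0.trans hρR.le
  have e : (fun r : ℝ => dilate m a r w) =
      fun r : ℝ => ∑' ν, (r : ℂ) ^ wt m ν * (a ν * character ν w) := funext fun r => dilate_real r w
  have h : ContinuousOn (fun r : ℝ => dilate m a r w) (Set.Ioo (-R) R) := by
    rw [e]
    refine continuousOn_tsum (u := fun ν => R ^ wt m ν * A) (fun ν => by fun_prop)
      ((H.summable_wt hR0 hR1).mul_right A) fun ν r hr => ?_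
    rw [norm_mul, norm_mul, norm_character, mul_one, norm_pow, Complex.norm_real, Real.norm_eq_abs]
    have : |r| ≤ R := (abs_lt.2 hr).le
    gcongr
    exact ha ν
  exact h.continuousAt (Ioo_mem_nhds (by linarith) hρR)

theorem poissonFamily_dilate (H : Weights m) (ha : ∀ ν, ‖a ν‖ ≤ A) (hs : HasOneSignedSpectrum a)
    (w : Torus) : PoissonFamily fun r t => dilate m a r (flow m t w) where
  continuous ρ h0 h1 := (continuous_dilate H ha (by simpa [abs_of_nonneg h0] using h1)).comp
    ((continuous_flow m).comp (by fun_prop : Continuous fun t : UnitAddCircle => (t, w)))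
  continuousAt t ρ h0 h1 := continuousAt_dilate_real H ha h0 h1 _
  reproduce r ρ t hr0 hr1 hρ0 hρ1 := by
    have hint {g : UnitAddCircle → ℂ} (hg : Continuous g) : Integrable g :=
      hg.integrable_of_hasCompactSupport (HasCompactSupport.of_compactSpace _)
    have hp := continuous_poissonProfile_norm_sub hr0 hr1 t
    have h1 (ν : ℕ →₀ ℤ) : ∫ s, (poissonProfile r ‖s - t‖ : ℂ) *
        (((ρ : ℂ) ^ wt m ν * (a ν * character ν w)) * fourier (deg m ν) s) =
        (((r * ρ : ℝ) : ℂ) ^ wt m ν * (a ν * character ν w)) * fourier (deg m ν) t := by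
      by_cases h : a ν = 0
      · simp [h]
      have : (fun s => (poissonProfile r ‖s - t‖ : ℂ) *
          (((ρ : ℂ) ^ wt m ν * (a ν * character ν w)) * fourier (deg m ν) s)) = fun s =>
          ((ρ : ℂ) ^ wt m ν * (a ν * character ν w)) *
            ((poissonProfile r ‖s - t‖ : ℂ) * fourier (deg m ν) s) := by
        funext s; ring
      rw [this, integral_const_mul, integral_poissonProfile_mul_fourier hr0 hr1,
        natAbs_deg (hs ν h)]
      push_cast
      ring
    have h2 := hasSum_integral_of_summable_integral_norm (μ := (volume : Measure UnitAddCircle))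
      (F := fun (ν : ℕ →₀ ℤ) s => (poissonProfile r ‖s - t‖ : ℂ) *
        (((ρ : ℂ) ^ wt m ν * (a ν * character ν w)) * fourier (deg m ν) s))
      (fun ν => hint (by fun_prop)) (by
        refine (summable_dilate_real H ha hρ0 hρ1 w).congr fun ν => ?_
        simp only [norm_mul _ ((_ : ℂ) * fourier _ _), norm_mul _ (fourier _ _), norm_fourier_apply,
          mul_one, Complex.norm_real, Real.norm_of_nonneg (poissonProfile_nonneg hr0 hr1 _)]
        rw [integral_mul_const, integral_poissonProfile hr0 hr1, one_mul])
    simp only [h1] at h2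
    rw [dilate_real_flow, h2.tsum_eq]
    refine integral_congr_ae (Eventually.of_forall fun s => ?_)
    simp only
    rw [dilate_real_flow, tsum_mul_left, Complex.real_smul]

/-- Averaging over the orbits of the flow does not change integrals. -/
theorem lintegral_eq_lintegral_flow (m : ℕ → ℕ) {φ : Torus → ℝ≥0∞} (hφ : Measurable φ) :
    ∫⁻ w, φ w ∂haar = ∫⁻ w, (∫⁻ t, φ (flow m t w)) ∂haar := by
  have hm : Measurable fun p : Torus × UnitAddCircle => φ (flow m p.2 p.1) :=
    hφ.comp ((continuous_flow m).comp continuous_swap).measurable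
  rw [lintegral_lintegral_swap hm.aemeasurable]
  have h (t : UnitAddCircle) : ∫⁻ w, φ (flow m t w) ∂haar = ∫⁻ w, φ w ∂haar :=
    (measurePreserving_flow m t).lintegral_comp hφ
  simp only [h, lintegral_const, measure_univ, mul_one]

theorem measure_eq_lintegral_flow (m : ℕ → ℕ) {s : Set Torus} (hs : MeasurableSet s) :
    haar s = ∫⁻ w, volume {t | flow m t w ∈ s} ∂haar := by
  rw [← lintegral_indicator_one hs, lintegral_eq_lintegral_flow m (measurable_one.indicator hs)]
  refine lintegral_congr fun w => ?_
  have hc : Measurable fun t => flow m t w :=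
    ((continuous_flow m).comp (by fun_prop : Continuous fun t : UnitAddCircle => (t, w))).measurable
  exact lintegral_indicator_one (μ := volume) (hc hs)

/-- An exhausting sequence of radii. -/
def radius (n : ℕ) : ℝ := 1 - 1 / (n + 2)

theorem radius_pos (n : ℕ) : 0 < radius n := by
  have : (1 : ℝ) / (n + 2) < 1 := by
    rw [div_lt_one (by positivity)]
    have : (0 : ℝ) ≤ n := by positivity
    linarith
  unfold radius; linarith

theorem radius_lt_one (n : ℕ) : radius n < 1 := by
  have : (0 : ℝ) < 1 / (n + 2) := by positivity
  unfold radius; linarith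

theorem radius_mono : Monotone radius := by
  intro a b hab
  unfold radius
  gcongr

theorem tendsto_radius : Tendsto radius atTop (𝓝[<] 1) := by
  refine tendsto_nhdsWithin_iff.2 ⟨?_, Eventually.of_forall radius_lt_one⟩
  have h : Tendsto (fun n : ℕ => (1 : ℝ) / ((n + 1 : ℕ) + 1)) atTop (𝓝 0) :=
    (tendsto_add_atTop_iff_nat 1).2 tendsto_one_div_add_atTop_nhds_zero_nat
  have h2 := h.const_sub 1
  rw [sub_zero] at h2
  refine h2.congr fun n => ?_
  unfold radius
  push_cast
  ring_nf

theorem exists_lt_radius {r : ℝ} (hr : r < 1) : ∃ n, r < radius n :=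
  ((tendsto_radius.mono_right nhdsWithin_le_nhds).eventually (lt_mem_nhds hr)).exists

/-! ### The weak type inequality on the torus -/

theorem haar_lt_maximal_le (H : Weights m) (ha : ∀ ν, ‖a ν‖ ≤ A) (hs : HasOneSignedSpectrum a)
    {T : ℝ≥0∞} (hT : ∀ r : ℝ, 0 ≤ r → r < 1 → ∫⁻ w, ‖dilate m a r w‖ₑ ∂haar ≤ T) {c : ℝ≥0∞}
    (hc0 : c ≠ 0) (hc : c ≠ ∞) : haar {w | c < maximal m a w} ≤ 5 * T / c := by
  set E : ℝ → Set Torus := fun ρ => {w | ∃ r : ℝ, 0 ≤ r ∧ r < ρ ∧ c < ‖dilate m a r w‖ₑ} with hE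
  have hsub : {w | c < maximal m a w} ⊆ ⋃ n, E (radius n) := by
    intro w hw
    rw [Set.mem_ofPred_eq, maximal, lt_iSup_iff] at hw
    obtain ⟨r, hr⟩ := hw
    obtain ⟨hr01, hr⟩ := lt_iSup_iff.1 hr
    obtain ⟨n, hn⟩ := exists_lt_radius hr01.2
    exact Set.mem_iUnion.2 ⟨n, r, hr01.1.le, hn, hr⟩
  have hmono : Monotone fun n => E (radius n) := by
    rintro p q hpq w ⟨r, h0, h1, h2⟩
    exact ⟨r, h0, h1.trans_le (radius_mono hpq), h2⟩
  refine (measure_mono hsub).trans ?_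
  rw [hmono.measure_iUnion]
  refine iSup_le fun n => ?_
  have hρ0 := radius_pos n
  have hρ1 := radius_lt_one n
  have hdc {r : ℝ} (h0 : 0 ≤ r) (h1 : r < 1) : Continuous (dilate m a (r : ℂ)) :=
    continuous_dilate H ha (by simpa [abs_of_nonneg h0] using h1)
  have hmeas : MeasurableSet (E (radius n)) := by
    refine IsOpen.measurableSet ?_
    have : E (radius n) = ⋃ r ∈ Set.Ico 0 (radius n), {w | c < ‖dilate m a (r : ℂ) w‖ₑ} := by
      ext w
      simp [hE, and_assoc]
    rw [this]
    exact isOpen_biUnion fun r hr => isOpen_lt continuous_const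
      (hdc hr.1 (hr.2.trans hρ1)).enorm
  rw [measure_eq_lintegral_flow m hmeas]
  have hdm := (hdc hρ0.le hρ1).enorm.measurable
  calc ∫⁻ w, volume {t | flow m t w ∈ E (radius n)} ∂haar
      ≤ ∫⁻ w, 5 * (∫⁻ t, ‖dilate m a (radius n) (flow m t w)‖ₑ) / c ∂haar :=
        lintegral_mono fun w => (poissonFamily_dilate H ha hs w).volume_lt_le hρ0 hρ1 hc0 hc
    _ = 5 / c * ∫⁻ w, (∫⁻ t, ‖dilate m a (radius n) (flow m t w)‖ₑ) ∂haar := by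
        rw [← lintegral_const_mul']
        · refine lintegral_congr fun w => ?_
          rw [div_eq_mul_inv, div_eq_mul_inv]; ring
        · exact ENNReal.div_ne_top (by simp) hc0
    _ = 5 / c * ∫⁻ w, ‖dilate m a (radius n) w‖ₑ ∂haar := by
        rw [← lintegral_eq_lintegral_flow m hdm]
    _ ≤ 5 / c * T := by
        gcongr
        exact hT _ hρ0.le hρ1
    _ = 5 * T / c := by rw [div_eq_mul_inv, div_eq_mul_inv]; ring

/-! ### Radial limits on the torus -/

/-- The oscillation of the extension beyond the `n`-th radius. -/
def oscillation (m : ℕ → ℕ) (a : (ℕ →₀ ℤ) → ℂ) (n : ℕ) (w : Torus) : ℝ≥0∞ :=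
  ⨆ p ∈ Set.Ioo (radius n) 1 ×ˢ Set.Ioo (radius n) 1,
    ‖dilate m a ((p.1 : ℝ) : ℂ) w - dilate m a ((p.2 : ℝ) : ℂ) w‖ₑ

theorem exists_tendsto_iff_oscillation (w : Torus) :
    (∃ l : ℂ, Tendsto (fun r : ℝ => dilate m a (r : ℂ) w) (𝓝[<] 1) (𝓝 l)) ↔
      ⨅ n, oscillation m a n w = 0 := by
  constructor
  · rintro ⟨l, hl⟩
    refine le_antisymm (ENNReal.le_of_forall_pos_le_add fun ε hε _ => ?_) zero_le
    rw [zero_add]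
    have h := hl.eventually (Metric.closedEBall_mem_nhds l (ε := (ε / 2 : ℝ≥0)) (by
      have : (0 : ℝ≥0) < ε / 2 := by positivity
      exact_mod_cast this))
    obtain ⟨b, hb, hb'⟩ := mem_nhdsLT_iff_exists_Ico_subset.1 h
    obtain ⟨n, hn⟩ := exists_lt_radius hb
    refine (iInf_le _ n).trans (iSup₂_le fun p hp => ?_)
    have h1 := hb' ⟨(hn.trans hp.1.1).le, hp.1.2⟩
    have h2 := hb' ⟨(hn.trans hp.2.1).le, hp.2.2⟩
    rw [← edist_eq_enorm_sub]
    refine (edist_triangle_right _ _ l).trans ((add_le_add h1 h2).trans (le_of_eq ?_))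
    rw [← ENNReal.coe_add, add_halves]
  · intro h
    have hc : Cauchy (map (fun r : ℝ => dilate m a (r : ℂ) w) (𝓝[<] 1)) := by
      refine EMetric.cauchy_iff.2 ⟨NeBot.ne inferInstance, fun ε hε => ?_⟩
      rw [← h] at hε
      obtain ⟨n, hn⟩ := iInf_lt_iff.1 hε
      refine ⟨_, image_mem_map (Ioo_mem_nhdsLT (radius_lt_one n)), ?_⟩
      rintro - ⟨r, hr, rfl⟩ - ⟨s, hs, rfl⟩
      refine lt_of_le_of_lt ?_ hn
      rw [edist_eq_enorm_sub]
      exact le_iSup₂_of_le (r, s) ⟨hr, hs⟩ le_rfl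
    exact cauchy_map_iff_exists_tendsto.1 hc

theorem measurable_oscillation (H : Weights m) (ha : ∀ ν, ‖a ν‖ ≤ A) (n : ℕ) :
    Measurable (oscillation m a n) := by
  refine LowerSemicontinuous.measurable ?_
  have hdc {r : ℝ} (h0 : radius n < r) (h1 : r < 1) : Continuous (dilate m a (r : ℂ)) :=
    continuous_dilate H ha (by simpa [abs_of_nonneg ((radius_pos n).trans h0).le] using h1)
  refine lowerSemicontinuous_biSup fun p hp => Continuous.lowerSemicontinuous ?_
  exact ((hdc hp.1.1 hp.1.2).sub (hdc hp.2.1 hp.2.2)).enorm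

theorem ae_exists_tendsto_dilate (H : Weights m) (ha : ∀ ν, ‖a ν‖ ≤ A)
    (hs : HasOneSignedSpectrum a) {T : ℝ≥0∞} (hTtop : T ≠ ∞)
    (hT : ∀ r : ℝ, 0 ≤ r → r < 1 → ∫⁻ w, ‖dilate m a r w‖ₑ ∂haar ≤ T) :
    ∀ᵐ w ∂haar, ∃ l : ℂ, Tendsto (fun r : ℝ => dilate m a (r : ℂ) w) (𝓝[<] 1) (𝓝 l) := by
  have hdc {r : ℝ} (h0 : 0 ≤ r) (h1 : r < 1) : Continuous (dilate m a (r : ℂ)) :=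
    continuous_dilate H ha (by simpa [abs_of_nonneg h0] using h1)
  have hflow : Measurable fun p : Torus × UnitAddCircle => flow m p.2 p.1 :=
    ((continuous_flow m).comp continuous_swap).measurable
  set S : Set Torus := {w | ⨅ n, oscillation m a n w ≠ 0} with hS
  have hSm : MeasurableSet S :=
    (Measurable.iInf fun n => measurable_oscillation H ha n) (measurableSet_singleton 0).compl
  set J : Torus → ℝ≥0∞ := fun w => ⨆ n, ∫⁻ t, ‖dilate m a (radius n) (flow m t w)‖ₑ with hJ
  have hJm (n : ℕ) : Measurable fun w => ∫⁻ t, ‖dilate m a (radius n) (flow m t w)‖ₑ :=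
    (((hdc (radius_pos n).le (radius_lt_one n)).enorm.measurable).comp hflow).lintegral_prod_right'
  have hJint : ∫⁻ w, J w ∂haar ≤ T := by
    rw [hJ, lintegral_iSup hJm]
    · refine iSup_le fun n => ?_
      rw [← lintegral_eq_lintegral_flow m
        (φ := fun w => ‖dilate m a (radius n) w‖ₑ)
        (hdc (radius_pos n).le (radius_lt_one n)).enorm.measurable]
      exact hT _ (radius_pos n).le (radius_lt_one n)
    · intro p q hpq w
      exact (poissonFamily_dilate H ha hs w).lintegral_enorm_mono (radius_pos p).le
        (radius_mono hpq) (radius_lt_one q)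
  have hJfin : ∀ᵐ w ∂haar, J w < ∞ :=
    ae_lt_top (Measurable.iSup hJm) (hJint.trans_lt hTtop.lt_top).ne
  have hnull : haar S = 0 := by
    rw [measure_eq_lintegral_flow m hSm]
    refine (lintegral_congr_ae ?_).trans lintegral_zero
    filter_upwards [hJfin] with w hw
    have hP := poissonFamily_dilate H ha hs w
    have h := hP.ae_exists_tendsto (C := (J w).toReal) fun ρ h0 h1 => by
      rw [integral_norm_eq_lintegral_enorm (hP.continuous ρ h0 h1).aestronglyMeasurable]
      refine ENNReal.toReal_mono hw.ne ?_
      obtain ⟨n, hn⟩ := exists_lt_radius h1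
      exact (hP.lintegral_enorm_mono h0 hn.le (radius_lt_one n)).trans
        (le_iSup (fun n => ∫⁻ t, ‖dilate m a (radius n) (flow m t w)‖ₑ) n)
    rw [ae_iff] at h
    refine le_antisymm ((measure_mono fun t ht => ?_).trans h.le) zero_le
    exact fun hx => ht ((exists_tendsto_iff_oscillation _).1 hx)
  rw [ae_iff]
  refine le_antisymm ((measure_mono fun w hw => ?_).trans hnull.le) zero_le
  exact fun hx => hw ((exists_tendsto_iff_oscillation _).2 hx)

end

section

/-! ### The strong `L²` maximal inequality on the circle -/

theorem poissonLIntegral_withDensity {h : UnitAddCircle → ℝ≥0∞} (hh : Measurable h) {r : ℝ}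
    (hr0 : 0 ≤ r) (hr1 : r < 1) (t : UnitAddCircle) :
    poissonLIntegral (volume.withDensity h) r t =
      ∫⁻ s, h s * ENNReal.ofReal (poissonProfile r ‖s - t‖) :=
  lintegral_withDensity_eq_lintegral_mul _ hh
    (continuous_poissonProfile_norm_sub hr0 hr1 t).measurable.ennreal_ofReal

/-- The radial maximal function of the Poisson integral of a density. -/
def poissonMaximal (h : UnitAddCircle → ℝ≥0∞) (t : UnitAddCircle) : ℝ≥0∞ :=
  ⨆ r ∈ Set.Ico (0 : ℝ) 1, poissonLIntegral (volume.withDensity h) r t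

theorem poissonMaximal_le {h : UnitAddCircle → ℝ≥0∞} (hh : Measurable h) {c : ℝ≥0∞}
    (hc : ∀ t, h t ≤ c) (t : UnitAddCircle) : poissonMaximal h t ≤ c := by
  refine iSup₂_le fun r hr => ?_
  rw [poissonLIntegral_withDensity hh hr.1 hr.2]
  calc _ ≤ ∫⁻ s, c * ENNReal.ofReal (poissonProfile r ‖s - t‖) := by
        gcongr with s
        exact hc s
    _ = c := by
        rw [lintegral_const_mul _
          (continuous_poissonProfile_norm_sub hr.1 hr.2 t).measurable.ennreal_ofReal]
        change c * poissonLIntegral volume r t = c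
        rw [poissonLIntegral_volume hr.1 hr.2, mul_one]

theorem measurable_poissonMaximal {h : UnitAddCircle → ℝ} (hh : Continuous h) (h0 : ∀ t, 0 ≤ h t) :
    Measurable (poissonMaximal fun t => ENNReal.ofReal (h t)) := by
  refine LowerSemicontinuous.measurable ?_
  refine lowerSemicontinuous_biSup fun r hr => Continuous.lowerSemicontinuous ?_
  have e (t : UnitAddCircle) : poissonLIntegral (volume.withDensity fun t => ENNReal.ofReal (h t)) r t =
      ENNReal.ofReal (∫ s, h (s + t) * poissonProfile r ‖s‖) := by
    have hc : Continuous fun s => h (s + t) * poissonProfile r ‖s‖ :=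
      (hh.comp (by fun_prop)).mul ((continuous_poissonProfile hr.1 hr.2).comp (by fun_prop))
    rw [poissonLIntegral_withDensity hh.measurable.ennreal_ofReal hr.1 hr.2,
      ofReal_integral_eq_lintegral_ofReal (hc.integrable_of_hasCompactSupport
        (HasCompactSupport.of_compactSpace _)) (Eventually.of_forall fun s =>
          mul_nonneg (h0 _) (poissonProfile_nonneg hr.1 hr.2 _)),
      ← lintegral_add_right_eq_self _ t]
    refine lintegral_congr fun s => ?_
    rw [add_sub_cancel_right, ENNReal.ofReal_mul (h0 _)]
  refine Continuous.congr (ENNReal.continuous_ofReal.comp ?_) fun t => (e t).symm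
  have hc : Continuous fun p : UnitAddCircle × UnitAddCircle =>
      h (p.2 + p.1) * poissonProfile r ‖p.2‖ :=
    (hh.comp (by fun_prop)).mul ((continuous_poissonProfile hr.1 hr.2).comp (by fun_prop))
  have := continuous_parametric_integral_of_continuous (μ := (volume : Measure UnitAddCircle))
    (f := fun t s => h (s + t) * poissonProfile r ‖s‖) hc isCompact_univ
  simpa using this

theorem volume_lt_poissonMaximal_le {h : UnitAddCircle → ℝ} (hh : Continuous h)
    {l : ℝ} (hl : 0 < l) :
    volume {t | ENNReal.ofReal l < poissonMaximal (fun t => ENNReal.ofReal (h t)) t} ≤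
      5 * (∫⁻ t in {t | l / 2 < h t}, ENNReal.ofReal (h t)) / ENNReal.ofReal (l / 2) := by
  set g : UnitAddCircle → ℝ≥0∞ := {t | l / 2 < h t}.indicator fun t => ENNReal.ofReal (h t) with hg
  have hS : MeasurableSet {t | l / 2 < h t} := (isOpen_lt continuous_const hh).measurableSet
  have hgm : Measurable g := hh.measurable.ennreal_ofReal.indicator hS
  have hgi : ∫⁻ t, g t = ∫⁻ t in {t | l / 2 < h t}, ENNReal.ofReal (h t) := lintegral_indicator hS _
  have hl2 : 0 < l / 2 := by positivity
  have hfin : IsFiniteMeasure (volume.withDensity g) := by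
    refine isFiniteMeasure_withDensity (ne_of_lt ?_)
    calc ∫⁻ t, g t ≤ ∫⁻ t, ‖h t‖ₑ := by
          refine lintegral_mono fun t => (Set.indicator_le_self _ _ t).trans ?_
          exact Real.ofReal_le_enorm _
      _ < ∞ := (hh.integrable_of_hasCompactSupport
          (HasCompactSupport.of_compactSpace _)).hasFiniteIntegral
  have hw := volume_maximal_le (volume.withDensity g) (c := ENNReal.ofReal (l / 2))
    (by simpa using hl) ENNReal.ofReal_ne_top
  rw [withDensity_apply _ MeasurableSet.univ, Measure.restrict_univ, hgi] at hw
  refine (measure_mono fun t ht => ?_).trans hw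
  rw [Set.mem_ofPred_eq, poissonMaximal, lt_iSup_iff] at ht
  obtain ⟨r, hr⟩ := ht
  obtain ⟨hr01, hr⟩ := lt_iSup_iff.1 hr
  refine ⟨r, hr01.1, hr01.2, ?_⟩
  have hkm := (continuous_poissonProfile_norm_sub hr01.1 hr01.2 t).measurable.ennreal_ofReal
  rw [poissonLIntegral_withDensity hh.measurable.ennreal_ofReal hr01.1 hr01.2] at hr
  rw [poissonLIntegral_withDensity hgm hr01.1 hr01.2]
  have hle : ∫⁻ s, ENNReal.ofReal (h s) * ENNReal.ofReal (poissonProfile r ‖s - t‖) ≤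
      (∫⁻ s, g s * ENNReal.ofReal (poissonProfile r ‖s - t‖)) + ENNReal.ofReal (l / 2) := by
    calc _ ≤ ∫⁻ s, (g s * ENNReal.ofReal (poissonProfile r ‖s - t‖) +
          ENNReal.ofReal (l / 2) * ENNReal.ofReal (poissonProfile r ‖s - t‖)) := by
          refine lintegral_mono fun s => ?_
          rw [← add_mul]
          gcongr
          by_cases hs : l / 2 < h s
          · rw [hg, Set.indicator_of_mem (by exact hs)]
            exact le_self_add
          · exact (ENNReal.ofReal_le_ofReal (not_lt.1 hs)).trans le_add_self
      _ = _ := by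
          refine (lintegral_add_left (hgm.mul hkm) _).trans ?_
          rw [lintegral_const_mul _ hkm]
          congr 1
          change _ * poissonLIntegral volume r t = _
          rw [poissonLIntegral_volume hr01.1 hr01.2, mul_one]
  have h2 : ENNReal.ofReal l = ENNReal.ofReal (l / 2) + ENNReal.ofReal (l / 2) := by
    rw [← ENNReal.ofReal_add hl2.le hl2.le, add_halves]
  rw [h2] at hr
  exact (ENNReal.add_lt_add_iff_right ENNReal.ofReal_ne_top).1 (hr.trans_le hle)

theorem lintegral_poissonMaximal_sq_le {h : UnitAddCircle → ℝ} (hh : Continuous h)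
    (h0 : ∀ t, 0 ≤ h t) :
    ∫⁻ t, poissonMaximal (fun t => ENNReal.ofReal (h t)) t ^ 2 ≤
      40 * ∫⁻ t, ENNReal.ofReal (h t) ^ 2 := by
  obtain ⟨c, hc⟩ : ∃ c, ∀ t, h t ≤ c := by
    obtain ⟨c, hc⟩ := isCompact_univ.exists_bound_of_continuousOn hh.continuousOn
    exact ⟨c, fun t => (le_abs_self _).trans (hc t trivial)⟩
  set N := poissonMaximal fun t => ENNReal.ofReal (h t) with hN
  have hNm : Measurable N := measurable_poissonMaximal hh h0
  have hNtop (t : UnitAddCircle) : N t ≠ ∞ :=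
    ((poissonMaximal_le hh.measurable.ennreal_ofReal
      (fun t => ENNReal.ofReal_le_ofReal (hc t)) t).trans_lt ENNReal.ofReal_lt_top).ne
  have e1 : ∫⁻ t, N t ^ 2 = ∫⁻ t, ENNReal.ofReal ((N t).toReal ^ (2 : ℝ)) := by
    refine lintegral_congr fun t => ?_
    rw [Real.rpow_ofNat, ENNReal.ofReal_pow ENNReal.toReal_nonneg, ENNReal.ofReal_toReal (hNtop t)]
  rw [e1, lintegral_rpow_eq_lintegral_meas_lt_mul volume
    (Eventually.of_forall fun t => ENNReal.toReal_nonneg) hNm.ennreal_toReal.aemeasurable two_pos]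
  have hmeas : Measurable fun p : ℝ × UnitAddCircle =>
      {p : ℝ × UnitAddCircle | p.1 / 2 < h p.2}.indicator (fun p => ENNReal.ofReal (h p.2)) p :=
    (hh.measurable.comp measurable_snd).ennreal_ofReal.indicator
      (isOpen_lt (by fun_prop) (by fun_prop)).measurableSet
  have e2 : ∀ l ∈ Set.Ioi (0 : ℝ), volume {t | l < (N t).toReal} * ENNReal.ofReal (l ^ ((2 : ℝ) - 1)) ≤
      10 * ∫⁻ t, {p : ℝ × UnitAddCircle | p.1 / 2 < h p.2}.indicator
        (fun p => ENNReal.ofReal (h p.2)) (l, t) := by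
    intro l hl
    have hl : 0 < l := hl
    have hset : {t | l < (N t).toReal} = {t | ENNReal.ofReal l < N t} := by
      ext t
      exact (ENNReal.ofReal_lt_iff_lt_toReal hl.le (hNtop t)).symm
    have hind : ∫⁻ t, {p : ℝ × UnitAddCircle | p.1 / 2 < h p.2}.indicator
        (fun p => ENNReal.ofReal (h p.2)) (l, t) =
        ∫⁻ t in {t | l / 2 < h t}, ENNReal.ofReal (h t) :=
      lintegral_indicator (μ := volume) (s := {t | l / 2 < h t})
        (isOpen_lt continuous_const hh).measurableSet fun t => ENNReal.ofReal (h t)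
    rw [hset, hind]
    have hpow : l ^ ((2 : ℝ) - 1) = 2 * (l / 2) := by
      norm_num
      ring
    rw [hpow, ENNReal.ofReal_mul zero_le_two]
    have hl2 : ENNReal.ofReal (l / 2) ≠ 0 := by simpa using hl
    set I := ∫⁻ t in {t | l / 2 < h t}, ENNReal.ofReal (h t)
    calc _ ≤ 5 * I / ENNReal.ofReal (l / 2) * (ENNReal.ofReal 2 * ENNReal.ofReal (l / 2)) := by
          gcongr
          exact volume_lt_poissonMaximal_le hh hl
      _ = (5 * I / ENNReal.ofReal (l / 2) * ENNReal.ofReal (l / 2)) * ENNReal.ofReal 2 := by ring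
      _ = 5 * I * ENNReal.ofReal 2 := by rw [ENNReal.div_mul_cancel hl2 ENNReal.ofReal_ne_top]
      _ = 10 * I := by
          have : (10 : ℝ≥0∞) = 5 * 2 := by norm_num
          rw [this, ENNReal.ofReal_ofNat]; ring
  calc _ ≤ ENNReal.ofReal 2 * ∫⁻ l in Set.Ioi (0 : ℝ), 10 *
        ∫⁻ t, {p : ℝ × UnitAddCircle | p.1 / 2 < h p.2}.indicator
          (fun p => ENNReal.ofReal (h p.2)) (l, t) := by
        exact mul_le_mul' le_rfl (setLIntegral_mono' measurableSet_Ioi e2)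
    _ = 20 * ∫⁻ t, ∫⁻ l in Set.Ioi (0 : ℝ), {p : ℝ × UnitAddCircle | p.1 / 2 < h p.2}.indicator
          (fun p => ENNReal.ofReal (h p.2)) (l, t) := by
        rw [lintegral_const_mul _ hmeas.lintegral_prod_right', lintegral_lintegral_swap
          hmeas.aemeasurable, ← mul_assoc, ENNReal.ofReal_ofNat]
        norm_num
    _ = 20 * ∫⁻ t, 2 * ENNReal.ofReal (h t) ^ 2 := by
        congr 1
        refine lintegral_congr fun t => ?_
        have : ∀ l : ℝ, {p : ℝ × UnitAddCircle | p.1 / 2 < h p.2}.indicator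
            (fun p => ENNReal.ofReal (h p.2)) (l, t) =
            (Set.Iio (2 * h t)).indicator (fun _ => ENNReal.ofReal (h t)) l := by
          intro l
          refine Set.indicator_eq_indicator ?_ rfl
          simp only [Set.mem_ofPred_eq, Set.mem_Iio]
          constructor <;> intro h <;> linarith
        simp only [this]
        rw [lintegral_indicator measurableSet_Iio, setLIntegral_const,
          Measure.restrict_apply measurableSet_Iio, Set.inter_comm, Set.Ioi_inter_Iio,
          Real.volume_Ioo, sub_zero, ENNReal.ofReal_mul zero_le_two, ENNReal.ofReal_ofNat]
        ring
    _ = 40 * ∫⁻ t, ENNReal.ofReal (h t) ^ 2 := by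
        rw [lintegral_const_mul _ (hh.measurable.ennreal_ofReal.pow_const 2), ← mul_assoc]
        norm_num

/-! ### Square roots of analytic functions are subharmonic -/

theorem exists_analytic_decomposition {p : C(UnitAddCircle, ℂ)}
    (hp : p ∈ Submodule.span ℂ (Set.range (fourier (T := 1)))) :
    ∃ q₁ q₂ : ℂ → ℂ, Differentiable ℂ q₁ ∧ Differentiable ℂ q₂ ∧
      (∀ t : UnitAddCircle, p t = q₁ (AddCircle.toCircle t) + conj (q₂ (AddCircle.toCircle t))) ∧
      ∀ r : ℝ, 0 ≤ r → r < 1 → ∀ t : UnitAddCircle,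
        ∫ s, (poissonProfile r ‖s - t‖ : ℂ) * p s =
          q₁ (r * AddCircle.toCircle t) + conj (q₂ (r * AddCircle.toCircle t)) := by
  have hint {g : UnitAddCircle → ℂ} (hg : Continuous g) : Integrable g :=
    hg.integrable_of_hasCompactSupport (HasCompactSupport.of_compactSpace _)
  induction hp using Submodule.span_induction with
  | mem x hx =>
    obtain ⟨n, rfl⟩ := hx
    rcases le_total 0 n with hn | hn
    · have hf (t : UnitAddCircle) : fourier n t = (AddCircle.toCircle t : ℂ) ^ n.natAbs := by
        rw [fourier_apply, AddCircle.toCircle_zsmul, Circle.coe_zpow, ← zpow_natCast,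
          Int.natAbs_of_nonneg hn]
      refine ⟨fun z => z ^ n.natAbs, 0, by fun_prop, differentiable_const 0, fun t => ?_,
        fun r hr0 hr1 t => ?_⟩
      · simp only [Pi.zero_apply, map_zero, add_zero]; exact hf t
      · rw [integral_poissonProfile_mul_fourier hr0 hr1, hf]
        simp [mul_pow]
    · have hf (t : UnitAddCircle) : fourier n t = conj ((AddCircle.toCircle t : ℂ) ^ n.natAbs) := by
        rw [fourier_apply, AddCircle.toCircle_zsmul, map_pow, ← Circle.coe_inv_eq_conj,
          ← Circle.coe_pow, inv_pow, ← zpow_natCast, ← zpow_neg]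
        congr 2
        omega
      refine ⟨0, fun z => z ^ n.natAbs, differentiable_const 0, by fun_prop, fun t => ?_,
        fun r hr0 hr1 t => ?_⟩
      · simp only [Pi.zero_apply, zero_add]; exact hf t
      · rw [integral_poissonProfile_mul_fourier hr0 hr1, hf]
        simp [mul_pow]
  | zero => exact ⟨0, 0, differentiable_const 0, differentiable_const 0, by simp, by simp⟩
  | add x y _ _ hx hy =>
    obtain ⟨q₁, q₂, h₁, h₂, hb, hi⟩ := hx
    obtain ⟨q₁', q₂', h₁', h₂', hb', hi'⟩ := hy
    refine ⟨q₁ + q₁', q₂ + q₂', h₁.add h₁', h₂.add h₂', fun t => ?_, fun r hr0 hr1 t => ?_⟩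
    · rw [ContinuousMap.add_apply, hb, hb', Pi.add_apply, Pi.add_apply, map_add]; ring
    · have hk := continuous_poissonProfile_norm_sub hr0 hr1 t
      simp only [ContinuousMap.add_apply, mul_add]
      rw [integral_add (hint (by fun_prop)) (hint (by fun_prop)), hi r hr0 hr1, hi' r hr0 hr1,
        Pi.add_apply, Pi.add_apply, map_add]
      ring
  | smul c x _ hx =>
    obtain ⟨q₁, q₂, h₁, h₂, hb, hi⟩ := hx
    refine ⟨fun z => c * q₁ z, fun z => conj c * q₂ z, h₁.const_mul c, h₂.const_mul _, fun t => ?_,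
      fun r hr0 hr1 t => ?_⟩
    · rw [ContinuousMap.smul_apply, hb, smul_eq_mul, map_mul, Complex.conj_conj]; ring
    · have : (fun s => (poissonProfile r ‖s - t‖ : ℂ) * (c • x) s) =
          fun s => c * ((poissonProfile r ‖s - t‖ : ℂ) * x s) := by
        funext s; rw [ContinuousMap.smul_apply, smul_eq_mul]; ring
      rw [this, integral_const_mul, hi r hr0 hr1, map_mul, Complex.conj_conj]; ring

theorem exists_trig_approx (g : C(UnitAddCircle, ℂ)) {ε : ℝ} (hε : 0 < ε) :
    ∃ p ∈ Submodule.span ℂ (Set.range (fourier (T := 1))), ‖g - p‖ < ε := by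
  have : g ∈ closure (Submodule.span ℂ (Set.range (fourier (T := 1))) : Set C(UnitAddCircle, ℂ)) := by
    have h : g ∈ (Submodule.span ℂ (Set.range (fourier (T := 1)))).topologicalClosure := by
      rw [span_fourier_closure_eq_top]; trivial
    exact h
  obtain ⟨p, hp, hd⟩ := Metric.mem_closure_iff.1 this ε hε
  exact ⟨p, hp, by rwa [dist_eq_norm] at hd⟩

theorem exists_eq_toCircle {z : ℂ} (hz : ‖z‖ = 1) :
    ∃ t : UnitAddCircle, z = AddCircle.toCircle t := by
  obtain ⟨t, ht⟩ := exists_polar z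
  exact ⟨t, by rw [ht, hz]; simp⟩

theorem integral_ofReal_mul_re {k : UnitAddCircle → ℝ} (hk : Continuous k)
    (p : C(UnitAddCircle, ℂ)) : ∫ s, k s * (p s).re = (∫ s, (k s : ℂ) * p s).re := by
  have hi : Integrable fun s => (k s : ℂ) * p s :=
    ((Complex.continuous_ofReal.comp hk).mul p.continuous).integrable_of_hasCompactSupport
      (HasCompactSupport.of_compactSpace _)
  refine Eq.trans ?_ (Complex.reCLM.integral_comp_comm hi)
  refine integral_congr_ae (Eventually.of_forall fun s => ?_)
  simp

theorem norm_le_exp_re {F q : ℂ → ℂ} (hF : DiffContOnCl ℂ F (Metric.ball 0 1))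
    (hq : Differentiable ℂ q)
    (h : ∀ t : UnitAddCircle, ‖F (AddCircle.toCircle t)‖ ≤ Real.exp (q (AddCircle.toCircle t)).re)
    {z : ℂ} (hz : ‖z‖ < 1) : ‖F z‖ ≤ Real.exp (q z).re := by
  have hG : DiffContOnCl ℂ (fun z => F z * Complex.exp (-q z)) (Metric.ball 0 1) :=
    hF.smul hq.neg.cexp.diffContOnCl
  have hnorm (z : ℂ) : ‖F z * Complex.exp (-q z)‖ = ‖F z‖ * Real.exp (-(q z).re) := by
    rw [norm_mul, Complex.norm_exp, Complex.neg_re]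
  have hmax := Complex.norm_le_of_forall_mem_frontier_norm_le (C := 1) Metric.isBounded_ball hG
    (fun y hy => ?_) (subset_closure (mem_ball_zero_iff.2 hz))
  · rwa [hnorm, Real.exp_neg, ← div_eq_mul_inv, div_le_one (Real.exp_pos _)] at hmax
  · rw [frontier_ball _ one_ne_zero, mem_sphere_zero_iff_norm] at hy
    obtain ⟨s, rfl⟩ := exists_eq_toCircle hy
    rw [hnorm, Real.exp_neg, ← div_eq_mul_inv, div_le_one (Real.exp_pos _)]
    exact h s

theorem integral_poissonProfile_mul_le {g g' : UnitAddCircle → ℝ} (hg : Continuous g)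
    (hg' : Continuous g') {ε : ℝ} (h : ∀ s, g s ≤ g' s + ε) {r : ℝ} (hr0 : 0 ≤ r)
    (hr1 : r < 1) (t : UnitAddCircle) :
    ∫ s, poissonProfile r ‖s - t‖ * g s ≤ (∫ s, poissonProfile r ‖s - t‖ * g' s) + ε := by
  have hint {g : UnitAddCircle → ℝ} (hg : Continuous g) : Integrable g :=
    hg.integrable_of_hasCompactSupport (HasCompactSupport.of_compactSpace _)
  have hk := continuous_poissonProfile_norm_sub hr0 hr1 t
  calc _ ≤ ∫ s, (poissonProfile r ‖s - t‖ * g' s + poissonProfile r ‖s - t‖ * ε) := by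
        refine integral_mono (hint (hk.mul hg))
          (hint ((hk.mul hg').add (hk.mul continuous_const))) fun s => ?_
        simp only
        rw [← mul_add]
        exact mul_le_mul_of_nonneg_left (h s) (poissonProfile_nonneg hr0 hr1 _)
    _ = _ := by
        refine (integral_add (hint (hk.mul hg')) (hint (hk.mul continuous_const))).trans ?_
        simp only [Pi.mul_apply]
        rw [integral_mul_const, integral_poissonProfile hr0 hr1, one_mul]

theorem norm_le_exp_poisson {F : ℂ → ℂ} (hF : DiffContOnCl ℂ F (Metric.ball 0 1))
    {g : UnitAddCircle → ℝ} (hg : Continuous g)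
    (hFg : ∀ t : UnitAddCircle, ‖F (AddCircle.toCircle t)‖ ≤ Real.exp (g t)) {r : ℝ} (hr0 : 0 ≤ r)
    (hr1 : r < 1) (t : UnitAddCircle) :
    ‖F (r * AddCircle.toCircle t)‖ ≤ Real.exp (∫ s, poissonProfile r ‖s - t‖ * g s) := by
  have hk := continuous_poissonProfile_norm_sub hr0 hr1 t
  have key (ε : ℝ) (hε : 0 < ε) : ‖F (r * AddCircle.toCircle t)‖ ≤
      Real.exp ((∫ s, poissonProfile r ‖s - t‖ * g s) + ε + ε) := by
    obtain ⟨p, hp, hgp⟩ := exists_trig_approx ⟨fun t => (g t : ℂ), Complex.continuous_ofReal.comp hg⟩ hε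
    obtain ⟨q₁, q₂, hq₁, hq₂, hb, hi⟩ := exists_analytic_decomposition hp
    have hre (s : UnitAddCircle) : |g s - (p s).re| ≤ ε := by
      have h1 := (ContinuousMap.norm_coe_le_norm _ s).trans hgp.le
      refine le_trans ?_ ((Complex.abs_re_le_norm _).trans h1)
      exact le_of_eq rfl
    have hbre (s : UnitAddCircle) : (p s).re =
        (q₁ (AddCircle.toCircle s) + q₂ (AddCircle.toCircle s)).re := by
      rw [hb, Complex.add_re, Complex.add_re, Complex.conj_re]
    have hire : ∫ s, poissonProfile r ‖s - t‖ * (p s).re =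
        (q₁ (r * AddCircle.toCircle t) + q₂ (r * AddCircle.toCircle t)).re := by
      rw [integral_ofReal_mul_re hk p, hi r hr0 hr1 t, Complex.add_re, Complex.add_re,
        Complex.conj_re]
    have hz : ‖(r : ℂ) * AddCircle.toCircle t‖ < 1 := by
      rwa [norm_mul, Circle.norm_coe, mul_one, Complex.norm_real, Real.norm_of_nonneg hr0]
    have hmax := norm_le_exp_re (q := fun z => q₁ z + q₂ z + (ε : ℂ)) hF
      ((hq₁.add hq₂).add_const _) (fun s => (hFg s).trans (Real.exp_le_exp.2 (by
        rw [Complex.add_re, ← hbre, Complex.ofReal_re]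
        linarith [(abs_le.1 (hre s)).2]))) hz
    rw [Complex.add_re, ← hire, Complex.ofReal_re] at hmax
    refine hmax.trans (Real.exp_le_exp.2 (add_le_add_left ?_ _))
    exact integral_poissonProfile_mul_le (Complex.continuous_re.comp p.continuous) hg
      (fun s => sub_le_iff_le_add'.1 (by
        have := (abs_le.1 (hre s)).1
        simp only [Function.comp_apply]
        linarith)) hr0 hr1 t
  have hlim : Tendsto (fun ε : ℝ => Real.exp ((∫ s, poissonProfile r ‖s - t‖ * g s) + ε + ε))
      (𝓝[>] 0) (𝓝 (Real.exp (∫ s, poissonProfile r ‖s - t‖ * g s))) := by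
    have : Continuous fun ε : ℝ => Real.exp ((∫ s, poissonProfile r ‖s - t‖ * g s) + ε + ε) := by
      fun_prop
    simpa using (this.tendsto 0).mono_left (nhdsWithin_le_nhds (s := Set.Ioi 0))
  refine ge_of_tendsto hlim ?_
  filter_upwards [self_mem_nhdsWithin] with ε hε using key ε hε

theorem exp_poisson_le {g : UnitAddCircle → ℝ} (hg : Continuous g) {r : ℝ} (hr0 : 0 ≤ r)
    (hr1 : r < 1) (t : UnitAddCircle) :
    Real.exp (∫ s, poissonProfile r ‖s - t‖ * g s) ≤
      ∫ s, poissonProfile r ‖s - t‖ * Real.exp (g s) := by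
  have hint {g : UnitAddCircle → ℝ} (hg : Continuous g) : Integrable g :=
    hg.integrable_of_hasCompactSupport (HasCompactSupport.of_compactSpace _)
  have hk := continuous_poissonProfile_norm_sub hr0 hr1 t
  set c := ∫ s, poissonProfile r ‖s - t‖ * g s with hc
  calc Real.exp c = ∫ s, (Real.exp c * (1 - c) * poissonProfile r ‖s - t‖ +
        Real.exp c * (poissonProfile r ‖s - t‖ * g s)) := by
        rw [integral_add (hint (by fun_prop)) (hint (by fun_prop)), integral_const_mul,
          integral_const_mul, integral_poissonProfile hr0 hr1, ← hc]
        ring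
    _ ≤ _ := by
        refine integral_mono (hint (by fun_prop)) (hint (by fun_prop)) fun s => ?_
        have h1 := Real.add_one_le_exp (g s - c)
        have h2 : Real.exp (g s) = Real.exp c * Real.exp (g s - c) := by
          rw [← Real.exp_add]; ring_nf
        simp only
        rw [h2]
        have h3 := poissonProfile_nonneg hr0 hr1 ‖s - t‖
        have h4 := (Real.exp_pos c).le
        have := mul_le_mul_of_nonneg_left h1 (mul_nonneg h3 h4)
        nlinarith

theorem sqrt_norm_le_poisson {F : ℂ → ℂ} (hF : DiffContOnCl ℂ F (Metric.ball 0 1)) {r : ℝ}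
    (hr0 : 0 ≤ r) (hr1 : r < 1) (t : UnitAddCircle) :
    √‖F (r * AddCircle.toCircle t)‖ ≤
      ∫ s : UnitAddCircle, poissonProfile r ‖s - t‖ * √‖F (AddCircle.toCircle s)‖ := by
  have hFc : Continuous fun s : UnitAddCircle => F (AddCircle.toCircle s) := by
    refine hF.continuousOn.comp_continuous
      (continuous_subtype_val.comp AddCircle.continuous_toCircle) fun s => ?_
    rw [closure_ball _ one_ne_zero, mem_closedBall_zero_iff, Circle.norm_coe]
  have key (δ : ℝ) (hδ : 0 < δ) : √‖F (r * AddCircle.toCircle t)‖ ≤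
      (∫ s : UnitAddCircle, poissonProfile r ‖s - t‖ * √‖F (AddCircle.toCircle s)‖) + √δ := by
    set g : UnitAddCircle → ℝ := fun s => Real.log (max ‖F (AddCircle.toCircle s)‖ δ) with hgdef
    have hpos (s : UnitAddCircle) : 0 < max ‖F (AddCircle.toCircle s)‖ δ := lt_max_of_lt_right hδ
    have hgc : Continuous g := Continuous.log (hFc.norm.max continuous_const) fun s => (hpos s).ne'
    have h1 := norm_le_exp_poisson hF hgc (fun s => by
      rw [hgdef, Real.exp_log (hpos s)]; exact le_max_left _ _) hr0 hr1 t
    have h2 := Real.sqrt_le_sqrt h1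
    rw [← Real.exp_half, ← integral_div] at h2
    have h3 := exp_poisson_le (g := fun s => g s / 2) (by fun_prop) hr0 hr1 t
    simp only [mul_div_assoc] at h2
    refine (h2.trans h3).trans ?_
    have h4 (s : UnitAddCircle) : Real.exp (g s / 2) ≤ √‖F (AddCircle.toCircle s)‖ + √δ := by
      rw [Real.exp_half, hgdef, Real.exp_log (hpos s)]
      rcases max_choice ‖F (AddCircle.toCircle s)‖ δ with h | h <;> rw [h]
      · exact le_add_of_nonneg_right (Real.sqrt_nonneg _)
      · exact le_add_of_nonneg_left (Real.sqrt_nonneg _)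
    exact integral_poissonProfile_mul_le (by fun_prop) hFc.norm.sqrt h4 hr0 hr1 t
  have hlim : Tendsto (fun δ : ℝ => (∫ s : UnitAddCircle,
      poissonProfile r ‖s - t‖ * √‖F (AddCircle.toCircle s)‖) + √δ) (𝓝[>] 0)
      (𝓝 (∫ s : UnitAddCircle, poissonProfile r ‖s - t‖ * √‖F (AddCircle.toCircle s)‖)) := by
    have : Continuous fun δ : ℝ => (∫ s : UnitAddCircle,
      poissonProfile r ‖s - t‖ * √‖F (AddCircle.toCircle s)‖) + √δ := 
      continuous_const.add Real.continuous_sqrt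
    simpa using (this.tendsto 0).mono_left (nhdsWithin_le_nhds (s := Set.Ioi 0))
  refine ge_of_tendsto hlim ?_
  filter_upwards [self_mem_nhdsWithin] with δ hδ using key δ hδ

end

section

variable {m : ℕ → ℕ} {a : (ℕ →₀ ℤ) → ℂ} {A : ℝ}

/-! ### The maximal inequality for analytic spectrum -/

theorem monomial_approach_of_nonneg (m : ℕ → ℕ) {ν : ℕ →₀ ℤ} (hν : 0 ≤ ν) (ξ : ℂ) (w : Torus) :
    monomial ν (approach m ξ w) = ξ ^ wt m ν * character ν w := by
  rw [monomial_approach]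
  congr 1
  unfold monomial approach wt
  rw [Finsupp.prod, Finsupp.sum, ← Finset.prod_pow_eq_pow_sum]
  refine Finset.prod_congr rfl fun j _ => ?_
  rw [if_pos (show 0 ≤ ν j from hν j)]
  simp [pow_mul]

theorem differentiableAt_dilate (H : Weights m) (ha : ∀ ν, ‖a ν‖ ≤ A) (hs : HasAnalyticSpectrum a)
    (w : Torus) {ξ : ℂ} (hξ : ‖ξ‖ < 1) : DifferentiableAt ℂ (fun z => dilate m a z w) ξ := by
  obtain ⟨R, hξR, hR1⟩ := exists_between hξ
  have hR0 : 0 ≤ R := (norm_nonneg ξ).trans hξR.le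
  have e : (fun z => dilate m a z w) = fun z => ∑' ν, a ν * character ν w * z ^ wt m ν := by
    funext z
    refine tsum_congr fun ν => ?_
    by_cases h : a ν = 0
    · simp [h]
    · rw [monomial_approach_of_nonneg m (hs ν h)]; ring
  have hd : DifferentiableOn ℂ (fun z => dilate m a z w) (Metric.ball 0 R) := by
    rw [e]
    refine Complex.differentiableOn_tsum_of_summable_norm ((H.summable_wt hR0 hR1).mul_left A)
      (fun ν => by fun_prop) Metric.isOpen_ball fun ν z hz => ?_
    rw [norm_mul, norm_mul, norm_character, mul_one, norm_pow]
    have hz : ‖z‖ ≤ R := (mem_ball_zero_iff.1 hz).le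
    have hA : 0 ≤ A := (norm_nonneg _).trans (ha 0)
    gcongr
    exact ha ν
  exact hd.differentiableAt (Metric.isOpen_ball.mem_nhds (mem_ball_zero_iff.2 hξR))

theorem diffContOnCl_dilate_mul (H : Weights m) (ha : ∀ ν, ‖a ν‖ ≤ A)
    (hs : HasAnalyticSpectrum a) (w : Torus) {ρ : ℝ} (hρ0 : 0 ≤ ρ) (hρ1 : ρ < 1) :
    DiffContOnCl ℂ (fun z => dilate m a (ρ * z) w) (Metric.ball 0 1) := by
  refine DifferentiableOn.diffContOnCl fun z hz => DifferentiableAt.differentiableWithinAt ?_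
  rw [closure_ball _ one_ne_zero, mem_closedBall_zero_iff] at hz
  refine (differentiableAt_dilate H ha hs w (ξ := ρ * z) ?_).comp z (by fun_prop)
  rw [norm_mul, Complex.norm_real, Real.norm_of_nonneg hρ0]
  exact (mul_le_of_le_one_right hρ0 hz).trans_lt hρ1

theorem enorm_eq_ofReal_sqrt_sq (z : ℂ) : ‖z‖ₑ = ENNReal.ofReal (√‖z‖) ^ 2 := by
  rw [← ENNReal.ofReal_pow (Real.sqrt_nonneg _), Real.sq_sqrt (norm_nonneg _), ofReal_norm]

theorem continuous_dilate_flow (H : Weights m) (ha : ∀ ν, ‖a ν‖ ≤ A) {ρ : ℝ} (hρ0 : 0 ≤ ρ)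
    (hρ1 : ρ < 1) (w : Torus) : Continuous fun t : UnitAddCircle => dilate m a ρ (flow m t w) :=
  (continuous_dilate H ha (by simpa [abs_of_nonneg hρ0] using hρ1)).comp
    ((continuous_flow m).comp (by fun_prop : Continuous fun t : UnitAddCircle => (t, w)))

theorem enorm_dilate_flow_le (H : Weights m) (ha : ∀ ν, ‖a ν‖ ≤ A) (hs : HasAnalyticSpectrum a)
    (w : Torus) {r ρ : ℝ} (hr0 : 0 ≤ r) (hrρ : r < ρ) (hρ1 : ρ < 1) (t : UnitAddCircle) :
    ‖dilate m a r (flow m t w)‖ₑ ≤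
      poissonMaximal (fun s => ENNReal.ofReal (√‖dilate m a ρ (flow m s w)‖)) t ^ 2 := by
  have hρ0 : 0 < ρ := hr0.trans_lt hrρ
  have hq0 : 0 ≤ r / ρ := by positivity
  have hq1 : r / ρ < 1 := (div_lt_one hρ0).2 hrρ
  have hc := (continuous_dilate_flow H ha hρ0.le hρ1 w).norm.sqrt
  have h := sqrt_norm_le_poisson (diffContOnCl_dilate_mul H ha hs w hρ0.le hρ1) hq0 hq1 t
  simp only [← dilate_flow] at h
  have e : (ρ : ℂ) * ((r / ρ : ℝ) * AddCircle.toCircle t) = r * AddCircle.toCircle t := by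
    have : (ρ : ℂ) ≠ 0 := by exact_mod_cast hρ0.ne'
    push_cast
    field_simp
  rw [e, ← dilate_flow] at h
  rw [enorm_eq_ofReal_sqrt_sq]
  gcongr
  refine le_trans ?_ (le_iSup₂_of_le (r / ρ) ⟨hq0, hq1⟩ le_rfl)
  rw [poissonLIntegral_withDensity hc.measurable.ennreal_ofReal hq0 hq1]
  refine (ENNReal.ofReal_le_ofReal h).trans (le_of_eq ?_)
  have hk := continuous_poissonProfile_norm_sub hq0 hq1 t
  refine (ofReal_integral_eq_lintegral_ofReal ((hk.mul hc).integrable_of_hasCompactSupport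
    (HasCompactSupport.of_compactSpace _)) (Eventually.of_forall fun s =>
      mul_nonneg (poissonProfile_nonneg hq0 hq1 _) (Real.sqrt_nonneg _))).trans ?_
  refine lintegral_congr fun s => ?_
  rw [Pi.mul_apply, mul_comm, ENNReal.ofReal_mul (Real.sqrt_nonneg _)]

/-- The radial maximal function up to the radius `ρ`. -/
def truncatedMaximal (m : ℕ → ℕ) (a : (ℕ →₀ ℤ) → ℂ) (ρ : ℝ) (w : Torus) : ℝ≥0∞ :=
  ⨆ r ∈ Set.Ioo (0 : ℝ) ρ, ‖dilate m a (r : ℂ) w‖ₑ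

theorem truncatedMaximal_mono (w : Torus) : Monotone fun ρ => truncatedMaximal m a ρ w :=
  fun _ _ h => biSup_mono fun _ hr => ⟨hr.1, hr.2.trans_le h⟩

theorem maximal_eq_iSup (w : Torus) : maximal m a w = ⨆ n, truncatedMaximal m a (radius n) w := by
  refine le_antisymm (iSup₂_le fun r hr => ?_) (iSup_le fun n => ?_)
  · obtain ⟨n, hn⟩ := exists_lt_radius hr.2
    exact le_iSup_of_le n (le_iSup₂_of_le r ⟨hr.1, hn⟩ le_rfl)
  · exact truncatedMaximal_mono w (radius_lt_one n).le

theorem measurable_truncatedMaximal (H : Weights m) (ha : ∀ ν, ‖a ν‖ ≤ A) {ρ : ℝ} (hρ : ρ < 1) :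
    Measurable (truncatedMaximal m a ρ) := by
  refine LowerSemicontinuous.measurable ?_
  refine lowerSemicontinuous_biSup fun r hr => Continuous.lowerSemicontinuous ?_
  exact (continuous_dilate H ha
    (by simpa [abs_of_pos hr.1] using hr.2.trans hρ)).enorm

theorem lintegral_truncatedMaximal_le (H : Weights m) (ha : ∀ ν, ‖a ν‖ ≤ A)
    (hs : HasAnalyticSpectrum a) {ρ : ℝ} (hρ0 : 0 ≤ ρ) (hρ1 : ρ < 1) :
    ∫⁻ w, truncatedMaximal m a ρ w ∂haar ≤ 40 * ∫⁻ w, ‖dilate m a ρ w‖ₑ ∂haar := by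
  have hdm : Measurable fun w => ‖dilate m a ρ w‖ₑ :=
    (continuous_dilate H ha (by simpa [abs_of_nonneg hρ0] using hρ1)).enorm.measurable
  rw [lintegral_eq_lintegral_flow m (measurable_truncatedMaximal H ha hρ1),
    lintegral_eq_lintegral_flow m hdm, ← lintegral_const_mul' _ _ (by simp)]
  refine lintegral_mono fun w => ?_
  have hc := (continuous_dilate_flow H ha hρ0 hρ1 w).norm.sqrt
  calc ∫⁻ t, truncatedMaximal m a ρ (flow m t w)
      ≤ ∫⁻ t, poissonMaximal (fun s => ENNReal.ofReal (√‖dilate m a ρ (flow m s w)‖)) t ^ 2 :=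
        lintegral_mono fun t => iSup₂_le fun r hr =>
          enorm_dilate_flow_le H ha hs w hr.1.le hr.2 hρ1 t
    _ ≤ 40 * ∫⁻ t, ENNReal.ofReal (√‖dilate m a ρ (flow m t w)‖) ^ 2 :=
        lintegral_poissonMaximal_sq_le hc fun t => Real.sqrt_nonneg _
    _ = 40 * ∫⁻ t, ‖dilate m a ρ (flow m t w)‖ₑ := by simp only [enorm_eq_ofReal_sqrt_sq]

theorem lintegral_maximal_le (H : Weights m) (ha : ∀ ν, ‖a ν‖ ≤ A) (hs : HasAnalyticSpectrum a)
    {T : ℝ≥0∞} (hT : ∀ r : ℝ, 0 ≤ r → r < 1 → ∫⁻ w, ‖dilate m a r w‖ₑ ∂haar ≤ T) :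
    ∫⁻ w, maximal m a w ∂haar ≤ 40 * T := by
  simp only [maximal_eq_iSup]
  rw [lintegral_iSup fun n => measurable_truncatedMaximal H ha (radius_lt_one n)]
  · refine iSup_le fun n => (lintegral_truncatedMaximal_le H ha hs (radius_pos n).le
      (radius_lt_one n)).trans ?_
    gcongr
    exact hT _ (radius_pos n).le (radius_lt_one n)
  · exact fun p q hpq w => truncatedMaximal_mono w (radius_mono hpq)

end

section

variable {m : ℕ → ℕ} {a : (ℕ →₀ ℤ) → ℂ} {A : ℝ}

/-! ### Identification of the radial limits -/

theorem lintegral_le_of_ae_tendsto {X : Type*} [MeasurableSpace X] {μ : Measure X}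
    {f : ℕ → X → ℝ≥0∞} {g : X → ℝ≥0∞} {B : ℕ → ℝ≥0∞} {b : ℝ≥0∞}
    (hf : ∀ n, AEMeasurable (f n) μ)
    (h : ∀ᵐ x ∂μ, Tendsto (fun n => f n x) atTop (𝓝 (g x)))
    (hB : ∀ᶠ n in atTop, ∫⁻ x, f n x ∂μ ≤ B n) (hb : Tendsto B atTop (𝓝 b)) :
    ∫⁻ x, g x ∂μ ≤ b := by
  calc ∫⁻ x, g x ∂μ = ∫⁻ x, liminf (fun n => f n x) atTop ∂μ := by
        refine lintegral_congr_ae ?_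
        filter_upwards [h] with x hx using hx.liminf_eq.symm
    _ ≤ liminf (fun n => ∫⁻ x, f n x ∂μ) atTop := lintegral_liminf_le' hf
    _ ≤ liminf B atTop := liminf_le_liminf hB
    _ = b := hb.liminf_eq

theorem continuous_dilate_radius (H : Weights m) (ha : ∀ ν, ‖a ν‖ ≤ A) (n : ℕ) :
    Continuous (dilate m a (radius n : ℂ)) :=
  continuous_dilate H ha (by simpa [abs_of_pos (radius_pos n)] using radius_lt_one n)

theorem exists_measurable_radial_limit (H : Weights m) (ha : ∀ ν, ‖a ν‖ ≤ A)
    (h : ∀ᵐ w ∂haar, ∃ l : ℂ, Tendsto (fun r : ℝ => dilate m a (r : ℂ) w) (𝓝[<] 1) (𝓝 l)) :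
    ∃ L : Torus → ℂ, Measurable L ∧
      ∀ᵐ w ∂haar, Tendsto (fun r : ℝ => dilate m a (r : ℂ) w) (𝓝[<] 1) (𝓝 (L w)) := by
  obtain ⟨L, hL, hlim⟩ := measurable_limit_of_tendsto_metrizable_ae (μ := haar) (L := atTop)
    (f := fun n => dilate m a (radius n : ℂ))
    (fun n => (continuous_dilate_radius H ha n).measurable.aemeasurable) (by
      filter_upwards [h] with w ⟨l, hl⟩ using ⟨l, hl.comp tendsto_radius⟩)
  refine ⟨L, hL, ?_⟩
  filter_upwards [h, hlim] with w ⟨l, hl⟩ hw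
  rwa [tendsto_nhds_unique hw (hl.comp tendsto_radius)]

theorem ae_exists_tendsto_dilate_measureFourier (H : Weights m) {μ : ComplexMeasure Torus}
    (hs : HasOneSignedSpectrum (measureFourier μ)) :
    ∀ᵐ w ∂haar, ∃ l : ℂ,
      Tendsto (fun r : ℝ => dilate m (measureFourier μ) (r : ℂ) w) (𝓝[<] 1) (𝓝 l) :=
  ae_exists_tendsto_dilate H (norm_measureFourier_le μ) hs (tvNorm_ne_top μ)
    fun _ h0 h1 => lintegral_enorm_dilate_le H μ h0 h1

theorem norm_functionFourier_le {f : Torus → ℂ} (hf : Integrable f haar) (ν : ℕ →₀ ℤ) :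
    ‖functionFourier f ν‖ ≤ (tvNorm (haar.withDensityᵥ f)).toReal := by
  rw [← measureFourier_withDensityᵥ hf]
  exact norm_measureFourier_le _ ν

theorem ae_tendsto_dilate_functionFourier (H : Weights m) {f : Torus → ℂ}
    (hf : Integrable f haar) (hs : HasOneSignedSpectrum (functionFourier f)) :
    ∀ᵐ w ∂haar,
      Tendsto (fun r : ℝ => dilate m (functionFourier f) (r : ℂ) w) (𝓝[<] 1) (𝓝 (f w)) := by
  have hex := ae_exists_tendsto_dilate_measureFourier H (μ := haar.withDensityᵥ f)
    (by rwa [measureFourier_withDensityᵥ hf])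
  rw [measureFourier_withDensityᵥ hf] at hex
  obtain ⟨L, hL, hlim⟩ := exists_measurable_radial_limit H (norm_functionFourier_le hf) hex
  have hfm := hf.aestronglyMeasurable.aemeasurable
  have hzero : ∫⁻ w, ‖L w - f w‖ₑ ∂haar ≤ 0 := by
    refine lintegral_le_of_ae_tendsto
      (f := fun n w => ‖dilate m (functionFourier f) (radius n : ℂ) w - f w‖ₑ) (fun n => ?_) ?_
      (Eventually.of_forall fun n => le_rfl)
      ((tendsto_lintegral_enorm_dilate_sub H hf).comp tendsto_radius)
    · exact ((continuous_dilate_radius H (norm_functionFourier_le hf) n).measurable.aemeasurable.sub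
        hfm).enorm
    · filter_upwards [hlim] with w hw
      exact ((hw.comp tendsto_radius).sub_const (f w)).enorm
  have h0 := (lintegral_eq_zero_iff' (hL.aemeasurable.sub hfm).enorm).1 (le_antisymm hzero zero_le)
  filter_upwards [hlim, h0] with w hw h0
  rwa [sub_eq_zero.1 (enorm_eq_zero.1 h0)] at hw

/-- A measure singular to Haar measure is concentrated up to `ε` on a closed set which has an open
neighbourhood of Haar measure at most `ε`. -/
theorem exists_isClosed_isOpen_of_mutuallySingular {κ : Measure Torus} [IsFiniteMeasure κ]
    (h : κ ⟂ₘ haar) {ε : ℝ≥0∞} (hε : ε ≠ 0) :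
    ∃ K U : Set Torus, IsClosed K ∧ IsOpen U ∧ K ⊆ U ∧ κ Kᶜ ≤ ε ∧ haar U ≤ ε := by
  obtain ⟨S, hS, hκ, hh⟩ := h
  obtain ⟨K, hKS, hK, hKε⟩ := hS.compl.exists_isClosed_sdiff_lt (measure_ne_top κ _) hε
  have hK0 : haar K = 0 := measure_mono_null hKS hh
  obtain ⟨U, hKU, hU, hUε⟩ := K.exists_isOpen_lt_of_lt (μ := haar) ε
    (by rw [hK0]; exact pos_iff_ne_zero.2 hε)
  refine ⟨K, U, hK, hU, hKU, ?_, hUε.le⟩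
  calc κ Kᶜ ≤ κ (S ∪ Sᶜ \ K) := measure_mono fun x hx => by
        by_cases hxS : x ∈ S
        · exact Or.inl hxS
        · exact Or.inr ⟨hxS, hx⟩
    _ ≤ κ S + κ (Sᶜ \ K) := measure_union_le _ _
    _ ≤ ε := by rw [hκ, zero_add]; exact hKε.le

theorem ae_tendsto_dilate_of_mutuallySingular (H : Weights m) {μ : ComplexMeasure Torus}
    (hμ : μ.variation ⟂ₘ haar) (hs : HasOneSignedSpectrum (measureFourier μ)) :
    ∀ᵐ w ∂haar,
      Tendsto (fun r : ℝ => dilate m (measureFourier μ) (r : ℂ) w) (𝓝[<] 1) (𝓝 0) := by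
  obtain ⟨L, hL, hlim⟩ := exists_measurable_radial_limit H (norm_measureFourier_le μ)
    (ae_exists_tendsto_dilate_measureFourier H hs)
  have hsmall (ε : ℝ≥0∞) (hε : ε ≠ 0) : ∫⁻ w, min ‖L w‖ₑ 1 ∂haar ≤ ε + ε := by
    obtain ⟨K, U, hK, hU, hKU, hKε, hUε⟩ := exists_isClosed_isOpen_of_mutuallySingular hμ hε
    obtain ⟨φ, hφK, hφU, hφ⟩ := exists_continuous_zero_one_of_isClosed hK hU.isClosed_compl
      (Set.disjoint_compl_right_iff_subset.2 hKU)
    obtain ⟨B, hB, hBlim⟩ := exists_tendsto_lintegral_mul_enorm_dilate_le H μ φ.continuous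
      fun w => (hφ w).1
    have h1 : ∫⁻ w, ENNReal.ofReal (φ w) * ‖L w‖ₑ ∂haar ≤
        ∫⁻ w, ENNReal.ofReal (φ w) ∂μ.variation := by
      refine lintegral_le_of_ae_tendsto (fun n => ?_) ?_ (tendsto_radius.eventually hB)
        (hBlim.comp tendsto_radius)
      · exact (φ.continuous.measurable.ennreal_ofReal.mul (continuous_dilate_radius H
          (norm_measureFourier_le μ) n).measurable.enorm).aemeasurable
      · filter_upwards [hlim] with w hw
        exact ENNReal.Tendsto.const_mul (hw.comp tendsto_radius).enorm
          (Or.inr ENNReal.ofReal_ne_top)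
    have h2 : ∫⁻ w, ENNReal.ofReal (φ w) ∂μ.variation ≤ ε := by
      refine le_trans ?_ hKε
      rw [← lintegral_indicator_one hK.isOpen_compl.measurableSet]
      refine lintegral_mono fun w => ?_
      by_cases hw : w ∈ K
      · simp [hφK hw]
      · rw [Set.indicator_of_mem hw]
        simpa using (hφ w).2
    calc ∫⁻ w, min ‖L w‖ₑ 1 ∂haar
        ≤ ∫⁻ w, (ENNReal.ofReal (φ w) * ‖L w‖ₑ + U.indicator 1 w) ∂haar := by
          refine lintegral_mono fun w => ?_
          by_cases hw : w ∈ U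
          · rw [Set.indicator_of_mem hw]
            exact (min_le_right _ _).trans le_add_self
          · have : φ w = 1 := hφU hw
            rw [this, ENNReal.ofReal_one, one_mul]
            exact (min_le_left _ _).trans le_self_add
      _ = (∫⁻ w, ENNReal.ofReal (φ w) * ‖L w‖ₑ ∂haar) + haar U := by
          refine (lintegral_add_left (φ.continuous.measurable.ennreal_ofReal.mul hL.enorm) _).trans ?_
          rw [lintegral_indicator_one hU.measurableSet]
          rfl
      _ ≤ ε + ε := add_le_add (h1.trans h2) hUε
  have hzero : ∫⁻ w, min ‖L w‖ₑ 1 ∂haar = 0 := by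
    refine le_antisymm (ENNReal.le_of_forall_pos_le_add fun ε hε _ => ?_) zero_le
    have := hsmall (ε / 2 : ℝ≥0) (by simpa using hε.ne')
    rwa [← ENNReal.coe_add, add_halves, ← zero_add (ε : ℝ≥0∞)] at this
  have h0 := (lintegral_eq_zero_iff (hL.enorm.min measurable_const)).1 hzero
  filter_upwards [hlim, h0] with w hw h0
  have hLw : L w = 0 := by
    have h0 : min ‖L w‖ₑ 1 = 0 := h0
    rcases min_choice ‖L w‖ₑ 1 with h | h
    · exact enorm_eq_zero.1 (h ▸ h0)
    · exact absurd (h ▸ h0) one_ne_zero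
  rwa [hLw] at hw

theorem dilate_add (H : Weights m) {b : (ℕ →₀ ℤ) → ℂ} {B : ℝ} (ha : ∀ ν, ‖a ν‖ ≤ A)
    (hb : ∀ ν, ‖b ν‖ ≤ B) {ξ : ℂ} (hξ : ‖ξ‖ < 1) (w : Torus) :
    dilate m (fun ν => a ν + b ν) ξ w = dilate m a ξ w + dilate m b ξ w := by
  unfold dilate polyExtension
  rw [← (summable_norm_dilate H ha hξ w).of_norm.tsum_add (summable_norm_dilate H hb hξ w).of_norm]
  exact tsum_congr fun ν => add_mul _ _ _

theorem ae_tendsto_dilate_add_mutuallySingular (H : Weights m) {f : Torus → ℂ}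
    (hf : Integrable f haar) {μ : ComplexMeasure Torus} (hμ : μ.variation ⟂ₘ haar)
    (hsf : HasOneSignedSpectrum (functionFourier f))
    (hsμ : HasOneSignedSpectrum (measureFourier μ)) :
    ∀ᵐ w ∂haar, Tendsto
      (fun r : ℝ => dilate m (measureFourier (haar.withDensityᵥ f + μ)) (r : ℂ) w)
      (𝓝[<] 1) (𝓝 (f w)) := by
  filter_upwards [ae_tendsto_dilate_functionFourier H hf hsf,
    ae_tendsto_dilate_of_mutuallySingular H hμ hsμ] with w h1 h2
  have h := h1.add h2
  rw [add_zero] at h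
  refine h.congr' ?_
  filter_upwards [eventually_nhdsLT_one] with r hr
  rw [← dilate_add H (norm_functionFourier_le hf) (norm_measureFourier_le μ)
    (by simpa [abs_of_pos hr.1] using hr.2)]
  congr 1
  funext ν
  rw [measureFourier_add, measureFourier_withDensityᵥ hf]

end

end InfPolydisc

end

theorem mainTheorem8 (m : ℕ → ℕ) (hm : ∀ j, 0 < m j)
    (hsum : ∀ r : ℝ, 0 ≤ r → r < 1 → Summable fun j => r ^ m j) :
    -- the series defining `μ_ξ` converges absolutely at every point
    (∀ (μ : ComplexMeasure Torus) (ξ : ℂ), ‖ξ‖ < 1 → ∀ w : Torus,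
      Summable fun ν => ‖measureFourier μ ν * monomial ν (approach m ξ w)‖) ∧
    -- (i)
    (∀ μ : ComplexMeasure Torus,
      (∀ ξ : ℂ, ‖ξ‖ < 1 →
        Continuous (dilate m (measureFourier μ) ξ) ∧
        ∫⁻ w, ‖dilate m (measureFourier μ) ξ w‖ₑ ∂haar ≤ tvNorm μ) ∧
      (∀ g : C(Torus, ℂ),
        Tendsto (fun r : ℝ => ∫ w, g w * dilate m (measureFourier μ) (r : ℂ) w ∂haar)
          (𝓝[<] 1) (𝓝 (cintegral μ g)))) ∧
    -- (ii)
    (∃ C : ℝ≥0, ∀ μ : ComplexMeasure Torus, HasOneSignedSpectrum (measureFourier μ) →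
      ∀ t : ℝ, 0 < t →
        haar {w | ENNReal.ofReal t < maximal m (measureFourier μ) w} ≤
          C * tvNorm μ / ENNReal.ofReal t) ∧
    (∀ μ : ComplexMeasure Torus, HasOneSignedSpectrum (measureFourier μ) →
      ∀ᵐ w ∂haar, ∃ l : ℂ,
        Tendsto (fun r : ℝ => dilate m (measureFourier μ) (r : ℂ) w) (𝓝[<] 1) (𝓝 l)) ∧
    -- (iii)
    (∀ f : Torus → ℂ, Integrable f haar → HasOneSignedSpectrum (functionFourier f) →
      (∀ᵐ w ∂haar,
        Tendsto (fun r : ℝ => dilate m (functionFourier f) (r : ℂ) w) (𝓝[<] 1) (𝓝 (f w))) ∧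
      Tendsto (fun r : ℝ => ∫⁻ w, ‖dilate m (functionFourier f) (r : ℂ) w - f w‖ₑ ∂haar)
        (𝓝[<] 1) (𝓝 0)) ∧
    -- (iv)
    (∃ C : ℝ≥0, ∀ f : Torus → ℂ, MemHardyOne f →
      ∫⁻ w, maximal m (functionFourier f) w ∂haar ≤ C * ∫⁻ w, ‖f w‖ₑ ∂haar) ∧
    (∃ C : ℝ≥0, ∀ μ : ComplexMeasure Torus, HasAnalyticSpectrum (measureFourier μ) →
      ∫⁻ w, maximal m (measureFourier μ) w ∂haar ≤ C * tvNorm μ) ∧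
    -- radial limits of a measure with a singular part
    (∀ (μ μs : ComplexMeasure Torus) (f : Torus → ℂ), Integrable f haar →
      μs.variation ⟂ₘ haar → μ = haar.withDensityᵥ f + μs →
      HasOneSignedSpectrum (functionFourier f) → HasOneSignedSpectrum (measureFourier μs) →
      ∀ᵐ w ∂haar,
        Tendsto (fun r : ℝ => dilate m (measureFourier μ) (r : ℂ) w) (𝓝[<] 1) (𝓝 (f w))) := by
  have H : Weights m := ⟨hm, hsum⟩
  refine ⟨fun μ ξ hξ w => summable_norm_dilate H (norm_measureFourier_le μ) hξ w,
    fun μ => ⟨fun ξ hξ => ⟨continuous_dilate H (norm_measureFourier_le μ) hξ,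
      lintegral_enorm_dilate_complex_le H μ hξ⟩, tendsto_integral_mul_dilate H μ⟩,
    ⟨5, fun μ hs t ht => ?_⟩, fun μ hs => ae_exists_tendsto_dilate_measureFourier H hs,
    fun f hf hs => ⟨ae_tendsto_dilate_functionFourier H hf hs,
      tendsto_lintegral_enorm_dilate_sub H hf⟩,
    ⟨40, fun f hf => ?_⟩, ⟨40, fun μ hs => ?_⟩, ?_⟩
  · exact haar_lt_maximal_le H (norm_measureFourier_le μ) hs
      (fun r h0 h1 => lintegral_enorm_dilate_le H μ h0 h1) (by simpa using ht)
      ENNReal.ofReal_ne_top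
  · exact lintegral_maximal_le H (norm_functionFourier_le hf.1) hf.2
      fun r h0 h1 => lintegral_enorm_dilate_functionFourier_le H hf.1 h0 h1
  · exact lintegral_maximal_le H (norm_measureFourier_le μ) hs
      fun r h0 h1 => lintegral_enorm_dilate_le H μ h0 h1
  · rintro μ μs f hf hμs rfl hsf hsμ
    exact ae_tendsto_dilate_add_mutuallySingular H hf hμs hsf hsμ
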